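/- **Theorem (Fáry–Milnor).** A *knot* is the image $K=\gamma(\mathbb{R}/\mathbb{Z})$ of a continuous injective map $\gamma:\mathbb{R}/\mathbb{Z}\to\mathbb{R}^3$. Two subsets $A,B\subset\mathbb{R}^3$ are *ambient isotopic* if there are homeomorphisms $H_s:\mathbb{R}^3\to\mathbb{R}^3$, $s\in[0,1]$, with $(s,x)\mapsto H_s(x)$ continuous, $H_0=\mathrm{id}$ and $H_1(A)=B$. A knot is *tame* if it is ambient isotopic to a polygonal knot (a knot that is the union of the edges of a closed polygon), and *trivial* if it is ambient isotopic to the round circle $\{x^2+y^2=1,\ z=0\}$. The *total curvature* of a closed polygon whose consecutive vertices are distinct is the sum of its exterior angles, and the total curvature $\kappa(K)\in[0,\infty]$ of a knot $K$ is the supremum of the total curvatures of all closed polygons with vertices $\gamma(t_0),\gamma(t_1),\dots,\gamma(t_{m-1})$, where $m\ge 3$ and $t_0<t_1<\dots<t_{m-1}<t_0+1$. If $K$ is a nontrivial tame knot in $\mathbb{R}^3$, then $$\kappa(K)>4\pi .$$ -/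

import Mathlib

noncomputable section

/-- Euclidean three-space. -/
abbrev E3 : Type := EuclideanSpace ℝ (Fin 3)

/-- A knot: a parametrized simple closed curve in space, that is, a continuous injective map of the
circle `ℝ / ℤ` (hence a homeomorphism onto its image). -/
structure Knot where
  /-- the parametrization -/
  toFun : UnitAddCircle → E3
  continuous_toFun : Continuous toFun
  injective_toFun : Function.Injective toFun

/-- Two subsets of space are ambient isotopic: there is a continuous one-parameter family of
homeomorphisms of space that starts at the identity and ends at a homeomorphism carrying `A`
onto `B`. -/
def AmbientIsotopic (A B : Set E3) : Prop :=
  ∃ H : unitInterval → (E3 ≃ₜ E3),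
    Continuous (fun q : unitInterval × E3 => H q.1 q.2) ∧
    H 0 = Homeomorph.refl E3 ∧
    (H 1) '' A = B

/-- The standard round circle: the unit circle in the `xy`-plane. -/
def standardCircle : Set E3 := {x | x 0 ^ 2 + x 1 ^ 2 = 1 ∧ x 2 = 0}

/-- The total curvature of the closed polygon with cyclically ordered vertices
`p 0, p 1, …, p (n + 2)`: the sum of its exterior angles. Indices are taken modulo `n + 3`. -/
def polygonTotalCurvature {n : ℕ} (p : Fin (n + 3) → E3) : ℝ :=
  ∑ i : Fin (n + 3), InnerProductGeometry.angle (p (i + 1) - p i) (p (i + 2) - p (i + 1))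

namespace Knot

/-- The underlying point set of a knot. -/
def image (K : Knot) : Set E3 := Set.range K.toFun

/-- A knot is polygonal if its image is made up of the edges of a closed polygon. -/
def IsPolygonal (K : Knot) : Prop :=
  ∃ (n : ℕ) (p : Fin (n + 3) → E3), K.image = ⋃ i : Fin (n + 3), segment ℝ (p i) (p (i + 1))

/-- A knot is tame if it is ambient isotopic to a polygonal knot. -/
def IsTame (K : Knot) : Prop :=
  ∃ L : Knot, L.IsPolygonal ∧ AmbientIsotopic K.image L.image

/-- A knot is trivial if it is ambient isotopic to the standard round circle. -/
def IsTrivial (K : Knot) : Prop :=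
  AmbientIsotopic K.image standardCircle

/-- The total curvature of a knot, a value in `[0, ∞]`: the supremum of the total curvatures of the
closed polygons inscribed in it. The vertices of an inscribed polygon are the points of the knot at
parameters `t 0 < t 1 < … < t (n + 2) < t 0 + 1`. -/
def totalCurvature (K : Knot) : ENNReal :=
  ⨆ (n : ℕ) (t : Fin (n + 3) → ℝ) (_ : StrictMono t) (_ : t (Fin.last (n + 2)) < t 0 + 1),
    ENNReal.ofReal (polygonTotalCurvature fun i => K.toFun (t i : UnitAddCircle))

end Knot

end

/-!
The total curvature of a knot is compared with the number of times its height functions turn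
round. For a vector `v`, let `h` be the height `t ↦ ⟨v, γ t⟩` of the parametrization `γ : ℝ → ℝ³` of
period one. It has a *zigzag with `n` peaks* (`HasZigzag n h`) if there are `2 n` cyclically ordered
parameters along which `h` alternately goes down and up.

*Integral geometry.* For nonzero `a`, `b`, the proportion of vectors `v` of the unit ball for which
`⟨v, a⟩` and `⟨v, b⟩` have opposite signs is at most `∠ a b / π`
(`ballMeasure_inner_mul_inner_neg_le`). So the total curvature of a closed polygon is at least `π`
times the average number of direction changes of its height functions. If every `v ≠ 0` gives a
zigzag with two peaks, then, by compactness of the sphere, a fine inscribed polygon has at least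
four direction changes for almost every `v`, which yields total curvature at least `4 π`. The
inequality is strict as soon as some `v` gives a zigzag with three peaks: a neighbourhood of that
`v` then contributes at least six direction changes (`four_pi_lt_sum_angle`).

*A direction with three peaks exists* (`exists_hasZigzag_three`). Otherwise the levels `u` such that
`h - u` changes sign four times form, for each `v`, a nonempty interval, and a level `c v` can be
chosen continuously in `v ≠ 0` with `c (-v) = -c v`. In the absence of a third peak, any two
alternating sequences for `h - c v` interlace after an even shift of the index, and that shift is
unique; this labels the alternating sequences consistently over a square that parametrizes a
hemisphere. Replacing `v` by `-v` exchanges positive and negative terms, so it amounts to an odd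
shift, the same all along the boundary. Going half round the boundary twice brings back the initial
sequence shifted by twice an odd number, whereas by uniqueness the shift has to be zero
(`not_forall_exists_isAlternating`).

*A direction without two peaks unknots* (`Knot.isTrivial_of_not_hasZigzag`). After two shears the
direction is vertical. The height then is constant or rises weakly along one arc and falls weakly
along the other (`exists_isUnimodal`). Its plateaus are tilted by moving points along vertical
lines, with functions obtained from Tietze's extension theorem (`IsUnimodal.isotopicIn_circle`).
Once the height is strictly monotone on both arcs, the curve meets every horizontal plane between
its bottom and its top in two points; translations, rotations and radial maps of these planes carry
the pairs of points to those of a round circle (`isotopicIn_circle_of_strict`). -/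

noncomputable section

/-! ### Zigzags and alternating sequences -/

/-- A zigzag with `n` peaks of a function `h` of period one: a bi-infinite increasing sequence of
parameters, periodic modulo the period of `h`, on which `h` is at each even index strictly larger
than at the two neighbouring odd indices. -/
structure IsZigzag (n : ℕ) (h : ℝ → ℝ) (x : ℤ → ℝ) : Prop where
  strictMono : StrictMono x
  period : ∀ j, x (j + 2 * n) = x j + 1
  right_lt (i : ℤ) : Even i → h (x (i + 1)) < h (x i)
  left_lt (i : ℤ) : Even i → h (x (i - 1)) < h (x i)

/-- `h` has a zigzag with `n` peaks. -/
def HasZigzag (n : ℕ) (h : ℝ → ℝ) : Prop := ∃ x, IsZigzag n h x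

/-- A bi-infinite increasing sequence of parameters, with four terms per period, along which `f` is
positive at even and negative at odd indices. -/
structure IsAlternating (f : ℝ → ℝ) (x : ℤ → ℝ) : Prop where
  strictMono : StrictMono x
  period : ∀ j, x (j + 4) = x j + 1
  pos {i : ℤ} : Even i → 0 < f (x i)
  neg {i : ℤ} : Odd i → f (x i) < 0

/-- The valleys of a zigzag are the peaks of a zigzag of the opposite function. -/
theorem HasZigzag.of_neg {n : ℕ} {h : ℝ → ℝ} (hh : HasZigzag n fun t => -h t) : HasZigzag n h := by
  obtain ⟨x, hx⟩ := hh
  refine ⟨fun j => x (j + 1), fun _ _ hij => hx.strictMono (by gcongr), fun j => ?_, fun i hi => ?_,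
    fun i hi => ?_⟩
  · rw [← hx.period]; ring_nf
  · have := hx.left_lt (i + 2) (by grind)
    rw [show i + 2 - 1 = i + 1 by ring] at this
    simpa [add_assoc] using this
  · simpa using hx.right_lt i hi

theorem HasZigzag.const_mul {n : ℕ} {h : ℝ → ℝ} (hh : HasZigzag n h) {c : ℝ} (hc : c ≠ 0) :
    HasZigzag n fun t => c * h t := by
  have key : ∀ c : ℝ, 0 < c → HasZigzag n fun t => c * h t := fun c hc => by
    obtain ⟨x, hx⟩ := hh
    exact ⟨x, hx.strictMono, hx.period, fun i hi => mul_lt_mul_of_pos_left (hx.right_lt i hi) hc,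
      fun i hi => mul_lt_mul_of_pos_left (hx.left_lt i hi) hc⟩
  rcases hc.lt_or_gt with hc | hc
  · exact HasZigzag.of_neg (by simpa using key (-c) (neg_pos.2 hc))
  · exact key c hc

/-- Finitely many increasing parameters within one period extend to a sequence that gains one every
`N` terms. The last two clauses describe its terms by quotient and remainder of the index. -/
theorem exists_periodic_extension {N : ℕ} (hN : 0 < N) (y : ℕ → ℝ)
    (hy : ∀ i, i + 1 < N → y i < y (i + 1)) (hlast : y (N - 1) < y 0 + 1) :
    ∃ x : ℤ → ℝ, StrictMono x ∧ (∀ j, x (j + N) = x j + 1) ∧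
      (∀ (q : ℤ) (r : ℕ), r < N → x (r + N * q) = y r + q) ∧
      ∀ j : ℤ, ∃ (q : ℤ) (r : ℕ), r < N ∧ j = r + N * q := by
  have hn' : (0 : ℤ) < N := by positivity
  let x : ℤ → ℝ := fun j => y (j % N).toNat + (j / N : ℤ)
  have hx : ∀ (q : ℤ) (r : ℕ), r < N → x (r + N * q) = y r + q := by
    intro q r hr
    have h1 : ((r : ℤ) + N * q) % N = r := by
      rw [Int.add_mul_emod_self_left]
      exact Int.emod_eq_of_lt (by positivity) (by exact_mod_cast hr)
    have h2 : ((r : ℤ) + N * q) / N = q := by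
      rw [Int.add_mul_ediv_left _ _ hn'.ne', Int.ediv_eq_zero_of_lt (by positivity)
        (by exact_mod_cast hr), zero_add]
    simp only [x, h1, h2, Int.toNat_natCast]
  have hdecomp : ∀ j : ℤ, ∃ (q : ℤ) (r : ℕ), r < N ∧ j = r + N * q := by
    intro j
    refine ⟨j / N, (j % N).toNat, ?_, ?_⟩
    · have := Int.emod_lt_of_pos j hn'
      have := Int.emod_nonneg j hn'.ne'
      omega
    · rw [Int.toNat_of_nonneg (Int.emod_nonneg j hn'.ne')]
      exact (Int.emod_add_mul_ediv j _).symm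
  refine ⟨x, ?_, ?_, hx, hdecomp⟩
  · refine strictMono_int_of_lt_succ fun j => ?_
    obtain ⟨q, r, hr, rfl⟩ := hdecomp j
    rw [hx q r hr]
    rcases Nat.lt_or_ge (r + 1) N with h1 | h1
    · have : (r : ℤ) + N * q + 1 = ((r + 1 : ℕ) : ℤ) + N * q := by push_cast; ring
      rw [this, hx q (r + 1) h1]
      linarith [hy r h1]
    · have hr' : r = N - 1 := by omega
      have : (r : ℤ) + N * q + 1 = ((0 : ℕ) : ℤ) + N * (q + 1) := by
        have : (r : ℤ) = N - 1 := by omega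
        rw [this]; push_cast; ring
      rw [this, hx (q + 1) 0 (by omega), hr']
      push_cast
      linarith
  · intro j
    obtain ⟨q, r, hr, rfl⟩ := hdecomp j
    rw [hx q r hr, show (r : ℤ) + N * q + N = r + N * (q + 1) by ring, hx _ r hr]
    push_cast; ring

theorem IsAlternating.of_lt {f : ℝ → ℝ} (hper : Function.Periodic f 1) {a b c d : ℝ}
    (hab : a < b) (hbc : b < c) (hcd : c < d) (hda : d < a + 1)
    (ha : 0 < f a) (hb : f b < 0) (hc : 0 < f c) (hd : f d < 0) : ∃ x, IsAlternating f x := by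
  obtain ⟨x, hmono, hp, hx, hdec⟩ := exists_periodic_extension (N := 4) (by norm_num)
    (fun i => ![a, b, c, d] (Fin.ofNat 4 i)) (fun i hi => by
      have : i < 3 := by omega
      interval_cases i
      · exact hab
      · exact hbc
      · exact hcd) hda
  refine ⟨x, hmono, hp, ?_, ?_⟩ <;>
  · intro i hi
    obtain ⟨q, r, hr, rfl⟩ := hdec i
    rw [hx q r hr, show f (![a, b, c, d] (Fin.ofNat 4 r) + q) = f (![a, b, c, d] (Fin.ofNat 4 r)) by
      simpa using hper.int_mul q _]
    interval_cases r <;> first | assumption | (exfalso; push_cast at hi; grind)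

theorem HasZigzag.three_of_lt {h : ℝ → ℝ} (hper : Function.Periodic h 1) {a b c d e f : ℝ}
    (hab : a < b) (hbc : b < c) (hcd : c < d) (hde : d < e) (hef : e < f) (hfa : f < a + 1)
    (hba : h b < h a) (hbc' : h b < h c) (hdc : h d < h c) (hde' : h d < h e) (hfe : h f < h e)
    (hfa' : h f < h a) : HasZigzag 3 h := by
  obtain ⟨x, hmono, hp, hx, hdec⟩ := exists_periodic_extension (N := 6) (by norm_num)
    (fun i => ![a, b, c, d, e, f] (Fin.ofNat 6 i)) (fun i hi => by
      have : i < 5 := by omega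
      interval_cases i
      · exact hab
      · exact hbc
      · exact hcd
      · exact hde
      · exact hef) hfa
  have hh : ∀ (q : ℤ) (r : ℕ), r < 6 →
      h (x (r + (6 : ℕ) * q)) = h (![a, b, c, d, e, f] (Fin.ofNat 6 r)) := fun q r hr => by
    rw [hx q r hr]; simpa using hper.int_mul q _
  refine ⟨x, hmono, hp, ?_, ?_⟩
  · intro i hi
    obtain ⟨q, r, hr, rfl⟩ := hdec i
    have hs : ((r : ℤ) + (6 : ℕ) * q) + 1 = ((r + 1 : ℕ) : ℤ) + (6 : ℕ) * q := by push_cast; ring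
    have hr5 : r + 1 < 6 := by push_cast at hi; grind
    rw [hs, hh q r hr, hh q _ hr5]
    interval_cases r <;> first | assumption | (exfalso; push_cast at hi; grind)
  · intro i hi
    obtain ⟨q, r, hr, rfl⟩ := hdec i
    rw [hh q r hr]
    rcases Nat.eq_zero_or_pos r with rfl | hr0
    · rw [show ((0 : ℕ) : ℤ) + (6 : ℕ) * q - 1 = ((5 : ℕ) : ℤ) + (6 : ℕ) * (q - 1) by
        push_cast; ring, hh _ 5 (by norm_num)]
      exact hfa'
    · obtain ⟨s, rfl⟩ : ∃ s, r = s + 1 := ⟨r - 1, by omega⟩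
      rw [show ((s + 1 : ℕ) : ℤ) + (6 : ℕ) * q - 1 = (s : ℤ) + (6 : ℕ) * q by push_cast; ring,
        hh _ s (by omega)]
      have hs5 : s < 5 := by omega
      interval_cases s <;> first | assumption | (exfalso; push_cast at hi; grind)

/-- A level that separates two peaks from two valleys is crossed four times per period. -/
theorem HasZigzag.exists_isAlternating {h : ℝ → ℝ} (hper : Function.Periodic h 1)
    (hh : HasZigzag 2 h) :
    ∃ (u : ℝ) (x : ℤ → ℝ), IsAlternating (fun t => h t - u) x := by
  obtain ⟨x, hx⟩ := hh
  have e4 := hx.period 0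
  norm_num at e4
  have h10 := hx.right_lt 0 (by decide)
  have h12 := hx.left_lt 2 (by decide)
  have h32 := hx.right_lt 2 (by decide)
  have h30 : h (x 3) < h (x 0) := by
    have := hx.left_lt 4 (by decide)
    rw [e4, hper] at this
    exact this
  norm_num at h10 h12 h32
  obtain ⟨u, hu1, hu2⟩ := exists_between
    (show max (h (x 1)) (h (x 3)) < min (h (x 0)) (h (x 2)) by simp [*])
  simp only [max_lt_iff, lt_min_iff] at hu1 hu2
  exact ⟨u, IsAlternating.of_lt (fun t => by simp [hper t])
      (hx.strictMono (by norm_num : (0 : ℤ) < 1))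
    (hx.strictMono (by norm_num : (1 : ℤ) < 2)) (hx.strictMono (by norm_num : (2 : ℤ) < 3))
    (e4 ▸ hx.strictMono (by norm_num : (3 : ℤ) < 4)) (by linarith) (by linarith) (by linarith)
    (by linarith)⟩

theorem IsAlternating.isZigzag {f : ℝ → ℝ} {x : ℤ → ℝ} (hx : IsAlternating f x) :
    IsZigzag 2 f x where
  strictMono := hx.strictMono
  period := hx.period
  right_lt := fun _ hi => (hx.neg hi.add_one).trans (hx.pos hi)
  left_lt := fun _ hi => (hx.neg (hi.sub_odd odd_one)).trans (hx.pos hi)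

theorem HasZigzag.two_of_lt {h : ℝ → ℝ} (hper : Function.Periodic h 1) {a b c d : ℝ}
    (hab : a < b) (hbc : b < c) (hcd : c < d) (hda : d < a + 1)
    (hba : h b < h a) (hbc' : h b < h c) (hdc : h d < h c) (hda' : h d < h a) : HasZigzag 2 h := by
  obtain ⟨u, hu1, hu2⟩ := exists_between (max_lt (lt_min hba hbc') (lt_min hda' hdc))
  obtain ⟨h1, h2⟩ := max_lt_iff.1 hu1
  obtain ⟨h3, h4⟩ := lt_min_iff.1 hu2
  obtain ⟨x, hx⟩ := IsAlternating.of_lt (f := fun t => h t - u) (fun t => by simp only [hper t])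
    hab hbc hcd hda (by linarith) (by linarith) (by linarith) (by linarith)
  exact ⟨x, hx.strictMono, hx.period, fun i hi =>
      sub_lt_sub_iff_right u |>.1 (hx.isZigzag.right_lt i hi),
    fun i hi => sub_lt_sub_iff_right u |>.1 (hx.isZigzag.left_lt i hi)⟩

namespace IsAlternating

variable {f : ℝ → ℝ} {x y w : ℤ → ℝ}

theorem period_mul (hx : IsAlternating f x) (k : ℕ) (j : ℤ) : x (j + 4 * k) = x j + k := by
  induction k with
  | zero => simp
  | succ k ih => push_cast; rw [← add_assoc, ← ih, ← hx.period]; ring_nf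

theorem shift_even (hx : IsAlternating f x) {k : ℤ} (hk : Even k) :
    IsAlternating f (fun j => x (j + k)) where
  strictMono := fun _ _ hij => hx.strictMono (by gcongr)
  period := fun j => by rw [← hx.period]; ring_nf
  pos := fun hi => hx.pos (hi.add hk)
  neg := fun hi => hx.neg (hi.add_even hk)

theorem shift_odd (hx : IsAlternating f x) {k : ℤ} (hk : Odd k) :
    IsAlternating (fun t => -f t) (fun j => x (j + k)) where
  strictMono := fun _ _ hij => hx.strictMono (by gcongr)
  period := fun j => by rw [← hx.period]; ring_nf
  pos := fun hi => neg_pos.2 (hx.neg (hi.add_odd hk))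
  neg := fun hi => neg_neg_iff_pos.2 (hx.pos (hi.add_odd hk))

theorem ne_of_parity (hx : IsAlternating f x) (hy : IsAlternating f y) {i j : ℤ}
    (hij : Odd (i - j)) : x i ≠ y j := by
  intro heq
  rcases Int.even_or_odd i with hi | hi
  · have hj : Odd j := by grind
    have := hx.pos hi
    have := hy.neg hj
    rw [heq] at *; linarith
  · have hj : Even j := by grind
    have := hx.neg hi
    have := hy.pos hj
    rw [heq] at *; linarith

/-- Without three peaks, two consecutive terms of `x` cannot be followed, within the same period, by
four consecutive terms of `y` that continue the alternation of signs. -/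
theorem not_six (hf : Function.Periodic f 1) (h3 : ¬ HasZigzag 3 f)
    (hx : IsAlternating f x) (hy : IsAlternating f y) {i j : ℤ} (hij : Even (i - j))
    (h1 : x (i + 1) < y j) (h2 : y (j + 3) < x i + 1) : False := by
  have m1 := hx.strictMono (show i < i + 1 by omega)
  have n1 := hy.strictMono (show j < j + 1 by omega)
  have n2 := hy.strictMono (show j + 1 < j + 2 by omega)
  have n3 := hy.strictMono (show j + 2 < j + 3 by omega)
  rcases Int.even_or_odd i with hi | hi
  · have hj : Even j := by grind
    have a0 := hx.pos hi
    have a1 := hx.neg hi.add_one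
    have b0 := hy.pos hj
    have b1 := hy.neg hj.add_one
    have b2 := hy.pos (i := j + 2) (by grind)
    have b3 := hy.neg (i := j + 3) (by grind)
    exact h3 (HasZigzag.three_of_lt hf m1 h1 n1 n2 n3 h2 (by linarith) (by linarith) (by linarith)
      (by linarith) (by linarith) (by linarith))
  · have hj : Odd j := by grind
    have a0 := hx.neg hi
    have a1 := hx.pos hi.add_one
    have b0 := hy.neg hj
    have b1 := hy.pos hj.add_one
    have b2 := hy.neg (i := j + 2) (by grind)
    have b3 := hy.pos (i := j + 3) (by grind)
    refine h3 (HasZigzag.of_neg <| HasZigzag.three_of_lt (fun t => by simp [hf t]) m1 h1 n1 n2 n3 h2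
        ?_ ?_ ?_ ?_ ?_ ?_) <;>
    linarith

end IsAlternating

/-- Two sequences are aligned if each term of either is below the next term of the other. For
increasing sequences this says that the term of index `j` of either lies strictly between the terms
of indices `j - 1` and `j + 1` of the other. -/
def Aligned (x y : ℤ → ℝ) : Prop := ∀ j, x j < y (j + 1) ∧ y j < x (j + 1)

namespace Aligned

variable {f : ℝ → ℝ} {x y w : ℤ → ℝ}

theorem symm (hxy : Aligned x y) : Aligned y x := fun j => (hxy j).symm

theorem shift (hxy : Aligned x y) (k : ℤ) :
    Aligned (fun j => x (j + k)) (fun j => y (j + k)) := fun j => by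
  simpa only [add_right_comm] using hxy (j + k)

/-- Without three peaks, alternating sequences aligned at one index are aligned everywhere. -/
theorem of_lt_of_lt (hf : Function.Periodic f 1) (h3 : ¬ HasZigzag 3 f)
    (hx : IsAlternating f x) (hy : IsAlternating f y) {j₀ : ℤ}
    (h1 : y (j₀ - 1) < x j₀) (h2 : x j₀ < y (j₀ + 1)) : Aligned x y := by
  -- a failure at the next index leaves room for six alternating terms in one period
  have step : ∀ j, (y (j - 1) < x j ∧ x j < y (j + 1)) → y j < x (j + 1) ∧ x (j + 1) <
      y (j + 2) := by
    rintro j ⟨ha, hb⟩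
    constructor
    · by_contra! hc
      have hc' := lt_of_le_of_ne hc (hx.ne_of_parity hy (by simp))
      refine hx.not_six hf h3 hy (i := j) (j := j) (by simp) hc' ?_
      rw [show j + 3 = j - 1 + 4 by ring, hy.period]; linarith
    · by_contra! hc
      have hc' := lt_of_le_of_ne hc (hy.ne_of_parity hx (by ring_nf; decide))
      refine hy.not_six hf h3 hx (i := j + 1) (j := j + 1) (by simp) (by rwa [add_assoc]) ?_
      rw [show j + 1 + 3 = j + 4 by ring, hx.period]; linarith
  have up : ∀ n : ℕ, y (j₀ + n - 1) < x (j₀ + n) ∧ x (j₀ + n) < y (j₀ + n + 1) := by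
    intro n
    induction n with
    | zero => simpa using ⟨h1, h2⟩
    | succ n ih =>
      have := step _ ih
      push_cast
      constructor
      · convert this.1 using 2 <;> ring
      · convert this.2 using 2 <;> ring
  -- smaller indices are reached by periodicity
  have perx := hx.period_mul
  have pery := hy.period_mul
  have all : ∀ j, y (j - 1) < x j ∧ x j < y (j + 1) := by
    intro j
    obtain ⟨k, n, hk⟩ : ∃ k n : ℕ, j + 4 * k = j₀ + n :=
      ⟨(j₀ - j).toNat, (j + 4 * (j₀ - j).toNat - j₀).toNat, by omega⟩
    have := up n
    rw [← hk, perx, add_sub_right_comm, pery, add_right_comm, pery] at this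
    exact ⟨by linarith [this.1], by linarith [this.2]⟩
  exact fun j => ⟨(all j).2, by simpa using (all (j + 1)).1⟩

theorem exists_shift (hf : Function.Periodic f 1) (h3 : ¬ HasZigzag 3 f)
    (hx : IsAlternating f x) (hy : IsAlternating f y) :
    ∃ k, Even k ∧ Aligned x (fun j => y (j + k)) := by
  have pery := hy.period_mul
  obtain ⟨k1, hk1⟩ : ∃ k : ℤ, ∀ z, y (2 * z - 1) ≤ x 0 → z ≤ k := by
    obtain ⟨N, hN⟩ := exists_nat_gt (x 0 - y (-1))
    refine ⟨2 * N, fun z hz => ?_⟩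
    by_contra! hc
    have := hy.strictMono.monotone (show -1 + 4 * (N : ℤ) ≤ 2 * z - 1 by omega)
    rw [pery] at this; linarith
  obtain ⟨k2, hk2⟩ : ∃ k : ℤ, y (2 * k - 1) ≤ x 0 := by
    obtain ⟨N, hN⟩ := exists_nat_gt (y (-1) - x 0)
    refine ⟨-2 * N, ?_⟩
    have := pery N (-1 - 4 * N)
    rw [sub_add_cancel] at this
    rw [show 2 * (-2 * (N : ℤ)) - 1 = -1 - 4 * N by ring]; linarith
  -- the last negative term of `y` before `x 0` receives the index `-1`
  obtain ⟨m, hm, hmax⟩ := Int.exists_greatest_of_bdd ⟨k1, hk1⟩ ⟨k2, hk2⟩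
  refine ⟨2 * m, even_two_mul m, ?_⟩
  have hy' := hy.shift_even (even_two_mul m)
  refine of_lt_of_lt hf h3 hx hy' (j₀ := 0) ?_ ?_
  · refine lt_of_le_of_ne ?_ (hy'.ne_of_parity hx (by decide))
    rwa [show (0 : ℤ) - 1 + 2 * m = 2 * m - 1 by ring]
  · by_contra! hc
    have := hmax (m + 1) (by rwa [show 2 * (m + 1) - 1 = 0 + 1 + 2 * m by ring])
    omega

theorem even_shift_unique {k : ℤ} (hy : StrictMono y) (hxy : Aligned x y)
    (hk : Even k) (h : Aligned x (fun j => y (j + k))) : k = 0 := by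
  by_contra hne
  rcases lt_or_gt_of_ne hne with hlt | hgt
  · have : k ≤ -2 := by grind
    have h1 := (h 0).1
    have h2 := (hxy (-1)).2
    have h3 := hy.monotone (show 0 + 1 + k ≤ -1 by omega)
    norm_num at h1 h2 h3
    linarith
  · have : 2 ≤ k := by grind
    have h1 := (h 0).2
    have h2 := (hxy 1).1
    have h3 := hy.monotone (show 2 ≤ k by omega)
    norm_num at h1 h2 h3
    linarith

theorem trans (hf : Function.Periodic f 1) (h3 : ¬ HasZigzag 3 f)
    (hx : IsAlternating f x) (hy : IsAlternating f y)
    (hw : IsAlternating f w) (hxy : Aligned x y) (hyw : Aligned y w) : Aligned x w := by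
  refine of_lt_of_lt hf h3 hx hw (j₀ := 0) ?_ ?_
  · by_contra! hc
    have hc' := lt_of_le_of_ne hc (hx.ne_of_parity hw (by decide))
    -- `y (-1) < x 0 < w (-1) < y 0`
    have a1 := (hxy (-1)).2
    have a2 := (hyw (-1)).2
    have a3 := hy.period (-1)
    norm_num at a1 a2 a3 hc'
    have b0 := hx.pos (i := 0) (by decide)
    have b1 := hw.neg (i := -1) (by decide)
    have b2 := hy.pos (i := 0) (by decide)
    have b3 := hy.neg (i := 1) (by decide)
    have b4 := hy.pos (i := 2) (by decide)
    have b5 := hy.neg (i := 3) (by decide)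
    refine h3 (HasZigzag.three_of_lt hf hc' a2 (hy.strictMono (by decide : (0 : ℤ) < 1))
      (hy.strictMono (by decide : (1 : ℤ) < 2)) (hy.strictMono (by decide : (2 : ℤ) < 3))
      ?_ ?_ ?_ ?_ ?_ ?_ ?_) <;> linarith
  · by_contra! hc
    have hc' := lt_of_le_of_ne hc (hw.ne_of_parity hx (by decide))
    -- `w 1 < x 0 < y 1 < w 2`
    have a1 := (hxy 0).1
    have a2 := (hyw 1).1
    have a3 := hw.period 1
    norm_num at a1 a2 a3 hc'
    have b0 := hx.pos (i := 0) (by decide)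
    have b1 := hy.neg (i := 1) (by decide)
    have b2 := hw.pos (i := 2) (by decide)
    have b3 := hw.neg (i := 3) (by decide)
    have b4 := hw.pos (i := 4) (by decide)
    have b5 := hw.neg (i := 5) (by decide)
    refine h3 (HasZigzag.three_of_lt hf a1 a2 (hw.strictMono (by decide : (2 : ℤ) < 3))
      (hw.strictMono (by decide : (3 : ℤ) < 4)) (hw.strictMono (by decide : (4 : ℤ) < 5))
      ?_ ?_ ?_ ?_ ?_ ?_ ?_) <;> linarith

end Aligned

/-! ### Levels and grids of alternating sequences -/

section Level

variable {h : ℝ → ℝ}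

/-- Without three peaks, the levels that are crossed four times per period form an interval. The
peaks are taken from the higher level `u₂` and the valleys from the lower level `u₁`; these
interlace. -/
theorem IsAlternating.of_between (hper : Function.Periodic h 1) (h3 : ¬ HasZigzag 3 h) {u₁ u u₂ : ℝ}
    (h1 : u₁ ≤ u) (h2 : u ≤ u₂) (hex₁ : ∃ x, IsAlternating (fun t => h t - u₁) x)
    (hex₂ : ∃ x, IsAlternating (fun t => h t - u₂) x) : ∃ x,
      IsAlternating (fun t => h t - u) x := by
  obtain ⟨x, hx⟩ := hex₁
  obtain ⟨y, hy⟩ := hex₂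
  have xn : ∀ {i : ℤ}, Odd i → h (x i) < u₁ := fun hi => by linarith [hx.neg hi]
  have yp : ∀ {i : ℤ}, Even i → u₂ < h (y i) := fun hi => by linarith [hy.pos hi]
  have hne : ∀ {i j : ℤ}, Odd i → Even j → y j ≠ x i := fun hi hj heq => by
    have a1 := xn hi
    have a2 := yp hj
    rw [heq] at a2; linarith
  -- three consecutive terms of `x` between two consecutive peaks of `y` would be a third peak
  have key : ∀ i j : ℤ, Odd i → Even j → y j < x i → x (i + 2) < y (j + 2) → False := by
    intro i j hi hj hl hr
    have p := hy.period j
    have a0 := yp hj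
    have a1 := xn hi
    have a2 := hx.pos hi.add_one
    have a3 := xn (i := i + 2) (by grind)
    have a4 := yp (i := j + 2) (by grind)
    have a5 := hy.neg (i := j + 3) (by grind)
    refine h3 (HasZigzag.three_of_lt hper hl (hx.strictMono (show i < i + 1 by omega))
      (hx.strictMono (show i + 1 < i + 2 by omega)) hr (hy.strictMono (show j + 2 < j + 3 by omega))
      (p ▸ hy.strictMono (show j + 3 < j + 4 by omega)) ?_ ?_ ?_ ?_ ?_ ?_) <;> linarith
  obtain ⟨k1, hk1⟩ : ∃ k : ℤ, ∀ z, y (2 * z) ≤ x 1 → z ≤ k := by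
    obtain ⟨N, hN⟩ := exists_nat_gt (x 1 - y 0)
    refine ⟨2 * N, fun z hz => ?_⟩
    by_contra! hc
    have := hy.strictMono.monotone (show 0 + 4 * (N : ℤ) ≤ 2 * z by omega)
    rw [hy.period_mul] at this; linarith
  obtain ⟨k2, hk2⟩ : ∃ k : ℤ, y (2 * k) ≤ x 1 := by
    obtain ⟨N, hN⟩ := exists_nat_gt (y 0 - x 1)
    refine ⟨-2 * N, ?_⟩
    have := hy.period_mul N (0 - 4 * N)
    rw [sub_add_cancel] at this
    rw [show 2 * (-2 * (N : ℤ)) = 0 - 4 * N by ring]; linarith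
  -- the valley `x 1` lies between the consecutive peaks `y (2 * m)` and `y (2 * m + 2)`
  obtain ⟨m, hm, hmax⟩ := Int.exists_greatest_of_bdd ⟨k1, hk1⟩ ⟨k2, hk2⟩
  have hj : Even (2 * m) := even_two_mul m
  have hl : y (2 * m) < x 1 := lt_of_le_of_ne hm (hne (by decide) hj)
  have hr : x 1 < y (2 * m + 2) := by
    by_contra! hc
    have := hmax (m + 1) (by rwa [mul_add, mul_one])
    omega
  have hy4 := hy.period (2 * m)
  have hx4 := hx.period (-1)
  norm_num at hx4
  have h23 : y (2 * m + 2) < x 3 := by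
    by_contra! hc
    exact key 1 (2 * m) (by decide) hj hl (lt_of_le_of_ne hc (hne (by decide) (by grind)).symm)
  have h34 : x 3 < y (2 * m) + 1 := by
    by_contra! hc
    refine key (-1) (2 * m) (by decide) hj (lt_of_le_of_ne ?_ (hne (by decide) hj)) hr
    linarith
  refine IsAlternating.of_lt (fun t => by simp [hper t]) hl hr h23 h34 ?_ ?_ ?_ ?_
  · linarith [yp hj]
  · linarith [xn (i := 1) (by decide)]
  · linarith [yp (i := 2 * m + 2) (by grind)]
  · linarith [xn (i := 3) (by decide)]

end Level

section Grid

/-- For a fixed sequence, being alternating depends on the signs of only four values. -/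
theorem isOpen_setOf_isAlternating {X : Type*} [TopologicalSpace X] {g : X → ℝ → ℝ}
    (hg : ∀ t, Continuous fun p => g p t) (hper : ∀ p, Function.Periodic (g p) 1) (x : ℤ → ℝ) :
    IsOpen {p | IsAlternating (g p) x} := by
  by_cases hx : StrictMono x ∧ ∀ j, x (j + 4) = x j + 1
  · have : {p | IsAlternating (g p) x} =
        {p | 0 < g p (x 0)} ∩ {p | g p (x 1) < 0} ∩
          ({p | 0 < g p (x 2)} ∩ {p | g p (x 3) < 0}) := by
      ext p
      constructor
      · exact fun h => ⟨⟨h.pos (by decide), h.neg (by decide)⟩, h.pos (by decide),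
          h.neg (by decide)⟩
      · rintro ⟨⟨h0, h1⟩, h2, h3⟩
        have hq : ∀ (q : ℤ) r, g p (x (r + 4 * q)) = g p (x r) := by
          intro q
          induction q using Int.induction_on with
          | zero => simp
          | succ q ih =>
            intro r
            rw [show r + 4 * ((q : ℤ) + 1) = r + 4 * q + 4 by ring, hx.2, hper p, ih]
          | pred q ih =>
            intro r
            rw [← ih r, show r + 4 * (-(q : ℤ)) = r + 4 * (-(q : ℤ) - 1) + 4 by ring, hx.2, hper p]
        refine ⟨hx.1, hx.2, fun {i} hi => ?_, fun {i} hi => ?_⟩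
        · rw [← Int.emod_add_mul_ediv i 4, hq]
          have : i % 4 = 0 ∨ i % 4 = 2 := by grind
          rcases this with h | h <;> rw [h] <;> assumption
        · rw [← Int.emod_add_mul_ediv i 4, hq]
          have : i % 4 = 1 ∨ i % 4 = 3 := by grind
          rcases this with h | h <;> rw [h] <;> assumption
    rw [this]
    exact ((isOpen_lt continuous_const (hg _)).inter (isOpen_lt (hg _) continuous_const)).inter
      ((isOpen_lt continuous_const (hg _)).inter (isOpen_lt (hg _) continuous_const))
  · convert isOpen_empty
    ext p
    simp only [Set.mem_ofPred_eq, Set.mem_empty_iff_false, iff_false]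
    exact fun h => hx ⟨h.strictMono, h.period⟩

/-- `x` arises from `y` by an even shift of the index, which preserves the signs of an alternating
sequence. -/
def IsEvenShift (x y : ℤ → ℝ) : Prop := ∃ k, Even k ∧ x = fun j => y (j + k)

theorem IsEvenShift.isAlternating {f : ℝ → ℝ} {x y : ℤ → ℝ} (h : IsEvenShift x y)
    (hy : IsAlternating f y) : IsAlternating f x := by
  obtain ⟨k, hk, rfl⟩ := h
  exact hy.shift_even hk

/-- Along a chain of functions, each of which shares the alternating sequence `σ (n + 1)` with its
successor, the sequences `σ n` can be shifted one after the other so that neighbours are aligned. -/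
theorem exists_aligned_chain {f : ℕ → ℝ → ℝ} (hf : ∀ n, Function.Periodic (f n) 1)
    (h3 : ∀ n, ¬ HasZigzag 3 (f n)) {N : ℕ}
    (σ : ℕ → ℤ → ℝ) (h₁ : ∀ n < N, IsAlternating (f n) (σ n))
    (h₂ : ∀ n < N, IsAlternating (f n) (σ (n + 1))) {y : ℤ → ℝ} (hy : IsEvenShift y (σ 0)) :
    ∃ X : ℕ → ℤ → ℝ, X 0 = y ∧ (∀ n ≤ N, IsEvenShift (X n) (σ n)) ∧
      ∀ n < N, Aligned (X n) (X (n + 1)) := by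
  classical
  let X : ℕ → ℤ → ℝ := fun n => Nat.rec y (fun n Y =>
    if h : ∃ k, Even k ∧ Aligned Y (fun j => σ (n + 1) (j + k)) then
      fun j => σ (n + 1) (j + h.choose) else σ (n + 1)) n
  have step : ∀ n < N, IsEvenShift (X n) (σ n) →
      IsEvenShift (X (n + 1)) (σ (n + 1)) ∧ Aligned (X n) (X (n + 1)) := by
    intro n hn hs
    have h : ∃ k, Even k ∧ Aligned (X n) (fun j => σ (n + 1) (j + k)) :=
      Aligned.exists_shift (hf n) (h3 n) (hs.isAlternating (h₁ n hn)) (h₂ n hn)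
    have e : X (n + 1) = fun j => σ (n + 1) (j + h.choose) := dif_pos h
    rw [e]
    exact ⟨⟨_, h.choose_spec.1, rfl⟩, h.choose_spec.2⟩
  have all : ∀ n ≤ N, IsEvenShift (X n) (σ n) := by
    intro n
    induction n with
    | zero => exact fun _ => hy
    | succ n ih => exact fun hn => (step n hn (ih (by omega))).1
  exact ⟨X, rfl, all, fun n hn => (step n hn (all n hn.le)).2⟩

theorem Aligned.refl {x : ℤ → ℝ} (hx : StrictMono x) : Aligned x x := fun j =>
  ⟨hx (by omega), hx (by omega)⟩

/-- A family of functions over the square `[-1, 1]²` that is odd on the boundary of the square, and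
none of which has three peaks, cannot consist of functions with four sign changes per period. On a
fine grid the alternating sequences are chosen so that neighbours are aligned. Along the boundary
the index shift that aligns the sequence at a point with the one at its antipode is constant, and it
is odd because the function changes sign. Applied twice, it would have to be zero. -/
theorem not_forall_exists_isAlternating {g : ℝ × ℝ → ℝ → ℝ} (hg : ∀ t, Continuous fun p => g p t)
    (hper : ∀ p, Function.Periodic (g p) 1) (h3 : ∀ p, ¬ HasZigzag 3 (g p))
    (hodd : ∀ p : ℝ × ℝ, max |p.1| |p.2| = 1 → g (-p) = fun t => -g p t) :
    ¬ ∀ p, ∃ x, IsAlternating (g p) x := by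
  intro hex
  obtain ⟨δ, hδ, hball⟩ := lebesgue_number_lemma_of_metric
    (s := Set.Icc ((-1, -1) : ℝ × ℝ) (1, 1)) (c := fun x => {p | IsAlternating (g p) x})
    isCompact_Icc (isOpen_setOf_isAlternating hg hper)
    (fun p _ => Set.mem_iUnion.2 ((hex p).imp fun _ => id))
  choose! σ hσ using hball
  obtain ⟨N, hN⟩ := exists_nat_gt (2 / δ)
  have hN0 : (0 : ℝ) < N := lt_trans (by positivity) hN
  -- the grid of mesh `2 / N`; the sequence `σ p` alternates for all points `δ`-close to `p`
  let P : ℕ → ℕ → ℝ × ℝ := fun i j => (2 * i / N - 1, 2 * j / N - 1)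
  have hPmem : ∀ i j, i ≤ N → j ≤ N → P i j ∈ Set.Icc ((-1, -1) : ℝ × ℝ) (1, 1) := by
    have h1 : ∀ i : ℕ, i ≤ N → (-1 : ℝ) ≤ 2 * i / N - 1 ∧ (2 * i / N - 1 : ℝ) ≤ 1 := fun i hi => by
      have : (i : ℝ) / N ≤ 1 := (div_le_one hN0).2 (by exact_mod_cast hi)
      have : (0 : ℝ) ≤ i / N := by positivity
      constructor <;> rw [mul_div_assoc] <;> linarith
    exact fun i j hi hj => ⟨⟨(h1 i hi).1, (h1 j hj).1⟩, ⟨(h1 i hi).2, (h1 j hj).2⟩⟩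
  have hPneg : ∀ i j, i ≤ N → j ≤ N → P (N - i) (N - j) = -P i j := by
    intro i j hi hj
    simp only [P, Nat.cast_sub hi, Nat.cast_sub hj]
    ext <;> simp <;> field_simp <;> ring
  have hPdist : ∀ i j i' j' : ℕ, |(i : ℝ) - i'| ≤ 1 → |(j : ℝ) - j'| ≤ 1 →
      dist (P i j) (P i' j') < δ := by
    have h1 : ∀ i i' : ℕ, |(i : ℝ) - i'| ≤ 1 → dist (2 * i / N - 1 : ℝ) (2 * i' / N - 1) < δ := by
      intro i i' h
      rw [Real.dist_eq, show (2 * i / N - 1 - (2 * i' / N - 1) : ℝ) = 2 / N * (i - i') by ring,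
        abs_mul, abs_of_pos (by positivity)]
      rw [div_lt_comm₀ hδ hN0] at hN
      exact lt_of_le_of_lt (mul_le_of_le_one_right (by positivity) h) hN
    exact fun i j i' j' hi hj => max_lt (h1 _ _ hi) (h1 _ _ hj)
  -- lift the chosen sequences consistently: along the bottom row, then up each column
  have hσ' : ∀ i j i' j' : ℕ, i' ≤ N → j' ≤ N → |(i : ℝ) - i'| ≤ 1 → |(j : ℝ) - j'| ≤ 1 →
      IsAlternating (g (P i j)) (σ (P i' j')) := fun i j i' j' hi hj h1 h2 =>
    hσ _ (hPmem i' j' hi hj) (Metric.mem_ball.2 (hPdist _ _ _ _ h1 h2))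
  obtain ⟨R, -, hR, hRal⟩ := exists_aligned_chain (f := fun n => g (P n 0)) (fun n => hper _)
    (fun n => h3 _) (N := N) (fun n => σ (P n 0)) (fun n hn => hσ' _ _ _ _ hn.le (by simp) (by simp)
    (by simp)) (fun n hn => hσ' _ _ _ _ hn (by simp) (by simp) (by simp)) (y := σ (P 0 0))
    ⟨0, by decide, by simp⟩
  have hcol : ∀ i, i ≤ N → ∃ X : ℕ → ℤ → ℝ, X 0 = R i ∧ (∀ j ≤ N, IsEvenShift (X j) (σ (P i j))) ∧
      ∀ j < N, Aligned (X j) (X (j + 1)) := fun i hi =>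
    exists_aligned_chain (f := fun n => g (P i n)) (fun n => hper _) (fun n => h3 _) (N := N)
      (fun n => σ (P i n)) (fun n hn => hσ' _ _ _ _ hi hn.le (by simp) (by simp))
      (fun n hn => hσ' _ _ _ _ hi hn (by simp) (by simp)) (hR i hi)
  choose! X hX0 hXs hXv using hcol
  have hA : ∀ i j i' j' : ℕ, i' ≤ N → j' ≤ N → |(i : ℝ) - i'| ≤ 1 → |(j : ℝ) - j'| ≤ 1 →
      IsAlternating (g (P i j)) (X i' j') := fun i j i' j' hi hj h1 h2 =>
    (hXs i' hi j' hj).isAlternating (hσ' _ _ _ _ hi hj h1 h2)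
  have tr : ∀ {p : ℝ × ℝ} {a b c : ℤ → ℝ}, IsAlternating (g p) a → IsAlternating (g p) b →
      IsAlternating (g p) c → Aligned a b → Aligned b c → Aligned a c :=
    fun {p} {a b c} ha hb hc => Aligned.trans (hper p) (h3 p) ha hb hc
  -- alignment across the columns propagates upwards, square by square
  have hXh : ∀ j ≤ N, ∀ i < N, Aligned (X i j) (X (i + 1) j) := by
    intro j
    induction j with
    | zero => intro _ i hi; rw [hX0 i hi.le, hX0 (i + 1) hi]; exact hRal i hi
    | succ j ih =>
      intro hj i hi
      have a1 := hA i j i j hi.le (by omega) (by simp) (by simp)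
      have a2 := hA i j (i + 1) j hi (by omega) (by simp) (by simp)
      have a3 := hA i j i (j + 1) hi.le hj (by simp) (by simp)
      have a4 := hA i j (i + 1) (j + 1) hi hj (by simp) (by simp)
      exact tr a3 a1 a4 (hXv i hi.le j hj).symm (tr a1 a2 a4 (ih (by omega) i hi) (hXv _ hi j hj))
  -- compare with the antipodal point, moving along two sides of the square
  have hbd : ∀ i j, i ≤ N → j ≤ N → (j = 0 ∨ i = N) →
      g (P (N - i) (N - j)) = fun t => -g (P i j) t := by
    intro i j hi hj hb
    rw [hPneg i j hi hj]
    refine hodd _ ?_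
    have h1 := hPmem i j hi hj
    have h2 : |(P i j).1| ≤ 1 := abs_le.2 ⟨h1.1.1, h1.2.1⟩
    have h3 : |(P i j).2| ≤ 1 := abs_le.2 ⟨h1.1.2, h1.2.2⟩
    rcases hb with rfl | rfl
    · have : |(P i 0).2| = 1 := by simp [P]
      rw [this] at *; exact max_eq_right h2
    · have : |(P i j).1| = 1 := by simp only [P, mul_div_cancel_right₀ _ hN0.ne']; norm_num
      rw [this] at *; exact max_eq_left h3
  have hopp : ∀ i j i' j' : ℕ, i ≤ N → j ≤ N → (j = 0 ∨ i = N) → i' ≤ N → j' ≤ N →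
      |(i : ℝ) - i'| ≤ 1 → |(j : ℝ) - j'| ≤ 1 → ∀ {o : ℤ}, Odd o →
      IsAlternating (g (P (N - i) (N - j))) (fun l => X i' j' (l + o)) := by
    intro i j i' j' hi hj hb hi' hj' h1 h2 o ho
    rw [hbd i j hi hj hb]
    exact (hA i j i' j' hi' hj' h1 h2).shift_odd ho
  obtain ⟨k, hk, hstart⟩ := Aligned.exists_shift (hper _) (h3 _)
    (hA (N - 0) (N - 0) N N le_rfl le_rfl (by simp) (by simp))
    (hopp 0 0 0 0 (by simp) (by simp) (by simp) (by simp) (by simp) (by simp) (by simp) odd_one)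
  have ho : Odd (k + 1) := hk.add_one
  have hstart' : Aligned (X N N) (fun l => X 0 0 (l + (k + 1))) := by simpa only [add_assoc]
      using hstart
  have hside₁ : ∀ i ≤ N, Aligned (X (N - i) N) (fun l => X i 0 (l + (k + 1))) := by
    intro i
    induction i with
    | zero => exact fun _ => hstart'
    | succ i ih =>
      intro hi
      have hcast : ((N - (i + 1) : ℕ) : ℝ) + 1 = ((N - i : ℕ) : ℝ) := by
        have : N - (i + 1) + 1 = N - i := by omega
        exact_mod_cast this
      have a1 := hA (N - i) (N - 0) (N - (i + 1)) N (by omega) le_rfl (by rw [← hcast]; simp)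
          (by simp)
      have a2 := hA (N - i) (N - 0) (N - i) N (by omega) le_rfl (by simp) (by simp)
      have a3 := hopp i 0 i 0 (by omega) (by simp) (by simp) (by omega) (by simp) (by simp)
          (by simp) ho
      have a4 := hopp i 0 (i + 1) 0 (by omega) (by simp) (by simp) hi (by simp) (by simp)
          (by simp) ho
      have e1 := hXh N le_rfl (N - (i + 1)) (by omega)
      rw [show N - (i + 1) + 1 = N - i by omega] at e1
      exact tr a1 a2 a4 e1 (tr a2 a3 a4 (ih (by omega)) ((hXh 0 (by simp) i hi).shift _))
  have hside₂ : ∀ j ≤ N, Aligned (X 0 (N - j)) (fun l => X N j (l + (k + 1))) := by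
    intro j
    induction j with
    | zero => exact fun _ => by simpa using hside₁ N le_rfl
    | succ j ih =>
      intro hj
      have hcast : ((N - (j + 1) : ℕ) : ℝ) + 1 = ((N - j : ℕ) : ℝ) := by
        have : N - (j + 1) + 1 = N - j := by omega
        exact_mod_cast this
      have a1 := hA (N - N) (N - j) 0 (N - (j + 1)) (by omega) (by omega) (by simp)
          (by rw [← hcast]; simp)
      have a2 := hA (N - N) (N - j) 0 (N - j) (by omega) (by omega) (by simp) (by simp)
      have a3 := hopp N j N j le_rfl (by omega) (by simp) le_rfl (by omega) (by simp) (by simp) ho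
      have a4 := hopp N j N (j + 1) le_rfl (by omega) (by simp) le_rfl hj (by simp) (by simp) ho
      have e1 := hXv 0 (by simp) (N - (j + 1)) (by omega)
      rw [show N - (j + 1) + 1 = N - j by omega] at e1
      exact tr a1 a2 a4 e1 (tr a2 a3 a4 (ih (by omega)) ((hXv N le_rfl j hj).shift _))
  have hend := hside₂ N le_rfl
  rw [Nat.sub_self] at hend
  have a1 := hA 0 0 0 0 (by simp) (by simp) (by simp) (by simp)
  have a2 := hopp N N N N le_rfl le_rfl (by simp) le_rfl le_rfl (by simp) (by simp) ho
  rw [Nat.sub_self] at a2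
  -- from `(0, 0)` to `(N, N)` along two sides, and back to `(0, 0)` by the shift found at the start
  have hfin := tr a1 a2 (a1.shift_even (ho.add_odd ho)) hend
    (by simpa only [add_assoc] using hstart'.shift (k + 1))
  have := Aligned.even_shift_unique a1.strictMono (Aligned.refl a1.strictMono) (ho.add_odd ho) hfin
  grind

end Grid

/-! ### A direction with three peaks -/

section Curve

variable {γ : ℝ → E3}

/-- If all directions have two peaks and none has three, then a level crossed four times can be
chosen continuously and oddly in the direction: admissible levels form an interval for each
direction, each of them stays admissible nearby, and `(g v - g (-v)) / 2` makes a continuous choice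
`g` odd. -/
theorem exists_continuous_level (hper : Function.Periodic γ 1)
    (h2 : ∀ v : E3, v ≠ 0 → HasZigzag 2 fun t => inner ℝ v (γ t))
    (h3 : ∀ v : E3, ¬ HasZigzag 3 fun t => inner ℝ v (γ t)) :
    ∃ c : {v : E3 // v ≠ 0} → ℝ, Continuous c ∧
      (∀ v w : {v : E3 // v ≠ 0}, (w : E3) = -v → c w = -c v) ∧
      ∀ v, ∃ x, IsAlternating (fun t => inner ℝ v.1 (γ t) - c v) x := by
  have hp : ∀ v : E3, Function.Periodic (fun t => inner ℝ v (γ t)) 1 := fun v t => by simp [hper t]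
  let L : {v : E3 // v ≠ 0} → Set ℝ := fun v =>
    {u | ∃ x, IsAlternating (fun t => inner ℝ v.1 (γ t) - u) x}
  have hconv : ∀ v, Convex ℝ (L v) := fun v =>
    Set.OrdConnected.convex ⟨fun a ha b hb u hu => IsAlternating.of_between (hp v) (h3 v) hu.1 hu.2
      ha hb⟩
  have hloc : ∀ v, ∃ u, ∀ᶠ w in nhds v, u ∈ L w := by
    intro v
    obtain ⟨u, x, hx⟩ := (h2 v v.2).exists_isAlternating (hp v)
    refine ⟨u, ?_⟩
    have ho := isOpen_setOf_isAlternating (X := {v : E3 // v ≠ 0})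
      (g := fun w t => inner ℝ w.1 (γ t) - u) (fun t => by fun_prop)
      (fun w t => by simp [hper t]) x
    filter_upwards [ho.mem_nhds hx] with w hw using ⟨x, hw⟩
  obtain ⟨g, hg⟩ := exists_continuous_forall_mem_convex_of_local_const hconv hloc
  have hneg : ∀ {v : {v : E3 // v ≠ 0}} {u}, u ∈ L v → -u ∈ L ⟨-v.1, neg_ne_zero.2 v.2⟩ := by
    rintro v u ⟨x, hx⟩
    have := hx.shift_odd odd_one
    rw [show (fun t => -(inner ℝ v.1 (γ t) - u)) = fun t => inner ℝ (-v.1) (γ t) - -u by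
      funext t; rw [inner_neg_left]; ring] at this
    exact ⟨_, this⟩
  have hcont : Continuous fun v : {v : E3 // v ≠ 0} =>
      g (⟨-v.1, neg_ne_zero.2 v.2⟩ : {v : E3 // v ≠ 0}) :=
    g.continuous.comp (Continuous.subtype_mk (by fun_prop) _)
  refine ⟨fun v => (g v - g ⟨-v.1, neg_ne_zero.2 v.2⟩) / 2, by fun_prop, ?_, ?_⟩
  · rintro v ⟨w, hw⟩ rfl
    simp only [neg_neg, Subtype.coe_eta]
    ring
  · intro v
    have h1 := hg v
    have h2 := hneg (hg ⟨-v.1, neg_ne_zero.2 v.2⟩)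
    simp only [neg_neg, Subtype.coe_eta] at h2
    have := hconv v h1 h2 (by norm_num : (0 : ℝ) ≤ 1 / 2) (by norm_num : (0 : ℝ) ≤ 1 / 2)
        (by norm_num)
    rwa [show (1 / 2 : ℝ) • g v + (1 / 2 : ℝ) • -g ⟨-v.1, neg_ne_zero.2 v.2⟩ =
      (g v - g ⟨-v.1, neg_ne_zero.2 v.2⟩) / 2 by simp only [smul_eq_mul]; ring] at this

theorem exists_hasZigzag_three (hper : Function.Periodic γ 1)
    (h2 : ∀ v : E3, v ≠ 0 → HasZigzag 2 fun t => inner ℝ v (γ t)) :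
    ∃ v : E3, HasZigzag 3 fun t => inner ℝ v (γ t) := by
  by_contra! h3
  obtain ⟨c, hc, hcodd, hex⟩ := exists_continuous_level hper h2 h3
  -- the square is mapped to a surface around the origin, antipodally on its boundary
  let V : ℝ × ℝ → E3 := fun p => !₂[p.1, p.2, 1 - max |p.1| |p.2|]
  have hV0 : ∀ p, V p ≠ 0 := by
    intro p hp
    have e0 : p.1 = 0 := by simpa [V] using congrArg (fun v : E3 => v 0) hp
    have e1 : p.2 = 0 := by simpa [V] using congrArg (fun v : E3 => v 1) hp
    have e2 : 1 - max |p.1| |p.2| = 0 := by simpa [V] using congrArg (fun v : E3 => v 2) hp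
    simp [e0, e1] at e2
  have hVc : Continuous V := by
    refine (PiLp.continuous_toLp 2 _).comp (continuous_pi fun i => ?_)
    fin_cases i <;> simp <;> fun_prop
  let W : ℝ × ℝ → {v : E3 // v ≠ 0} := fun p => ⟨V p, hV0 p⟩
  have hWc : Continuous W := hVc.subtype_mk _
  refine not_forall_exists_isAlternating (g := fun p t => inner ℝ (V p) (γ t) - c (W p))
    (fun t => by fun_prop) (fun p t => by simp [hper t]) (fun p => ?_) (fun p hp => ?_)
      (fun p => hex (W p))
  · rintro ⟨x, hx⟩
    exact h3 (V p) ⟨x, hx.strictMono, hx.period, fun i hi => by simpa using hx.right_lt i hi,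
      fun i hi => by simpa using hx.left_lt i hi⟩
  · have hVneg : V (-p) = -V p := by
      ext i; fin_cases i <;> simp [V, hp]
    have := hcodd (W p) (W (-p)) hVneg
    funext t
    rw [this, hVneg, inner_neg_left]; ring

end Curve

/-! ### Crofton's inequality for an angle -/

section Crofton

open MeasureTheory InnerProductGeometry

/-- Lebesgue measure on the unit ball of space. It replaces the uniform measure on directions: the
conditions imposed on a vector depend on its direction only. -/
def ballMeasure : Measure E3 := volume.restrict (Metric.ball 0 1)

instance : IsFiniteMeasure ballMeasure :=
  ⟨by rw [ballMeasure, Measure.restrict_apply_univ]; exact measure_ball_lt_top⟩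

theorem measurableSet_inner_mul_inner_neg (a b : E3) :
    MeasurableSet {v : E3 | inner ℝ v a * inner ℝ v b < 0} :=
  (isOpen_lt (by fun_prop) continuous_const).measurableSet

theorem ballMeasure_map_isometry (R : E3 ≃ₗᵢ[ℝ] E3) (a b : E3) :
    ballMeasure.real {v | inner ℝ v (R a) * inner ℝ v (R b) < 0} =
      ballMeasure.real {v | inner ℝ v a * inner ℝ v b < 0} := by
  have h : MeasurePreserving R ballMeasure ballMeasure := by
    have := R.measurePreserving.restrict_preimage (s := Metric.ball 0 1) measurableSet_ball
    simpa [ballMeasure] using this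
  rw [measureReal_def, measureReal_def,
    ← h.measure_preimage (measurableSet_inner_mul_inner_neg _ _).nullMeasurableSet]
  simp [Set.preimage]

/-- The measure of the vectors that separate two unit vectors depends on their angle only, since two
reflections carry one pair to the other. -/
theorem ballMeasure_eq_of_inner_eq {a b a' b' : E3} (ha : ‖a‖ = 1) (hb : ‖b‖ = 1) (ha' : ‖a'‖ = 1)
    (hb' : ‖b'‖ = 1) (h : inner ℝ a b = inner ℝ a' b') :
    ballMeasure.real {v | inner ℝ v a * inner ℝ v b < 0} =
      ballMeasure.real {v | inner ℝ v a' * inner ℝ v b' < 0} := by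
  let R₁ := (ℝ ∙ (a - a'))ᗮ.reflection
  have h1 : R₁ a = a' := Submodule.reflection_sub (ha.trans ha'.symm)
  let R₂ := (ℝ ∙ (R₁ b - b'))ᗮ.reflection
  have h2 : R₂ (R₁ b) = b' := Submodule.reflection_sub (by rw [R₁.norm_map, hb, hb'])
  have h3 : R₂ a' = a' := by
    refine Submodule.reflection_mem_subspace_eq_self
        (Submodule.mem_orthogonal_singleton_iff_inner_left.2 ?_)
    rw [inner_sub_right, ← h, ← h1, R₁.inner_map_map, sub_self]
  rw [← ballMeasure_map_isometry R₁ a b, ← ballMeasure_map_isometry R₂, h1, h2, h3]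

/-- A point that makes `k` steps of length `θ` round the unit circle crosses a given line through
the centre at most `k θ / π + 1` times. -/
theorem sum_sign_changes_cos_le (ψ θ : ℝ) (hθ : 0 ≤ θ) (k : ℕ) :
    (∑ j ∈ Finset.range k, if Real.cos (j * θ - ψ) * Real.cos ((j + 1 : ℕ) * θ - ψ) < 0 then
      (1 : ℝ) else 0)
      ≤ k * θ / Real.pi + 1 := by
  have hπ := Real.pi_pos
  -- the number of the half circle that contains the point after `j` steps
  let f : ℕ → ℤ := fun j => ⌊(j * θ - ψ) / Real.pi + 1 / 2⌋
  have hf : ∀ j : ℕ, (f j : ℝ) * Real.pi - Real.pi / 2 ≤ j * θ - ψ ∧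
      j * θ - ψ ≤ f j * Real.pi + Real.pi / 2 := by
    intro j
    have h1 := Int.floor_le ((j * θ - ψ) / Real.pi + 1 / 2)
    have h2 := (Int.lt_floor_add_one ((j * θ - ψ) / Real.pi + 1 / 2)).le
    have e : (j * θ - ψ) / Real.pi * Real.pi = j * θ - ψ := by field_simp
    constructor
    · have := mul_le_mul_of_nonneg_right h1 hπ.le
      rw [add_mul, e] at this
      simp only [f]; linarith
    · have := mul_le_mul_of_nonneg_right h2 hπ.le
      rw [add_mul, e, add_mul] at this
      simp only [f]; linarith
  have hstep : ∀ j : ℕ, (if Real.cos (j * θ - ψ) * Real.cos ((j + 1 : ℕ) * θ - ψ) < 0 then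
      (1 : ℝ) else 0)
      ≤ (f (j + 1) : ℝ) - f j := by
    intro j
    have hmono : f j ≤ f (j + 1) := by
      refine Int.floor_le_floor ?_
      gcongr
      simp
    split_ifs with hc
    · have hne : f j ≠ f (j + 1) := by
        intro heq
        have c1 : ∀ i : ℕ, 0 ≤ Real.cos (i * θ - ψ - f i * Real.pi) := fun i =>
          Real.cos_nonneg_of_neg_pi_div_two_le_of_le (by linarith [(hf i).1])
            (by linarith [(hf i).2])
        have c2 := mul_nonneg (c1 j) (c1 (j + 1))
        rw [← heq, Real.cos_sub_int_mul_pi, Real.cos_sub_int_mul_pi, mul_mul_mul_comm,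
          ← mul_zpow] at c2
        norm_num at c2 hc
        linarith
      have : f j + 1 ≤ f (j + 1) := by omega
      have : (f j : ℝ) + 1 ≤ f (j + 1) := by exact_mod_cast this
      linarith
    · have : (f j : ℝ) ≤ f (j + 1) := by exact_mod_cast hmono
      linarith
  refine (Finset.sum_le_sum fun j _ => hstep j).trans ?_
  rw [Finset.sum_range_sub (fun j => (f j : ℝ))]
  have h1 := Int.floor_le ((k * θ - ψ) / Real.pi + 1 / 2)
  have h2 := (Int.lt_floor_add_one (((0 : ℕ) * θ - ψ) / Real.pi + 1 / 2)).le
  have e : (k * θ - ψ) / Real.pi = k * θ / Real.pi + ((0 : ℕ) * θ - ψ) / Real.pi := by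
    push_cast; ring
  simp only [f]
  rw [e] at h1 ⊢
  linarith

/-- The proportion of vectors `v` for which `⟨v, a⟩` and `⟨v, b⟩` have opposite signs is at most the
angle between `a` and `b` divided by `π`. The measure is the same for all pairs of unit vectors `n
(j θ)`, `n ((j + 1) θ)` of a plane, where `θ` is the angle, and a given `v` separates at most `k θ /
π + 1` of the first `k` of these pairs; the bound results from letting `k` tend to infinity. -/
theorem ballMeasure_inner_mul_inner_neg_le {a b : E3} (ha : a ≠ 0) (hb : b ≠ 0) :
    Real.pi * ballMeasure.real {v | inner ℝ v a * inner ℝ v b < 0} ≤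
      ballMeasure.real Set.univ * angle a b := by
  wlog hnorm : ‖a‖ = 1 ∧ ‖b‖ = 1 generalizing a b
  · have ha' := norm_pos_iff.2 ha
    have hb' := norm_pos_iff.2 hb
    have := this (a := ‖a‖⁻¹ • a) (b := ‖b‖⁻¹ • b) (by simp [ha]) (by simp [hb])
      (by constructor <;> rw [norm_smul, norm_inv, norm_norm, inv_mul_cancel₀ (by positivity)])
    rw [angle_smul_left_of_pos _ _ (by positivity), angle_smul_right_of_pos _ _ (by positivity)]
        at this
    convert this using 5 with v
    rw [inner_smul_right, inner_smul_right, mul_mul_mul_comm]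
    have hc : 0 < ‖a‖⁻¹ * ‖b‖⁻¹ := by positivity
    exact ⟨fun h => mul_neg_of_pos_of_neg hc h, fun h => neg_of_mul_neg_right h hc.le⟩
  obtain ⟨ha1, hb1⟩ := hnorm
  set θ := angle a b with hθ
  have hθ0 : 0 ≤ θ := angle_nonneg _ _
  let n : ℝ → E3 := fun φ => !₂[Real.cos φ, Real.sin φ, 0]
  have hn : ∀ φ, ‖n φ‖ = 1 := fun φ => by
    simp [n, EuclideanSpace.norm_eq, Fin.sum_univ_three]
  have hinner : ∀ φ ψ, inner ℝ (n φ) (n ψ) = Real.cos (ψ - φ) := fun φ ψ => by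
    simp [n, PiLp.inner_apply, Fin.sum_univ_three, Real.cos_sub]
  have hab : inner ℝ a b = Real.cos θ := by rw [hθ, cos_angle, ha1, hb1]; simp
  have hD : ∀ j : ℕ, ballMeasure.real
      {v | inner ℝ v (n (j * θ)) * inner ℝ v (n ((j + 1 : ℕ) * θ)) < 0}
      = ballMeasure.real {v | inner ℝ v a * inner ℝ v b < 0} := fun j =>
    ballMeasure_eq_of_inner_eq (hn _) (hn _) ha1 hb1 (by
      rw [hinner, hab]; congr 1; push_cast; ring)
  set D := ballMeasure.real {v | inner ℝ v a * inner ℝ v b < 0} with hDdef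
  set T := ballMeasure.real Set.univ
  have hk : ∀ k : ℕ, k * D ≤ T * (k * θ / Real.pi + 1) := by
    intro k
    have h1 : (k : ℝ) * D = ∑ j ∈ Finset.range k,
        ballMeasure.real {v | inner ℝ v (n (j * θ)) * inner ℝ v (n ((j + 1 : ℕ) * θ)) < 0} := by
      rw [Finset.sum_congr rfl fun j _ => hD j]; simp
    have hm : ∀ j : ℕ, MeasurableSet
        {v | inner ℝ v (n (j * θ)) * inner ℝ v (n ((j + 1 : ℕ) * θ)) < 0} :=
      fun j => measurableSet_inner_mul_inner_neg _ _
    have h2 : ∀ j : ℕ, ballMeasure.real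
        {v | inner ℝ v (n (j * θ)) * inner ℝ v (n ((j + 1 : ℕ) * θ)) < 0}
        = ∫ v, (if inner ℝ v (n (j * θ)) * inner ℝ v (n ((j + 1 : ℕ) * θ)) < 0 then (1 : ℝ) else 0)
          ∂ballMeasure := by
      intro j
      rw [← integral_indicator_one (hm j)]
      rfl
    rw [h1, Finset.sum_congr rfl fun j _ => h2 j, ← integral_finsetSum]
    · have h3 : T * (k * θ / Real.pi + 1) = ∫ _ : E3, (k * θ / Real.pi + 1) ∂ballMeasure := by
        simp [T]
      rw [h3]
      refine integral_mono_of_nonneg (Filter.Eventually.of_forall fun v => ?_) (integrable_const _)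
        (Filter.Eventually.of_forall fun v => ?_)
      · exact Finset.sum_nonneg fun j _ => by split_ifs <;> norm_num
      · set z : ℂ := ⟨v 0, v 1⟩ with hz
        have hv : ∀ φ, inner ℝ v (n φ) = ‖z‖ * Real.cos (φ - z.arg) := by
          intro φ
          have e1 : v 0 = ‖z‖ * Real.cos z.arg := (Complex.norm_mul_cos_arg z).symm
          have e2 : v 1 = ‖z‖ * Real.sin z.arg := (Complex.norm_mul_sin_arg z).symm
          simp only [n, PiLp.inner_apply, Fin.sum_univ_three, Real.cos_sub]
          simp only [RCLike.inner_apply, conj_trivial, Matrix.cons_val_zero, Matrix.cons_val_one,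
              Matrix.cons_val]
          rw [e1, e2]; ring
        refine le_trans (Finset.sum_le_sum fun j _ => ?_) (sum_sign_changes_cos_le z.arg θ hθ0 k)
        rw [hv, hv, mul_mul_mul_comm]
        split_ifs with h1 h2 h2
        · exact le_rfl
        · exact absurd (neg_of_mul_neg_right h1 (mul_self_nonneg _)) h2
        · exact zero_le_one
        · exact le_rfl
    · exact fun j _ => (integrable_const (1 : ℝ)).indicator (hm j)
  have hlim : D ≤ T * (θ / Real.pi) := by
    refine le_of_forall_pos_le_add fun ε hε => ?_
    obtain ⟨k, hk'⟩ := exists_nat_gt (T / ε)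
    have hT : 0 ≤ T := measureReal_nonneg
    have hk0 : (0 : ℝ) < k := lt_of_le_of_lt (by positivity) hk'
    rw [div_lt_iff₀ hε] at hk'
    have := hk k
    have e : T * (k * θ / Real.pi + 1) = k * (T * (θ / Real.pi)) + T := by ring
    rw [e] at this
    refine le_of_mul_le_mul_left ?_ hk0
    linarith
  have hπ := Real.pi_pos
  calc Real.pi * D ≤ Real.pi * (T * (θ / Real.pi)) := by gcongr
    _ = T * θ := by field_simp

end Crofton

/-! ### Zigzags of inscribed polygons -/

section Polygon

open MeasureTheory InnerProductGeometry Filter Topology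

/-- A zigzag with `n` peaks of a sequence `H` of period `m`, the heights of the vertices of a closed
polygon: a periodic nondecreasing sequence of indices at which `H` is alternately a peak (even
positions) and a valley (odd positions). -/
structure IsDiscreteZigzag (n m : ℕ) (H : ℤ → ℝ) (k : ℤ → ℤ) : Prop where
  mono : Monotone k
  period : ∀ j, k (j + 2 * n) = k j + m
  right_lt (i : ℤ) : Even i → H (k (i + 1)) < H (k i)
  left_lt (i : ℤ) : Even i → H (k (i - 1)) < H (k i)

theorem exists_sign_change {e : ℤ → ℝ} (h0 : ∀ k, e k ≠ 0) {a b : ℤ} (hab : a ≤ b)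
    (hs : e a * e b < 0) : ∃ k, a ≤ k ∧ k < b ∧ e k * e (k + 1) < 0 := by
  by_contra! hc
  have : ∀ k, a ≤ k → k ≤ b → 0 < e a * e k := by
    intro k hk
    induction k, hk using Int.leInduction with
    | base => exact fun _ => mul_self_pos.2 (h0 a)
    | succ k hk ih =>
      intro hkb
      have h1 := ih (by omega)
      have h2 := lt_of_le_of_ne (hc k hk (by omega)) (mul_ne_zero (h0 _) (h0 _)).symm
      have h3 : 0 < (e a * e (k + 1)) * (e k * e k) := by
        calc 0 < (e a * e k) * (e k * e (k + 1)) := mul_pos h1 h2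
          _ = _ := by ring
      exact pos_of_mul_pos_left h3 (mul_self_nonneg _)
  linarith [this b hab le_rfl]

theorem exists_diff_lt {H : ℤ → ℝ} {a b : ℤ} (hab : a ≤ b) (h : H b < H a) :
    ∃ k, a ≤ k ∧ k < b ∧ H (k + 1) - H k < 0 := by
  by_contra! hc
  have : ∀ k, a ≤ k → k ≤ b → H a ≤ H k := by
    intro k hk
    induction k, hk using Int.leInduction with
    | base => exact fun _ => le_rfl
    | succ k hk ih =>
      intro hkb
      linarith [ih (by omega), hc k hk (by omega)]
  linarith [this b hab le_rfl]

/-- A sequence that has a zigzag with `n` peaks and no two equal consecutive terms reverses its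
direction at least `2 n` times per period: each of the `2 n` pieces between peaks and valleys
contains a step of the expected sign, and between two such steps of opposite signs there is a
reversal. -/
theorem IsDiscreteZigzag.card_le {n m : ℕ} (hm : 0 < m) {H : ℤ → ℝ} {k : ℤ → ℤ}
    (hk : IsDiscreteZigzag n m H k) (hper : ∀ i, H (i + m) = H i) (hne : ∀ i, H (i + 1) - H i ≠ 0) :
    2 * n ≤ ((Finset.range m).filter fun i : ℕ =>
      (H (i + 1) - H i) * (H (i + 1 + 1) - H (i + 1)) < 0).card := by
  rcases Nat.eq_zero_or_pos n with rfl | hn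
  · simp
  let e : ℤ → ℝ := fun i => H (i + 1) - H i
  have hel : ∀ j : ℤ, ∃ l, k j ≤ l ∧ l < k (j + 1) ∧ (Even j → e l < 0) ∧ (Odd j → 0 < e l) := by
    intro j
    rcases Int.even_or_odd j with hj | hj
    · obtain ⟨l, h1, h2, h3⟩ := exists_diff_lt (hk.mono (by omega : j ≤ j + 1)) (hk.right_lt j hj)
      exact ⟨l, h1, h2, fun _ => h3, fun ho => absurd hj (Int.not_even_iff_odd.2 ho)⟩
    · have hlt := hk.left_lt (j + 1) hj.add_one
      rw [add_sub_cancel_right] at hlt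
      obtain ⟨l, h1, h2, h3⟩ := exists_diff_lt (H := fun i => -H i)
        (hk.mono (by omega : j ≤ j + 1)) (neg_lt_neg hlt)
      exact ⟨l, h1, h2, fun ho => absurd ho (Int.not_even_iff_odd.2 hj), fun _ => by
        simp only [e]; linarith⟩
  choose l₀ hl1 hl2 hl3 hl4 using hel
  -- one index of each sign per monotone piece, closed up after a full period
  let l : ℕ → ℤ := fun j => if j < 2 * n then l₀ j else l₀ 0 + m
  have eper : ∀ i, e (i + m) = e i := fun i => by
    simp only [e]; rw [add_right_comm, hper, hper]
  have hneg : ∀ j ≤ 2 * n, Even j → e (l j) < 0 := by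
    intro j hj hje
    simp only [l]
    split_ifs with h
    · exact hl3 _ (by exact_mod_cast hje)
    · rw [eper]; exact hl3 0 (by decide)
  have hpos : ∀ j ≤ 2 * n, Odd j → 0 < e (l j) := by
    intro j hj hje
    have : j < 2 * n := lt_of_le_of_ne hj (by rintro rfl; grind)
    simp only [l, if_pos this]
    exact hl4 _ (by exact_mod_cast hje)
  have hlt : ∀ j < 2 * n, l j < l (j + 1) := by
    intro j hj
    simp only [l, if_pos hj]
    split_ifs with h
    · exact lt_of_lt_of_le (hl2 j) (by exact_mod_cast hl1 (j + 1))
    · have h1 := hl2 j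
      have h2 := hk.period 0
      have : (j : ℤ) + 1 = 0 + 2 * n := by omega
      rw [this, h2] at h1
      linarith [hl1 0]
  have hch : ∀ j : ℕ, ∃ c, j < 2 * n → l j ≤ c ∧ c < l (j + 1) ∧ e c * e (c + 1) < 0 := by
    intro j
    by_cases hj : j < 2 * n
    · have : e (l j) * e (l (j + 1)) < 0 := by
        rcases Nat.even_or_odd j with h | h
        · exact mul_neg_of_neg_of_pos (hneg j hj.le h) (hpos _ hj h.add_one)
        · exact mul_neg_of_pos_of_neg (hpos j hj.le h) (hneg _ hj h.add_one)
      obtain ⟨c, hc⟩ := exists_sign_change hne (hlt j hj).le this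
      exact ⟨c, fun _ => hc⟩
    · exact ⟨0, fun h => absurd h hj⟩
  choose c hc using hch
  have hlmono : ∀ i j, i ≤ j → j ≤ 2 * n → l i ≤ l j := by
    intro i j hij
    induction j, hij using Nat.le_induction with
    | base => exact fun _ => le_rfl
    | succ j hij ih => exact fun hj => (ih (by omega)).trans (hlt j hj).le
  have hclt : ∀ i j, i < j → j < 2 * n → c i < c j := fun i j hij hj =>
    ((hc i (by omega)).2.1.trans_le (hlmono _ _ hij hj.le)).trans_le (hc j hj).1
  have hwin : ∀ j < 2 * n, l₀ 0 ≤ c j ∧ c j < l₀ 0 + m := by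
    intro j hj
    have h0 : l 0 = l₀ 0 := by simp [l, hn]
    have h1 : l (2 * n) = l₀ 0 + m := by simp [l]
    rw [← h1, ← h0]
    exact ⟨(hlmono _ _ (by omega) hj.le).trans (hc j hj).1,
      (hc j hj).2.1.trans_le (hlmono _ _ hj le_rfl)⟩
  have hm' : (0 : ℤ) < m := by exact_mod_cast hm
  have eperq : ∀ (q : ℤ) i, e (i + q * m) = e i := fun q i => Function.Periodic.int_mul eper q i
  -- the reversals lie within one period, hence remain distinct when reduced modulo `m`
  have hmod : ∀ i, e i = e ((i % m).toNat) ∧ e (i + 1) = e ((i % m).toNat + 1) := by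
    intro i
    rw [Int.toNat_of_nonneg (Int.emod_nonneg i hm'.ne')]
    have h1 : i = i % m + i / m * m := (Int.emod_add_ediv_mul i m).symm
    constructor
    · conv_lhs => rw [h1, eperq]
    · conv_lhs => rw [h1, add_right_comm, eperq]
  calc 2 * n = (Finset.range (2 * n)).card := (Finset.card_range _).symm
    _ ≤ _ := by
      refine Finset.card_le_card_of_injOn (fun j => (c j % m).toNat) ?_ ?_
      · intro j hj
        have hj' : j < 2 * n := by simpa using hj
        have h1 := Int.emod_nonneg (c j) hm'.ne'
        have h2 := Int.emod_lt_of_pos (c j) hm'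
        simp only [Finset.coe_filter, Finset.mem_range, Set.mem_ofPred_eq]
        refine ⟨by omega, ?_⟩
        have := (hc j hj').2.2
        rw [(hmod (c j)).1, (hmod (c j)).2] at this
        exact this
      · intro i hi j hj hij
        have hi' : i < 2 * n := by simpa using hi
        have hj' : j < 2 * n := by simpa using hj
        have h1 := Int.emod_nonneg (c i) hm'.ne'
        have h2 := Int.emod_nonneg (c j) hm'.ne'
        have heq : c i % m = c j % m := by dsimp only at hij; omega
        have hcij : c i = c j := by
          have hd : (m : ℤ) ∣ c i - c j := Int.ModEq.dvd heq.symm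
          obtain ⟨q, hq⟩ := hd
          have w1 := hwin i hi'
          have w2 := hwin j hj'
          have : q = 0 := by
            have a1 : (m : ℤ) * q < m * 1 := by rw [← hq]; linarith [w1.2, w2.1]
            have a2 : (m : ℤ) * (-1) < m * q := by rw [← hq]; linarith [w1.1, w2.2]
            have := lt_of_mul_lt_mul_left a1 hm'.le
            have := lt_of_mul_lt_mul_left a2 hm'.le
            omega
          rw [this] at hq; omega
        by_contra hne'
        rcases lt_or_gt_of_ne hne' with h | h
        · exact absurd hcij (hclt i j h hj').ne
        · exact absurd hcij (hclt j i h hi').ne'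

theorem tendsto_int_floor_mul_div (x : ℝ) :
    Tendsto (fun m : ℕ => (⌊x * m⌋ : ℝ) / m) atTop (𝓝 x) := by
  have h1 : Tendsto (fun m : ℕ => x - 1 / (m : ℝ)) atTop (𝓝 x) := by
    simpa using tendsto_const_nhds.sub (tendsto_one_div_atTop_nhds_zero_nat (𝕜 := ℝ))
  refine tendsto_of_tendsto_of_tendsto_of_le_of_le' h1 tendsto_const_nhds ?_ ?_ <;>
    filter_upwards [eventually_gt_atTop 0] with m hm
  · have hm' : (0 : ℝ) < m := by exact_mod_cast hm
    rw [le_div_iff₀ hm', sub_mul, one_div_mul_cancel hm'.ne']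
    linarith [Int.lt_floor_add_one (x * m)]
  · have hm' : (0 : ℝ) < m := by exact_mod_cast hm
    rw [div_le_iff₀ hm']
    exact Int.floor_le _

variable {γ : ℝ → E3}

/-- A zigzag of a height function survives a small change of the direction and the restriction to
the parameters `i / m`, `m` large: the inequalities are strict and finite in number per period. -/
theorem HasZigzag.eventually_isDiscreteZigzag (hγ : Continuous γ) (hper : Function.Periodic γ 1)
    {n : ℕ}
    (hn : 0 < n) {v₀ : E3} (h : HasZigzag n fun t => inner ℝ v₀ (γ t)) :
    ∀ᶠ p : E3 × ℕ in 𝓝 v₀ ×ˢ atTop,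
      ∃ k, IsDiscreteZigzag n p.2 (fun i => inner ℝ p.1 (γ (i / p.2))) k := by
  obtain ⟨x, hx⟩ := h
  have ht : ∀ j, Tendsto (fun p : E3 × ℕ => inner ℝ p.1 (γ ((⌊x j * p.2⌋ : ℝ) / p.2)))
      (𝓝 v₀ ×ˢ atTop) (𝓝 (inner ℝ v₀ (γ (x j)))) := fun j =>
    tendsto_fst.inner ((hγ.tendsto (x j)).comp ((tendsto_int_floor_mul_div (x j)).comp tendsto_snd))
  have hfin : ∀ᶠ p : E3 × ℕ in 𝓝 v₀ ×ˢ atTop, ∀ i ∈ Finset.Ico (0 : ℤ) (2 * n), Even i →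
      inner ℝ p.1 (γ ((⌊x (i + 1) * p.2⌋ : ℝ) / p.2)) < inner ℝ p.1 (γ ((⌊x i * p.2⌋ : ℝ) / p.2)) ∧
      inner ℝ p.1 (γ ((⌊x (i - 1) * p.2⌋ : ℝ) / p.2)) <
        inner ℝ p.1 (γ ((⌊x i * p.2⌋ : ℝ) / p.2)) := by
    rw [Filter.eventually_all_finset]
    intro i _
    by_cases hi : Even i
    · filter_upwards [(ht (i + 1)).eventually_lt (ht i) (hx.right_lt i hi),
        (ht (i - 1)).eventually_lt (ht i) (hx.left_lt i hi)] with p h1 h2 _ using ⟨h1, h2⟩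
    · exact Eventually.of_forall fun p h => absurd h hi
  filter_upwards [hfin, tendsto_snd.eventually (eventually_gt_atTop 0)] with ⟨v, m⟩ hp hm
  simp only at hp hm ⊢
  have hm' : (m : ℝ) ≠ 0 := by exact_mod_cast hm.ne'
  have hkp : ∀ j, ⌊x (j + 2 * n) * m⌋ = ⌊x j * m⌋ + m := fun j => by
    rw [hx.period, add_mul, one_mul, Int.floor_add_natCast]
  have hφ : Function.Periodic (fun j : ℤ => inner ℝ v (γ ((⌊x j * m⌋ : ℝ) / m))) (2 * n : ℤ) := by
    intro j
    simp only [hkp]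
    push_cast
    rw [add_div, div_self hm', hper]
  have hN : (0 : ℤ) < 2 * n := by positivity
  -- by periodicity only the indices `0 ≤ i < 2 * n` matter
  have hred : ∀ i : ℤ, Even i → i % (2 * n) ∈ Finset.Ico (0 : ℤ) (2 * n) ∧ Even (i % (2 * n)) ∧
      ∀ s, inner ℝ v (γ ((⌊x (i + s) * m⌋ : ℝ) / m)) =
        inner ℝ v (γ ((⌊x (i % (2 * n) + s) * m⌋ : ℝ) / m)) := by
    intro i hi
    have e : i = i % (2 * n) + i / (2 * n) * (2 * n) := (Int.emod_add_ediv_mul i _).symm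
    refine ⟨Finset.mem_Ico.2 ⟨Int.emod_nonneg _ hN.ne', Int.emod_lt_of_pos _ hN⟩, ?_, fun s => ?_⟩
    · rw [e] at hi
      refine (Int.even_add.1 hi).2 ?_
      rw [mul_left_comm]; exact even_two_mul _
    · have := hφ.int_mul (i / (2 * n)) (i % (2 * n) + s)
      simp only [Int.cast_id] at this
      rw [← this, add_right_comm, ← e]
  refine ⟨fun j => ⌊x j * m⌋, ⟨fun i j hij => ?_, hkp, fun i hi => ?_, fun i hi => ?_⟩⟩
  · exact Int.floor_le_floor (by gcongr; exact hx.strictMono.monotone hij)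
  · obtain ⟨h1, h2, h3⟩ := hred i hi
    have h0 := h3 0
    rw [add_zero, add_zero] at h0
    rw [h3 1, h0]
    exact (hp _ h1 h2).1
  · obtain ⟨h1, h2, h3⟩ := hred i hi
    have h0 := h3 0
    rw [add_zero, add_zero] at h0
    rw [sub_eq_add_neg, h3 (-1), h0]
    exact (hp _ h1 h2).2

/-- By compactness of the unit sphere, one number of vertices serves all directions. -/
theorem eventually_forall_isDiscreteZigzag (hγ : Continuous γ) (hper : Function.Periodic γ 1)
    (h2 : ∀ v : E3, v ≠ 0 → HasZigzag 2 fun t => inner ℝ v (γ t)) :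
    ∀ᶠ m : ℕ in atTop, ∀ v : E3, v ≠ 0 →
      ∃ k, IsDiscreteZigzag 2 m (fun i => inner ℝ v (γ (i / m))) k := by
  have hs : ∀ᶠ m : ℕ in atTop, ∀ v ∈ Metric.sphere (0 : E3) 1,
      ∃ k, IsDiscreteZigzag 2 m (fun i => inner ℝ v (γ (i / m))) k := by
    refine (isCompact_sphere (0 : E3) 1).induction_on
      (p := fun S => ∀ᶠ m : ℕ in atTop, ∀ v ∈ S,
        ∃ k, IsDiscreteZigzag 2 m (fun i => inner ℝ v (γ (i / m))) k) (by simp) ?_ ?_ ?_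
    · exact fun s t hst h => h.mono fun m hm v hv => hm v (hst hv)
    · intro s t hs ht
      filter_upwards [hs, ht] with m h1 h2 v hv
      exact hv.elim (h1 v) (h2 v)
    · intro v hv
      have hv0 : v ≠ 0 := by rintro rfl; simp at hv
      obtain ⟨U, hU, V, hV, hUV⟩ := Filter.mem_prod_iff.1
        (HasZigzag.eventually_isDiscreteZigzag hγ hper two_pos (h2 v hv0))
      refine ⟨U, mem_nhdsWithin_of_mem_nhds hU, ?_⟩
      filter_upwards [hV] with m hm w hw using hUV (Set.mk_mem_prod hw hm)
  filter_upwards [hs] with m hm v hv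
  have hv' := norm_pos_iff.2 hv
  obtain ⟨k, hk⟩ := hm (‖v‖⁻¹ • v) (by simp [norm_smul, hv])
  have hc : 0 < ‖v‖⁻¹ := by positivity
  refine ⟨k, hk.mono, hk.period, fun i hi => ?_, fun i hi => ?_⟩
  · have := hk.right_lt i hi
    simp only [inner_smul_left] at this
    exact lt_of_mul_lt_mul_left this hc.le
  · have := hk.left_lt i hi
    simp only [inner_smul_left] at this
    exact lt_of_mul_lt_mul_left this hc.le

end Polygon

/-! ### Total curvature -/

section TotalCurvature

open MeasureTheory InnerProductGeometry Filter Topology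

/-- A closed polygon with vertices `P i` and edges `E i`, indexed periodically modulo `m`, has
exterior angles of sum greater than `4 π` if its heights have two peaks in every direction and three
peaks in the directions of some open set. -/
theorem four_pi_lt_sum_angle {m : ℕ} (hm : 0 < m) {E : ℤ → E3} (P : ℤ → E3)
    (hE : ∀ i, E i = P (i + 1) - P i) (hP : ∀ i, P (i + m) = P i) (hE0 : ∀ i, E i ≠ 0)
    (h2 : ∀ v : E3, v ≠ 0 → ∃ k, IsDiscreteZigzag 2 m (fun i => inner ℝ v (P i)) k)
    {U : Set E3} (hU : IsOpen U) (hU1 : (U ∩ Metric.ball 0 1).Nonempty)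
    (h3 : ∀ v ∈ U, ∃ k, IsDiscreteZigzag 3 m (fun i => inner ℝ v (P i)) k) :
    4 * Real.pi < ∑ i ∈ Finset.range m, angle (E i) (E (i + 1)) := by
  set T := ballMeasure.real Set.univ with hT
  have hTpos : 0 < T := by
    rw [hT, measureReal_def, ballMeasure, Measure.restrict_apply_univ]
    exact ENNReal.toReal_pos (Metric.measure_ball_pos _ _ one_pos).ne' measure_ball_lt_top.ne
  have hUpos : 0 < ballMeasure.real U := by
    rw [measureReal_def, ballMeasure, Measure.restrict_apply hU.measurableSet]
    exact ENNReal.toReal_pos ((hU.inter Metric.isOpen_ball).measure_pos _ hU1).ne'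
      (measure_inter_lt_top_of_right_ne_top measure_ball_lt_top.ne).ne
  let S : ℕ → Set E3 := fun i => {v | inner ℝ v (E i) * inner ℝ v (E (i + 1)) < 0}
  have hSm : ∀ i, MeasurableSet (S i) := fun i => measurableSet_inner_mul_inner_neg _ _
  -- almost every direction is orthogonal to no edge
  have hgen : ∀ᵐ v ∂ballMeasure, ∀ i, inner ℝ v (E i) ≠ 0 := by
    rw [ae_all_iff]
    intro i
    refine ae_restrict_of_ae ?_
    have : (volume : Measure E3) ((ℝ ∙ E i)ᗮ : Submodule ℝ E3) = 0 := by
      refine Measure.addHaar_submodule _ _ fun htop => hE0 i ?_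
      have h : E i ∈ (ℝ ∙ E i)ᗮ := htop ▸ Submodule.mem_top
      rw [Submodule.mem_orthogonal_singleton_iff_inner_right] at h
      exact inner_self_eq_zero.1 h
    refine measure_mono_null (fun v hv => ?_) this
    simpa [Submodule.mem_orthogonal_singleton_iff_inner_left] using hv
  have hcount : ∀ᵐ v ∂ballMeasure, (4 : ℝ) + U.indicator (fun _ => 2) v ≤
      ∑ i ∈ Finset.range m, (S i).indicator (fun _ => (1 : ℝ)) v := by
    filter_upwards [hgen] with v hv
    have hv0 : v ≠ 0 := by rintro rfl; exact hv 0 (inner_zero_left _)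
    have hdiff : ∀ i, inner ℝ v (P (i + 1)) - inner ℝ v (P i) = inner ℝ v (E i) := fun i => by
      rw [hE, inner_sub_right]
    have hsum : ∑ i ∈ Finset.range m, (S i).indicator (fun _ => (1 : ℝ)) v =
        ((Finset.range m).filter fun i : ℕ => (inner ℝ v (P (i + 1)) - inner ℝ v (P i)) *
          (inner ℝ v (P (i + 1 + 1)) - inner ℝ v (P (i + 1))) < 0).card := by
      simp only [hdiff]
      rw [Finset.card_filter]
      push_cast
      exact Finset.sum_congr rfl fun i _ => rfl
    have hcard : ∀ n, (∃ k, IsDiscreteZigzag n m (fun i => inner ℝ v (P i)) k) →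
        ((2 * n : ℕ) : ℝ) ≤ ∑ i ∈ Finset.range m, (S i).indicator (fun _ => (1 : ℝ)) v := by
      rintro n ⟨k, hk⟩
      rw [hsum]
      exact_mod_cast hk.card_le hm (fun i => by simp only [hP]) (fun i => by rw [hdiff]; exact hv i)
    by_cases hvU : v ∈ U
    · rw [Set.indicator_of_mem hvU]
      have := hcard 3 (h3 v hvU)
      norm_num at this ⊢
      exact this
    · rw [Set.indicator_of_notMem hvU]
      have := hcard 2 (h2 v hv0)
      norm_num at this ⊢
      exact this
  have hint : 4 * T + 2 * ballMeasure.real U ≤ ∑ i ∈ Finset.range m, ballMeasure.real (S i) := by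
    have e1 : ∫ v, ((4 : ℝ) + U.indicator (fun _ => 2) v) ∂ballMeasure =
        4 * T + 2 * ballMeasure.real U := by
      rw [integral_add (integrable_const _) ((integrable_const _).indicator hU.measurableSet),
        integral_indicator_const _ hU.measurableSet, integral_const]
      simp only [smul_eq_mul]; ring
    have e2 : ∫ v, (∑ i ∈ Finset.range m, (S i).indicator (fun _ => (1 : ℝ)) v) ∂ballMeasure =
        ∑ i ∈ Finset.range m, ballMeasure.real (S i) := by
      rw [integral_finsetSum _ fun i _ => (integrable_const _).indicator (hSm i)]
      exact Finset.sum_congr rfl fun i _ => by rw [integral_indicator_const _ (hSm i)]; simp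
    rw [← e1, ← e2]
    refine integral_mono_ae ?_ ?_ hcount
    · exact (integrable_const _).add ((integrable_const _).indicator hU.measurableSet)
    · exact integrable_finsetSum _ fun i _ => (integrable_const _).indicator (hSm i)
  have hfin : Real.pi * (4 * T + 2 * ballMeasure.real U) ≤
      T * ∑ i ∈ Finset.range m, angle (E i) (E (i + 1)) := by
    refine (mul_le_mul_of_nonneg_left hint Real.pi_pos.le).trans ?_
    rw [Finset.mul_sum, Finset.mul_sum]
    exact Finset.sum_le_sum fun i _ => ballMeasure_inner_mul_inner_neg_le (hE0 _) (hE0 _)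
  have hstrict : T * (4 * Real.pi) < T * ∑ i ∈ Finset.range m, angle (E i) (E (i + 1)) := by
    refine lt_of_lt_of_le ?_ hfin
    have := mul_pos Real.pi_pos hUpos
    linarith
  exact lt_of_mul_lt_mul_left hstrict hTpos.le

namespace Knot

/-- The parametrization of a knot as a map of period one on the real line. -/
def lift (K : Knot) (t : ℝ) : E3 := K.toFun (t : UnitAddCircle)

theorem continuous_lift (K : Knot) : Continuous K.lift :=
  K.continuous_toFun.comp (AddCircle.continuous_mk' 1)

theorem periodic_lift (K : Knot) : Function.Periodic K.lift 1 := fun t => by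
  simp only [lift]; rw [AddCircle.coe_add_period]

theorem lift_ne (K : Knot) {s t : ℝ} (hst : s < t) (hts : t < s + 1) : K.lift s ≠ K.lift t := by
  intro h
  have h1 : (s : UnitAddCircle) = t := K.injective_toFun h
  have : Fact ((0 : ℝ) < 1) := ⟨one_pos⟩
  have := (AddCircle.coe_eq_coe_iff_of_mem_Ico (p := (1 : ℝ)) (a := s) ⟨le_rfl, by linarith⟩
    ⟨hst.le, hts⟩).1 h1
  exact hst.ne this

/-- The total curvature of the polygon with vertices at the parameters `i / (n + 3)`, its cyclic
indices being unfolded to the integers. -/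
theorem polygonTotalCurvature_regular (K : Knot) (n : ℕ) :
    polygonTotalCurvature (fun i : Fin (n + 3) =>
      K.toFun (((i : ℕ) / (n + 3 : ℕ) : ℝ) : UnitAddCircle)) =
      ∑ i ∈ Finset.range (n + 3),
        angle (K.lift (((i : ℤ) + 1 : ℤ) / (n + 3 : ℕ)) - K.lift ((i : ℤ) / (n + 3 : ℕ)))
        (K.lift (((i : ℤ) + 1 + 1 : ℤ) / (n + 3 : ℕ)) - K.lift (((i : ℤ) + 1 : ℤ) / (n + 3 : ℕ))) :=
          by
  have hm : ((n + 3 : ℕ) : ℝ) ≠ 0 := by positivity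
  have hmod : ∀ a : ℕ, K.lift ((a % (n + 3) : ℕ) / (n + 3 : ℕ)) = K.lift (a / (n + 3 : ℕ)) := by
    intro a
    have e : (a : ℝ) / (n + 3 : ℕ) = (a % (n + 3) : ℕ) / (n + 3 : ℕ) + (a / (n + 3) : ℕ) * 1 := by
      rw [mul_one, div_add' _ _ _ hm]
      congr 1
      exact_mod_cast (Nat.mod_add_div' a (n + 3)).symm
    rw [e, K.periodic_lift.nat_mul]
  rw [polygonTotalCurvature, ← Fin.sum_univ_eq_sum_range (fun i : ℕ =>
    angle (K.lift (((i : ℤ) + 1 : ℤ) / (n + 3 : ℕ)) - K.lift ((i : ℤ) / (n + 3 : ℕ)))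
        (K.lift (((i : ℤ) + 1 + 1 : ℤ) / (n + 3 : ℕ)) - K.lift (((i : ℤ) + 1 : ℤ) / (n + 3 : ℕ))))]
  refine Finset.sum_congr rfl fun i _ => ?_
  have h1 : K.toFun ((((i + 1 : Fin (n + 3)) : ℕ) / (n + 3 : ℕ) : ℝ) : UnitAddCircle) =
      K.lift (((i : ℤ) + 1 : ℤ) / (n + 3 : ℕ)) := by
    have : ((i + 1 : Fin (n + 3)) : ℕ) = ((i : ℕ) + 1) % (n + 3) := by simp [Fin.val_add]
    rw [this]
    refine (hmod (i + 1)).trans ?_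
    push_cast; rfl
  have h2 : K.toFun ((((i + 2 : Fin (n + 3)) : ℕ) / (n + 3 : ℕ) : ℝ) : UnitAddCircle) =
      K.lift (((i : ℤ) + 1 + 1 : ℤ) / (n + 3 : ℕ)) := by
    have : ((i + 2 : Fin (n + 3)) : ℕ) = ((i : ℕ) + 2) % (n + 3) := by simp [Fin.val_add]
    rw [this]
    refine (hmod (i + 2)).trans ?_
    push_cast; rw [add_assoc]; norm_num
  have h0 : K.toFun ((((i : Fin (n + 3)) : ℕ) / (n + 3 : ℕ) : ℝ) : UnitAddCircle) =
      K.lift ((i : ℤ) / (n + 3 : ℕ)) := by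
    push_cast; rfl
  rw [h1, h2, h0]

/-- A knot all of whose height functions have two peaks has total curvature greater than `4 π`. -/
theorem four_pi_lt_totalCurvature (K : Knot)
    (h2 : ∀ v : E3, v ≠ 0 → HasZigzag 2 fun t => inner ℝ v (K.lift t)) :
    ENNReal.ofReal (4 * Real.pi) < K.totalCurvature := by
  obtain ⟨v₁, x, hx⟩ := exists_hasZigzag_three K.periodic_lift h2
  -- the direction with three peaks is scaled into the unit ball
  set c : ℝ := (‖v₁‖ + 1)⁻¹ with hc
  have hc0 : 0 < c := by positivity
  set v₀ := c • v₁ with hv₀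
  have hball : v₀ ∈ Metric.ball (0 : E3) 1 := by
    rw [mem_ball_zero_iff, hv₀, norm_smul, Real.norm_of_nonneg hc0.le, hc,
        inv_mul_lt_iff₀ (by positivity)]
    linarith
  have h3 : HasZigzag 3 fun t => inner ℝ v₀ (K.lift t) := by
    refine ⟨x, hx.strictMono, hx.period, fun i hi => ?_, fun i hi => ?_⟩
    · simpa only [hv₀, real_inner_smul_left] using mul_lt_mul_of_pos_left (hx.right_lt i hi) hc0
    · simpa only [hv₀, real_inner_smul_left] using mul_lt_mul_of_pos_left (hx.left_lt i hi) hc0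
  obtain ⟨U, hU, V, hV, hUV⟩ := Filter.mem_prod_iff.1
    (HasZigzag.eventually_isDiscreteZigzag K.continuous_lift K.periodic_lift three_pos h3)
  obtain ⟨U', hU'U, hU'o, hvU'⟩ := mem_nhds_iff.1 hU
  obtain ⟨m, hm3, hmV, hm2⟩ := ((eventually_ge_atTop 3).and ((show ∀ᶠ m in atTop, m ∈ V from hV).and
    (eventually_forall_isDiscreteZigzag K.continuous_lift K.periodic_lift h2))).exists
  obtain ⟨n, rfl⟩ : ∃ n, m = n + 3 := ⟨m - 3, by omega⟩
  have hm : (0 : ℝ) < (n + 3 : ℕ) := by positivity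
  have key := four_pi_lt_sum_angle (m := n + 3) (by omega)
    (E := fun i : ℤ => K.lift ((i + 1 : ℤ) / (n + 3 : ℕ)) - K.lift (i / (n + 3 : ℕ)))
    (fun i => K.lift (i / (n + 3 : ℕ))) (fun i => rfl)
    (fun i => by
      have : ((i + (n + 3 : ℕ) : ℤ) : ℝ) / (n + 3 : ℕ) = i / (n + 3 : ℕ) + 1 := by
        rw [Int.cast_add, Int.cast_natCast, add_div, div_self hm.ne']
      simp only [this, K.periodic_lift _])
    (fun i => sub_ne_zero.2 (K.lift_ne (by gcongr; simp) (by
      rw [div_add_one hm.ne', div_lt_div_iff_of_pos_right hm]; push_cast; linarith)).symm)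
    hm2 hU'o ⟨v₀, hvU', hball⟩ (fun v hv => hUV (Set.mk_mem_prod (hU'U hv) hmV))
  rw [← K.polygonTotalCurvature_regular n] at key
  have hmono : StrictMono fun i : Fin (n + 3) => ((i : ℕ) / (n + 3 : ℕ) : ℝ) := fun i j hij => by
    dsimp only
    gcongr
    exact hij
  have hle : ENNReal.ofReal (polygonTotalCurvature (fun i : Fin (n + 3) =>
      K.toFun (((i : ℕ) / (n + 3 : ℕ) : ℝ) : UnitAddCircle))) ≤ K.totalCurvature := by
    refine le_iSup_of_le n (le_iSup_of_le (fun i : Fin (n + 3) => ((i : ℕ) / (n + 3 : ℕ) : ℝ))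
      (le_iSup_of_le hmono (le_iSup_of_le ?_ le_rfl)))
    simp only [Fin.val_last, Fin.val_zero, Nat.cast_zero, zero_div]
    rw [div_lt_iff₀ hm]
    push_cast
    linarith
  refine lt_of_lt_of_le ?_ hle
  exact (ENNReal.ofReal_lt_ofReal_iff (by linarith [Real.pi_pos])).2 key

end Knot

end TotalCurvature

/-! ### Ambient isotopies that preserve horizontal planes -/

section Isotopy

open Set

/-- Ambient isotopy of subsets of a topological space, of which `AmbientIsotopic` is the case of
Euclidean three-space. -/
def IsotopicIn {X : Type*} [TopologicalSpace X] (A B : Set X) : Prop :=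
  ∃ H : unitInterval → (X ≃ₜ X),
    Continuous (fun q : unitInterval × X => H q.1 q.2) ∧ H 0 = Homeomorph.refl X ∧ (H 1) '' A = B

namespace IsotopicIn

variable {X Y : Type*} [TopologicalSpace X] [TopologicalSpace Y] {A B C : Set X}

theorem trans (hAB : IsotopicIn A B) (hBC : IsotopicIn B C) : IsotopicIn A C := by
  obtain ⟨H, hH, hH0, rfl⟩ := hAB
  obtain ⟨J, hJ, hJ0, rfl⟩ := hBC
  refine ⟨fun s => (H s).trans (J s), ?_, Homeomorph.ext fun x => by simp [hH0, hJ0],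
    by rw [image_image]; rfl⟩
  exact hJ.comp (continuous_fst.prodMk hH)

theorem image (e : X ≃ₜ Y) (hAB : IsotopicIn A B) : IsotopicIn (e '' A) (e '' B) := by
  obtain ⟨H, hH, hH0, rfl⟩ := hAB
  refine ⟨fun s => (e.symm.trans (H s)).trans e, ?_, ?_, by simp [image_image]⟩
  · exact e.continuous.comp
      (hH.comp (continuous_fst.prodMk (e.symm.continuous.comp continuous_snd)))
  · ext x; simp [hH0]

/-- An isotopy may be given by a continuous family of maps and, for each parameter, a continuous
inverse; joint continuity of the inverses is not required. -/
theorem of_family (F G : unitInterval → X → X) (hF : Continuous fun q : unitInterval × X =>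
    F q.1 q.2)
    (hG : ∀ s, Continuous (G s)) (hGF : ∀ s, Function.LeftInverse (G s) (F s))
    (hFG : ∀ s, Function.RightInverse (G s) (F s)) (h0 : ∀ x, F 0 x = x) (h1 : F 1 '' A = B) :
    IsotopicIn A B :=
  ⟨fun s =>
    { toFun := F s
      invFun := G s
      left_inv := hGF s
      right_inv := hFG s
      continuous_toFun := hF.comp (Continuous.prodMk_right s)
      continuous_invFun := hG s }, hF, Homeomorph.ext h0, h1⟩

end IsotopicIn

/-- A map that agrees with a continuous map to within a continuous error is continuous wherever the
error vanishes. -/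
theorem continuous_of_dist_le {Y E : Type*} [TopologicalSpace Y] [MetricSpace E] {f g : Y → E}
    {b : Y → ℝ} {U : Set Y} (hU : IsOpen U) (hf : ContinuousOn f U) (hg : Continuous g)
    (hb : Continuous b) (hfg : ∀ y, dist (f y) (g y) ≤ b y) (hb0 : ∀ y ∉ U, b y = 0) :
    Continuous f := by
  rw [continuous_iff_continuousAt]
  intro y
  by_cases hy : y ∈ U
  · exact hf.continuousAt (hU.mem_nhds hy)
  · have hfy : f y = g y := dist_le_zero.1 ((hfg y).trans (hb0 y hy).le)
    rw [ContinuousAt, hfy]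
    refine (tendsto_iff_of_dist ?_).2 (hg.tendsto y)
    refine squeeze_zero (fun _ => dist_nonneg) hfg ?_
    simpa [hb0 y hy] using hb.tendsto y

/-- The union of the graphs over `[-1, 1]` of two functions of the height. -/
def twoStrands (p q : ℝ → ℂ) : Set (ℂ × ℝ) :=
  {x | x.2 ∈ Icc (-1 : ℝ) 1 ∧ (x.1 = p x.2 ∨ x.1 = q x.2)}

theorem image_twoStrands {F : ℂ × ℝ → ℂ × ℝ} {p q p' q' : ℝ → ℂ}
    (hp : ∀ z ∈ Icc (-1 : ℝ) 1, F (p z, z) = (p' z, z))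
    (hq : ∀ z ∈ Icc (-1 : ℝ) 1, F (q z, z) = (q' z, z)) :
    F '' twoStrands p q = twoStrands p' q' := by
  ext ⟨w, z⟩
  constructor
  · rintro ⟨⟨w', z'⟩, ⟨hz, h' | h'⟩, h⟩ <;> dsimp only at hz h h' <;> subst h'
    · rw [hp _ hz] at h
      obtain ⟨rfl, rfl⟩ := Prod.mk.inj h
      exact ⟨hz, Or.inl rfl⟩
    · rw [hq _ hz] at h
      obtain ⟨rfl, rfl⟩ := Prod.mk.inj h
      exact ⟨hz, Or.inr rfl⟩
  · rintro ⟨hz, h | h⟩ <;> dsimp only at hz h <;> subst h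
    · exact ⟨(p z, z), ⟨hz, Or.inl rfl⟩, hp z hz⟩
    · exact ⟨(q z, z), ⟨hz, Or.inr rfl⟩, hq z hz⟩

/-- Horizontal planes may be translated, each by its own vector. -/
theorem isotopicIn_translate {m : ℝ → ℂ} (hm : Continuous m) (A : Set (ℂ × ℝ)) :
    IsotopicIn A ((fun x => (x.1 + m x.2, x.2)) '' A) := by
  refine IsotopicIn.of_family (fun s x => (x.1 + (s : ℝ) * m x.2, x.2))
    (fun s x => (x.1 - (s : ℝ) * m x.2, x.2)) (by fun_prop) (fun s => by fun_prop)
    (fun s x => by simp) (fun s x => by simp) (fun x => by simp) (by simp)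

/-- Two strands `d` and `-d` that meet exactly at the ends can be turned into a constant direction.
At height `z` the circle through a point `w` is rotated by `u ((1 - σ) z) / u z`, where `u = d /
‖d‖`. Here `σ` is the time on the strands and decreases to `0` at twice their distance from the
axis. Hence points are moved by no more than a multiple of `‖d z‖`, and the isotopy is continuous
also at the ends, where `u` need not have a limit. -/
theorem isotopicIn_rotate {d : ℝ → ℂ} (hd : Continuous d) (hd0 : ∀ z, d z =
    0 ↔ z ∉ Ioo (-1 : ℝ) 1) :
    IsotopicIn (twoStrands d (-d)) (twoStrands (fun z => ‖d z‖ * (d 0 / ‖d 0‖))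
      (fun z => -(‖d z‖ * (d 0 / ‖d 0‖)))) := by
  classical
  have hdne : ∀ z ∈ Ioo (-1 : ℝ) 1, d z ≠ 0 := fun z hz h => (hd0 z).1 h hz
  let u : ℝ → ℂ := fun z => d z / ‖d z‖
  have hu : ∀ z ∈ Ioo (-1 : ℝ) 1, ‖u z‖ = 1 := fun z hz => by
    simp [u, hdne z hz]
  have huc : ContinuousOn u (Ioo (-1) 1) :=
    hd.continuousOn.div (by fun_prop) fun z hz => by simpa using hdne z hz
  -- for `σ` from `0` to `1`, a factor turning `u z` into `u 0`
  let R : ℝ → ℝ → ℂ := fun z σ => if z ∈ Ioo (-1 : ℝ) 1 then u ((1 - σ) * z) / u z else 1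
  have hshrink : ∀ z ∈ Ioo (-1 : ℝ) 1, ∀ σ ∈ Icc (0 : ℝ) 1, (1 - σ) * z ∈ Ioo (-1 : ℝ) 1 := by
    intro z hz σ hσ
    have : |(1 - σ) * z| < 1 := by
      rw [abs_mul, abs_of_nonneg (sub_nonneg.2 hσ.2)]
      exact lt_of_le_of_lt (mul_le_of_le_one_left (abs_nonneg _) (by linarith [hσ.1])) (abs_lt.2 hz)
    exact abs_lt.1 this
  have hRnorm : ∀ z, ∀ σ ∈ Icc (0 : ℝ) 1, ‖R z σ‖ = 1 := by
    intro z σ hσ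
    simp only [R]
    split_ifs with hz
    · rw [norm_div, hu z hz, hu _ (hshrink z hz σ hσ), div_one]
    · simp
  have hR0 : ∀ z, R z 0 = 1 := by
    intro z
    simp only [R]
    split_ifs with hz
    · rw [sub_zero, one_mul, div_self]
      exact norm_ne_zero_iff.1 (by rw [hu z hz]; norm_num)
    · rfl
  let χ : ℝ → ℝ := fun r => max 0 (min 1 (2 - r))
  have hχ : ∀ r, χ r ∈ Icc (0 : ℝ) 1 := fun r =>
      ⟨le_max_left _ _, max_le zero_le_one (min_le_left _ _)⟩
  have hχ2 : ∀ r, 2 ≤ r → χ r = 0 := fun r hr =>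
      max_eq_left (le_trans (min_le_right _ _) (by linarith))
  have hsχ : ∀ (s : unitInterval) r, (s : ℝ) * χ r ∈ Icc (0 : ℝ) 1 := fun s r =>
    ⟨mul_nonneg s.2.1 (hχ r).1, mul_le_one₀ s.2.2 (hχ r).1 (hχ r).2⟩
  let ρ : unitInterval × (ℂ × ℝ) → ℂ := fun q => R q.2.2 (q.1 * χ (‖q.2.1‖ / ‖d q.2.2‖))
  have hρ : ∀ q, ‖ρ q‖ = 1 := fun q => hRnorm _ _ (hsχ _ _)
  have hρ0 : ∀ q, ρ q ≠ 0 := fun q => norm_ne_zero_iff.1 (by rw [hρ]; norm_num)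
  let U : Set (unitInterval × (ℂ × ℝ)) := {q | q.2.2 ∈ Ioo (-1 : ℝ) 1}
  have hU : IsOpen U := isOpen_Ioo.preimage (by fun_prop : Continuous fun q :
      unitInterval × (ℂ × ℝ) => q.2.2)
  have hρc : ContinuousOn ρ U := by
    have h1 : ContinuousOn (fun q : unitInterval × (ℂ × ℝ) =>
        u ((1 - q.1 * χ (‖q.2.1‖ / ‖d q.2.2‖)) * q.2.2) / u q.2.2) U := by
      have hχc : Continuous χ := by fun_prop
      refine ContinuousOn.div (huc.comp ?_ fun q hq => hshrink _ hq _ (hsχ _ _))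
        (huc.comp (by fun_prop) fun q hq => hq) fun q hq =>
          norm_ne_zero_iff.1 (by rw [hu _ hq]; norm_num)
      have h2 : ContinuousOn (fun q : unitInterval × (ℂ × ℝ) => ‖q.2.1‖ / ‖d q.2.2‖) U :=
        ContinuousOn.div (by fun_prop) (by fun_prop) fun q hq => norm_ne_zero_iff.2 (hdne _ hq)
      have h3 := hχc.comp_continuousOn h2
      exact (continuousOn_const.sub (ContinuousOn.mul (by fun_prop) h3)).mul (by fun_prop)
    exact h1.congr fun q hq => if_pos hq
  have hbound : ∀ q, ‖ρ q - 1‖ * ‖q.2.1‖ ≤ 4 * ‖d q.2.2‖ := by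
    intro q
    by_cases hz : q.2.2 ∈ Ioo (-1 : ℝ) 1
    · have hdpos := norm_pos_iff.2 (hdne _ hz)
      rcases le_or_gt (2 * ‖d q.2.2‖) ‖q.2.1‖ with h | h
      · have : ρ q = 1 := by
          simp only [ρ]
          rw [hχ2 _ ((le_div_iff₀ hdpos).2 h), mul_zero, hR0]
        rw [this]; simp
      · have h1 : ‖ρ q - 1‖ ≤ 2 := by
          refine (norm_sub_le _ _).trans ?_
          rw [hρ]; norm_num
        nlinarith [norm_nonneg q.2.1, norm_nonneg (ρ q - 1)]
    · have : ρ q = 1 := if_neg hz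
      rw [this]; simp
  have hcont : ∀ {κ : unitInterval × (ℂ × ℝ) → ℂ}, ContinuousOn κ U →
      (∀ q, ‖κ q - 1‖ * ‖q.2.1‖ ≤ 4 * ‖d q.2.2‖) →
      Continuous fun q : unitInterval × (ℂ × ℝ) => (κ q * q.2.1, q.2.2) := by
    intro κ hκ hb
    refine Continuous.prodMk ?_ (by fun_prop)
    refine continuous_of_dist_le (g := fun q : unitInterval × (ℂ × ℝ) => q.2.1)
      (b := fun q => 4 * ‖d q.2.2‖) hU (hκ.mul (by fun_prop)) (by fun_prop) (by fun_prop) ?_ ?_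
    · intro q
      rw [dist_eq_norm, ← sub_one_mul, norm_mul]
      exact hb q
    · intro q hq
      rw [(hd0 _).2 hq]; simp
  have hinv : ∀ q, ‖(ρ q)⁻¹ - 1‖ = ‖ρ q - 1‖ := by
    intro q
    have : (ρ q)⁻¹ - 1 = -(ρ q)⁻¹ * (ρ q - 1) := by
      field_simp [hρ0 q]; ring
    rw [this, norm_mul, norm_neg, norm_inv, hρ, inv_one, one_mul]
  refine IsotopicIn.of_family (fun s x => (ρ (s, x) * x.1, x.2))
      (fun s x => ((ρ (s, x))⁻¹ * x.1, x.2))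
    (hcont hρc hbound) ?_ ?_ ?_ ?_ ?_
  · intro s
    exact (hcont (hρc.inv₀ fun q _ => hρ0 q) fun q => by
      rw [Pi.inv_apply, hinv]; exact hbound q).comp
      (Continuous.prodMk_right s)
  · intro s x
    have : ρ (s, (ρ (s, x) * x.1, x.2)) = ρ (s, x) := by
      simp only [ρ]
      rw [norm_mul, hRnorm _ _ (hsχ _ _), one_mul]
    dsimp only
    rw [this, inv_mul_cancel_left₀ (hρ0 _)]
  · intro s x
    have : ρ (s, ((ρ (s, x))⁻¹ * x.1, x.2)) = ρ (s, x) := by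
      simp only [ρ]
      rw [norm_mul, norm_inv, hRnorm _ _ (hsχ _ _), inv_one, one_mul]
    dsimp only
    rw [this, mul_inv_cancel_left₀ (hρ0 _)]
  · intro x
    simp [ρ, hR0]
  · have key : ∀ z w, ‖w‖ = ‖d z‖ → z ∈ Ioo (-1 : ℝ) 1 → ρ (1, (w, z)) = u 0 / u z := by
      intro z w hw hz
      have : χ 1 = 1 := by simp only [χ]; norm_num
      simp only [ρ, hw, div_self (norm_ne_zero_iff.2 (hdne z hz)), this, R, if_pos hz]
      simp
    have main : ∀ z, z ∈ Icc (-1 : ℝ) 1 → ∀ w, ‖w‖ = ‖d z‖ → z ∈ Ioo (-1 : ℝ) 1 →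
        ρ (1, (w, z)) * w = (w / d z) * (‖d z‖ * (d 0 / ‖d 0‖)) := by
      intro z _ w hw hz
      rw [key z w hw hz]
      have h1 := hdne z hz
      have h2 : (‖d z‖ : ℂ) ≠ 0 := by simpa using h1
      simp only [u]
      field_simp
    refine image_twoStrands ?_ ?_
    · intro z hz
      by_cases hz' : z ∈ Ioo (-1 : ℝ) 1
      · rw [main z hz _ rfl hz', div_self (hdne z hz'), one_mul]
      · simp [(hd0 z).2 hz']
    · intro z hz
      by_cases hz' : z ∈ Ioo (-1 : ℝ) 1
      · rw [main z hz _ (by simp) hz', Pi.neg_apply, neg_div, div_self (hdne z hz'), neg_one_mul]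
      · simp [(hd0 z).2 hz']

/-- The radial map of the plane that stretches the disc of radius `f` linearly onto the disc of
radius `g` and moves the points outside by `g - f` along their rays. For `f = g = 0` it is the
identity, by the convention `0 / 0 = 0`. -/
def radialShift (f g : ℝ) (w : ℂ) : ℂ := w + ((g - f) / max ‖w‖ f : ℝ) * w

theorem norm_radialShift_sub_le {f g : ℝ} (w : ℂ) : dist (radialShift f g w) w ≤ |g - f| := by
  rw [radialShift, dist_eq_norm, add_sub_cancel_left, norm_mul, Complex.norm_real, Real.norm_eq_abs,
    abs_div]
  have h : ‖w‖ ≤ |max ‖w‖ f| := (le_max_left _ _).trans (le_abs_self _)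
  rw [div_mul_eq_mul_div]
  exact div_le_of_le_mul₀ (abs_nonneg _) (abs_nonneg _) (by gcongr)

theorem radialShift_radialShift {f g : ℝ} (h : 0 < f ∧ 0 < g ∨ f = 0 ∧ g = 0) (w : ℂ) :
    radialShift g f (radialShift f g w) = w := by
  rcases h with ⟨hf, hg⟩ | ⟨rfl, rfl⟩
  · have e : radialShift f g w = ((1 + (g - f) / max ‖w‖ f : ℝ) : ℂ) * w := by
      rw [radialShift]; push_cast; ring
    rcases le_total ‖w‖ f with hw | hw
    · have e1 : radialShift f g w = ((g / f : ℝ) : ℂ) * w := by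
        rw [e, max_eq_right hw]; congr 2; field_simp; ring
      have e2 : ‖radialShift f g w‖ ≤ g := by
        rw [e1, norm_mul, Complex.norm_real, Real.norm_of_nonneg (by positivity),
            div_mul_eq_mul_div,
          div_le_iff₀ hf]
        gcongr
      have hf' : (f : ℂ) ≠ 0 := by exact_mod_cast hf.ne'
      have hg' : (g : ℂ) ≠ 0 := by exact_mod_cast hg.ne'
      rw [radialShift, max_eq_right e2, e1]
      push_cast
      field_simp
      ring
    · have hw0 : 0 < ‖w‖ := hf.trans_le hw
      have e1 : radialShift f g w = (((‖w‖ + g - f) / ‖w‖ : ℝ) : ℂ) * w := by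
        rw [e, max_eq_left hw]; congr 2; field_simp; ring
      have hpos : 0 < ‖w‖ + g - f := by linarith
      have e2 : ‖radialShift f g w‖ = ‖w‖ + g - f := by
        rw [e1, norm_mul, Complex.norm_real, Real.norm_of_nonneg (by positivity)]
        field_simp
      rw [radialShift, e2, max_eq_left (by linarith), e1, ← mul_assoc, ← add_mul,
          ← Complex.ofReal_mul,
        ← Complex.ofReal_add]
      have : (‖w‖ + g - f) / ‖w‖ + (f - g) / (‖w‖ + g - f) * ((‖w‖ + g - f) / ‖w‖) = 1 := by
        field_simp; ring
      rw [this]; simp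
  · simp [radialShift]

/-- The distance of two strands `f z * c` and `-(f z * c)` from the axis can be changed to any other
function that vanishes exactly at the ends. -/
theorem isotopicIn_radial {f g : ℝ → ℝ} (hf : Continuous f) (hg : Continuous g)
    (hpos : ∀ z ∈ Ioo (-1 : ℝ) 1, 0 < f z ∧ 0 < g z) (h0 : ∀ z ∉ Ioo (-1 : ℝ) 1, f z = 0 ∧ g z = 0)
    {c : ℂ} (hc : ‖c‖ = 1) :
    IsotopicIn (twoStrands (fun z => f z * c) (fun z => -(f z * c)))
      (twoStrands (fun z => g z * c) (fun z => -(g z * c))) := by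
  let k : unitInterval → ℝ → ℝ := fun s z => (1 - s) * f z + s * g z
  have hk : Continuous fun q : unitInterval × ℝ => k q.1 q.2 := by fun_prop
  have hfk : ∀ s z, 0 < f z ∧ 0 < k s z ∨ f z = 0 ∧ k s z = 0 := by
    intro s z
    by_cases hz : z ∈ Ioo (-1 : ℝ) 1
    · left
      refine ⟨(hpos z hz).1, ?_⟩
      obtain ⟨h1, h2⟩ := hpos z hz
      have hs0 := s.2.1
      have hs1 := s.2.2
      rcases hs0.eq_or_lt with h | h
      · simp only [k]; rw [← h]; linarith
      · have := mul_pos h h2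
        have := mul_nonneg (sub_nonneg.2 hs1) h1.le
        simp only [k]; linarith
    · right
      simp [k, h0 z hz]
  have hcont : ∀ {a b : unitInterval × (ℂ × ℝ) → ℝ}, Continuous a → Continuous b →
      (∀ q, 0 < a q ∧ 0 < b q ∨ a q = 0 ∧ b q = 0) →
      Continuous fun q : unitInterval × (ℂ × ℝ) => (radialShift (a q) (b q) q.2.1, q.2.2) := by
    intro a b ha hb hab
    refine Continuous.prodMk ?_ (by fun_prop)
    refine continuous_of_dist_le (g := fun q : unitInterval × (ℂ × ℝ) => q.2.1)
      (b := fun q => |b q - a q|) (U := {q | 0 < a q}) (isOpen_lt continuous_const ha) ?_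
        (by fun_prop)
      (by fun_prop) (fun q => norm_radialShift_sub_le _) ?_
    · have h1 : ContinuousOn (fun q : unitInterval × (ℂ × ℝ) => (b q - a q) / max ‖q.2.1‖ (a q))
          {q | 0 < a q} :=
        ContinuousOn.div (by fun_prop) (by fun_prop) fun q hq => (lt_max_of_lt_right hq).ne'
      exact ContinuousOn.add (by fun_prop)
        ((Complex.continuous_ofReal.comp_continuousOn h1).mul (by fun_prop))
    · intro q hq
      rcases hab q with h | h
      · exact absurd h.1 hq
      · simp [h]
  refine IsotopicIn.of_family (fun s x => (radialShift (f x.2) (k s x.2) x.1, x.2))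
    (fun s x => (radialShift (k s x.2) (f x.2) x.1, x.2))
    (hcont (a := fun q => f q.2.2) (b := fun q => k q.1 q.2.2) (by fun_prop)
      (by fun_prop) fun q => hfk _ _) ?_ ?_ ?_ ?_ ?_
  · intro s
    exact (hcont (a := fun q => k q.1 q.2.2) (b := fun q => f q.2.2) (by fun_prop) (by fun_prop)
      fun q => (hfk _ _).imp And.symm And.symm).comp (Continuous.prodMk_right s)
  · intro s x
    simp only [radialShift_radialShift (hfk s x.2)]
  · intro s x
    simp only [radialShift_radialShift ((hfk s x.2).imp And.symm And.symm)]
  · intro x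
    simp [k, radialShift]
  · have key : ∀ z (w : ℂ), ‖w‖ = 1 → radialShift (f z) (k 1 z) (f z * w) = g z * w := by
      intro z w hw
      by_cases hz : z ∈ Ioo (-1 : ℝ) 1
      · have h1 := (hpos z hz).1
        have h2 : (f z : ℂ) ≠ 0 := by exact_mod_cast h1.ne'
        rw [radialShift, norm_mul, hw, Complex.norm_real, Real.norm_of_nonneg h1.le, mul_one,
            max_self]
        simp only [k, Icc.coe_one]
        push_cast
        field_simp
        ring
      · simp [h0 z hz, radialShift]
    refine image_twoStrands ?_ ?_
    · intro z _
      simp only [key z c hc]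
    · intro z _
      have := key z (-c) (by simpa using hc)
      simp only [mul_neg] at this
      simp only [this]

end Isotopy

/-! ### Curves with strictly unimodal height -/

section Strands

open Set

/-- Points may be moved up by an amount that is nondecreasing on each vertical line. At each time
this is an expanding homeomorphism of every line, and expansion makes the inverse continuous. -/
theorem isotopicIn_vertical {G : ℂ × ℝ → ℝ} (hG : Continuous G)
    (hmono : ∀ w, Monotone fun z => G (w, z)) (A : Set (ℂ × ℝ)) :
    IsotopicIn A ((fun x => (x.1, x.2 + G x)) '' A) := by
  let f : unitInterval → ℂ → ℝ → ℝ := fun s w z => z + s * G (w, z)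
  have hexp : ∀ s w z z', |z - z'| ≤ |f s w z - f s w z'| := by
    intro s w z z'
    wlog h : z' ≤ z generalizing z z'
    · rw [abs_sub_comm, abs_sub_comm (f s w z)]
      exact this z' z (le_of_not_ge h)
    · have h1 := mul_le_mul_of_nonneg_left (hmono w h) s.2.1
      dsimp only at h1
      rw [abs_of_nonneg (sub_nonneg.2 h), abs_of_nonneg] <;> simp only [f] <;> linarith
  have hbij : ∀ s w, Function.Bijective (f s w) := by
    intro s w
    constructor
    · intro z z' h
      have := hexp s w z z'
      rw [h, sub_self, abs_zero] at this
      exact sub_eq_zero.1 (abs_nonpos_iff.1 this)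
    · refine Continuous.surjective (by fun_prop) ?_ ?_
      · refine Filter.tendsto_atTop_mono' _ ?_
          (Filter.tendsto_atTop_add_const_right _ (s * G (w, 0)) Filter.tendsto_id)
        filter_upwards [Filter.eventually_ge_atTop 0] with z hz
        have := mul_le_mul_of_nonneg_left (hmono w hz) s.2.1
        dsimp only at this
        simp only [f, id]; linarith
      · refine Filter.tendsto_atBot_mono' _ ?_
          (Filter.tendsto_atBot_add_const_right _ (s * G (w, 0)) Filter.tendsto_id)
        filter_upwards [Filter.eventually_le_atBot 0] with z hz
        have := mul_le_mul_of_nonneg_left (hmono w hz) s.2.1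
        dsimp only at this
        simp only [f, id]; linarith
  let e : unitInterval → ℂ → ℝ ≃ ℝ := fun s w => Equiv.ofBijective (f s w) (hbij s w)
  have hfe : ∀ s w z, f s w ((e s w).symm z) = z := fun s w z => (e s w).apply_symm_apply z
  refine IsotopicIn.of_family (fun s x => (x.1, f s x.1 x.2)) (fun s x => (x.1, (e s x.1).symm x.2))
    (by fun_prop) ?_ (fun s x => Prod.ext rfl ((e s x.1).symm_apply_apply x.2))
    (fun s x => Prod.ext rfl (hfe s x.1 x.2)) (fun x => by simp [f]) (by simp [f])
  intro s
  refine Continuous.prodMk (by fun_prop) (continuous_iff_continuousAt.2 fun y₀ => ?_)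
  rw [ContinuousAt, tendsto_iff_dist_tendsto_zero]
  set z₀ := (e s y₀.1).symm y₀.2 with hz₀
  have hlim : Filter.Tendsto (fun y : ℂ × ℝ => |y.2 - f s y.1 z₀|) (nhds y₀) (nhds 0) := by
    have h1 : Continuous fun y : ℂ × ℝ => |y.2 - f s y.1 z₀| := by fun_prop
    have h2 := h1.tendsto y₀
    rwa [hz₀, hfe, sub_self, abs_zero] at h2
  refine squeeze_zero (fun _ => dist_nonneg) (fun y => ?_) hlim
  have := hexp s y.1 ((e s y.1).symm y.2) z₀
  rw [hfe] at this
  exact this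

theorem isotopicIn_vertical_affine {a : ℝ} (ha : 0 < a) (b : ℝ) (A : Set (ℂ × ℝ)) :
    IsotopicIn A ((fun x => (x.1, a * x.2 + b)) '' A) := by
  let k : unitInterval → ℝ := fun s => (1 - s) + s * a
  have hk : ∀ s, k s ≠ 0 := by
    intro s
    have hs0 := s.2.1
    have hs1 := s.2.2
    rcases hs0.eq_or_lt with h | h
    · simp [k, ← h]
    · have := mul_pos h ha
      have : 0 < k s := by simp only [k]; linarith
      exact this.ne'
  refine IsotopicIn.of_family (fun s x => (x.1, k s * x.2 + s * b))
      (fun s x => (x.1, (x.2 - s * b) / k s))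
    (by fun_prop) (fun s => by fun_prop) (fun s x => ?_) (fun s x => ?_) (fun x => by simp [k])
      (by simp [k])
  · have := hk s
    simp [this]
  · have := hk s
    refine Prod.ext rfl ?_
    show k s * ((x.2 - s * b) / k s) + s * b = x.2
    rw [mul_div_cancel₀ _ this, sub_add_cancel]

/-- A round circle in a vertical plane is rotated about the vertical axis and then by a quarter turn
about the real axis. -/
theorem isotopicIn_circle {c : ℂ} (hc : ‖c‖ = 1) :
    IsotopicIn (twoStrands (fun z => √(1 - z ^ 2) * c) (fun z => -(√(1 - z ^ 2) * c)))
      {x | ‖x.1‖ = 1 ∧ x.2 = 0} := by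
  have step₁ : IsotopicIn (twoStrands (fun z => √(1 - z ^ 2) * c) (fun z => -(√(1 - z ^ 2) * c)))
      (twoStrands (fun z => √(1 - z ^ 2)) (fun z => -√(1 - z ^ 2))) := by
    have hc' : Complex.exp (-(c.arg * Complex.I)) * c = 1 := by
      have h := Complex.norm_mul_exp_arg_mul_I c
      rw [hc, Complex.ofReal_one, one_mul] at h
      calc Complex.exp (-(c.arg * Complex.I)) * c
          = Complex.exp (-(c.arg * Complex.I)) * Complex.exp (c.arg * Complex.I) := by rw [h]
        _ = 1 := by rw [← Complex.exp_add, neg_add_cancel, Complex.exp_zero]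
    refine IsotopicIn.of_family
        (fun s x => (Complex.exp (-((s : ℝ) * c.arg * Complex.I)) * x.1, x.2))
      (fun s x => (Complex.exp ((s : ℝ) * c.arg * Complex.I) * x.1, x.2)) (by fun_prop)
      (fun s => by fun_prop) (fun s x => ?_) (fun s x => ?_) (fun x => by simp) ?_
    · refine Prod.ext ?_ rfl
      show Complex.exp _ * (Complex.exp _ * x.1) = x.1
      rw [← mul_assoc, ← Complex.exp_add]; simp
    · refine Prod.ext ?_ rfl
      show Complex.exp _ * (Complex.exp _ * x.1) = x.1
      rw [← mul_assoc, ← Complex.exp_add]; simp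
    · refine image_twoStrands (fun z _ => ?_) (fun z _ => ?_)
      · refine Prod.ext ?_ rfl
        show Complex.exp (-(((1 : ℝ) : ℂ) * c.arg * Complex.I)) * (√(1 - z ^ 2) * c) = √(1 - z ^ 2)
        rw [Complex.ofReal_one, one_mul, mul_left_comm, hc', mul_one]
      · refine Prod.ext ?_ rfl
        show Complex.exp (-(((1 : ℝ) : ℂ) * c.arg * Complex.I)) * -(√(1 - z ^ 2) * c) =
            -√(1 - z ^ 2)
        rw [Complex.ofReal_one, one_mul, mul_neg, mul_left_comm, hc', mul_one]
  refine step₁.trans ?_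
  let F : ℝ → ℂ × ℝ → ℂ × ℝ := fun θ x =>
    ((x.1.re : ℂ) + (x.1.im * Real.cos θ - x.2 * Real.sin θ : ℝ) * Complex.I,
      x.1.im * Real.sin θ + x.2 * Real.cos θ)
  have hF : Continuous fun q : ℝ × (ℂ × ℝ) => F q.1 q.2 := by fun_prop
  have hinv : ∀ θ x, F (-θ) (F θ x) = x := by
    intro θ x
    have := Real.sin_sq_add_cos_sq θ
    refine Prod.ext (Complex.ext ?_ ?_) ?_
    · simp [F]
    · simp only [F, Real.cos_neg, Real.sin_neg, Complex.add_im, Complex.ofReal_im, Complex.mul_im,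
        Complex.I_im, Complex.I_re, Complex.ofReal_re]
      linear_combination x.1.im * this
    · simp only [F, Real.cos_neg, Real.sin_neg, Complex.add_im, Complex.ofReal_im, Complex.mul_im,
        Complex.I_im, Complex.I_re, Complex.ofReal_re]
      linear_combination x.2 * this
  refine IsotopicIn.of_family (fun s => F (s * (Real.pi / 2))) (fun s => F (-(s * (Real.pi / 2))))
    (hF.comp (by fun_prop : Continuous fun q : unitInterval × (ℂ × ℝ) =>
      ((q.1 : ℝ) * (Real.pi / 2), q.2)))
    (fun s => hF.comp (Continuous.prodMk_right _))
    (fun s x => hinv _ _) (fun s x => ?_) (fun x => ?_) ?_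
  · have := hinv (-(s * (Real.pi / 2))) x
    rwa [neg_neg] at this
  · refine Prod.ext (Complex.ext ?_ ?_) ?_ <;> simp [F]
  · have hF1 : ∀ x, F ((1 : unitInterval) * (Real.pi / 2)) x =
      ((x.1.re : ℂ) - x.2 * Complex.I, x.1.im) := by
      intro x
      refine Prod.ext (Complex.ext ?_ ?_) ?_ <;> simp [F]
    ext ⟨w, z⟩
    simp only [mem_image, hF1]
    constructor
    · rintro ⟨⟨w', z'⟩, ⟨hz, h⟩, h'⟩
      dsimp only at hz h h'
      obtain ⟨rfl, rfl⟩ := Prod.mk.inj h'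
      have hz2 : 0 ≤ 1 - z' ^ 2 := by nlinarith [hz.1, hz.2]
      have hre : w'.re ^ 2 = 1 - z' ^ 2 ∧ w'.im = 0 := by
        rcases h with rfl | rfl <;> simp [Real.sq_sqrt hz2]
      refine ⟨?_, hre.2⟩
      rw [← sq_eq_sq₀ (norm_nonneg _) zero_le_one, ← Complex.normSq_eq_norm_sq,
          Complex.normSq_apply]
      simp
      linarith [hre.1]
    · rintro ⟨hw, hz⟩
      dsimp only at hw hz
      subst hz
      have hw2 : w.re ^ 2 + w.im ^ 2 = 1 := by
        have := Complex.normSq_eq_norm_sq w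
        rw [hw, Complex.normSq_apply] at this
        linarith
      refine ⟨((w.re : ℂ), -w.im), ⟨⟨by nlinarith, by nlinarith⟩, ?_⟩, ?_⟩
      · dsimp only
        rw [show 1 - (-w.im) ^ 2 = w.re ^ 2 by linarith, Real.sqrt_sq_eq_abs]
        rcases abs_choice w.re with h | h
        · left; rw [h]
        · right; rw [h]; simp
      · refine Prod.ext (Complex.ext ?_ ?_) ?_ <;> simp

/-- Two strands that meet exactly at the ends form an unknot: they are centred at the axis, turned
into a constant direction, and moved to the distance from the axis that belongs to a circle. -/
theorem isotopicIn_circle_of_twoStrands {p q : ℝ → ℂ} (hp : Continuous p) (hq : Continuous q)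
    (hpq : ∀ z, p z = q z ↔ z ∉ Ioo (-1 : ℝ) 1) :
    IsotopicIn (twoStrands p q) {x | ‖x.1‖ = 1 ∧ x.2 = 0} := by
  let d : ℝ → ℂ := fun z => (p z - q z) / 2
  have hd : Continuous d := by fun_prop
  have hd0 : ∀ z, d z = 0 ↔ z ∉ Ioo (-1 : ℝ) 1 := fun z => by
    simp only [d, div_eq_zero_iff, OfNat.ofNat_ne_zero, or_false, sub_eq_zero]
    exact hpq z
  have h1 : IsotopicIn (twoStrands p q) (twoStrands d (-d)) := by
    have := isotopicIn_translate (m := fun z => -((p z + q z) / 2)) (by fun_prop) (twoStrands p q)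
    rwa [image_twoStrands (p' := d) (q' := -d)] at this
    · exact fun z _ => Prod.ext (by simp only [d]; ring) rfl
    · exact fun z _ => Prod.ext (by simp only [d, Pi.neg_apply]; ring) rfl
  have hd00 : d 0 ≠ 0 := fun h => (hd0 0).1 h (by norm_num)
  have hc : ‖d 0 / ‖d 0‖‖ = 1 := by
    rw [norm_div, Complex.norm_real, norm_norm, div_self (norm_ne_zero_iff.2 hd00)]
  have hsq : ∀ z : ℝ, z ∈ Ioo (-1 : ℝ) 1 ↔ 0 < 1 - z ^ 2 := fun z => by
    rw [sub_pos, sq_lt_one_iff_abs_lt_one, abs_lt]; rfl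
  refine ((h1.trans (isotopicIn_rotate hd hd0)).trans
      (isotopicIn_radial (g := fun z => √(1 - z ^ 2))
    hd.norm (by fun_prop) (fun z hz => ⟨?_, ?_⟩) (fun z hz => ⟨?_, ?_⟩) hc)).trans
      (isotopicIn_circle hc)
  · exact norm_pos_iff.2 fun h => (hd0 z).1 h hz
  · exact Real.sqrt_pos.2 ((hsq z).1 hz)
  · exact norm_eq_zero.2 ((hd0 z).2 hz)
  · exact Real.sqrt_eq_zero_of_nonpos (not_lt.1 fun h => hz ((hsq z).2 h))

/-- The inverse of an increasing bijection of `[a, b]` onto `[-1, 1]`, extended by constants. -/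
theorem exists_continuous_inverse {h : ℝ → ℝ} (hc : Continuous h) {a b : ℝ} (hab : a < b)
    (hm : StrictMonoOn h (Icc a b)) (ha : h a = -1) (hb : h b = 1) :
    ∃ τ : ℝ → ℝ, Continuous τ ∧ (∀ z, τ z ∈ Icc a b) ∧ (∀ z ∈ Icc (-1 : ℝ) 1, h (τ z) = z) ∧
      (∀ t ∈ Icc a b, τ (h t) = t) ∧ (∀ z ≤ -1, τ z = a) ∧ (∀ z, 1 ≤ z → τ z = b) := by
  let pr : ℝ → ℝ := fun t => max a (min b t)
  have hprmem : ∀ t, pr t ∈ Icc a b := fun t => ⟨le_max_left _ _, max_le hab.le (min_le_left _ _)⟩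
  have hpr : ∀ t ∈ Icc a b, pr t = t := fun t ht => by simp [pr, ht.1, ht.2]
  have hprmono : Monotone pr := fun s t hst => max_le_max le_rfl (min_le_min le_rfl hst)
  -- extend `h` to an increasing homeomorphism of the line, with slope one outside `[a, b]`
  let g : ℝ → ℝ := fun t => h (pr t) + (t - pr t)
  have hgc : Continuous g := by fun_prop
  have hprlip : ∀ s t, s ≤ t → pr t - pr s ≤ t - s := by
    intro s t hst
    simp only [pr]
    rcases le_total b s with h1 | h1 <;> rcases le_total b t with h2 | h2 <;>
      rcases le_total a s with h3 | h3 <;> rcases le_total a t with h4 | h4 <;>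
      simp only [min_eq_left, min_eq_right, max_eq_left, max_eq_right, hab.le, *] <;> linarith
  have hgm : StrictMono g := by
    intro s t hst
    have h1 := hprlip s t hst.le
    rcases (hprmono hst.le).eq_or_lt with h2 | h2
    · simp only [g, h2]; linarith
    · have := hm (hprmem s) (hprmem t) h2
      simp only [g]; linarith
  have hgs : Function.Surjective g := by
    have hlo : ∀ t, -1 ≤ h (pr t) := fun t => by
      rw [← ha]; exact hm.monotoneOn ⟨le_rfl, hab.le⟩ (hprmem t) (hprmem t).1
    have hhi : ∀ t, h (pr t) ≤ 1 := fun t => by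
      rw [← hb]; exact hm.monotoneOn (hprmem t) ⟨hab.le, le_rfl⟩ (hprmem t).2
    refine hgc.surjective ?_ ?_
    · refine Filter.tendsto_atTop_mono (f := fun t => t + (-1 - b)) (fun t => ?_)
        (Filter.tendsto_atTop_add_const_right _ _ Filter.tendsto_id)
      simp only [g]; linarith [hlo t, (hprmem t).2]
    · refine Filter.tendsto_atBot_mono (fun t => (?_ : g t ≤ t + (1 - a)))
        (Filter.tendsto_atBot_add_const_right _ _ Filter.tendsto_id)
      simp only [g]; linarith [hhi t, (hprmem t).1]
  let e := StrictMono.orderIsoOfSurjective g hgm hgs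
  have hge : ∀ z, g (e.symm z) = z := fun z => e.apply_symm_apply z
  have heg : ∀ t, e.symm (g t) = t := fun t => e.symm_apply_apply t
  have hgab : ∀ t ∈ Icc a b, g t = h t := fun t ht => by simp [g, hpr t ht]
  have ea : e.symm (-1) = a := by rw [← ha, ← hgab a ⟨le_rfl, hab.le⟩, heg]
  have eb : e.symm 1 = b := by rw [← hb, ← hgab b ⟨hab.le, le_rfl⟩, heg]
  have hmem : ∀ z ∈ Icc (-1 : ℝ) 1, e.symm z ∈ Icc a b := fun z hz =>
    ⟨ea ▸ e.symm.monotone hz.1, eb ▸ e.symm.monotone hz.2⟩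
  refine ⟨fun z => pr (e.symm z), by have := e.symm.continuous; fun_prop, fun z => hprmem _, ?_, ?_,
      ?_, ?_⟩
  · intro z hz
    dsimp only
    rw [hpr _ (hmem z hz), ← hgab _ (hmem z hz), hge]
  · intro t ht
    dsimp only
    rw [← hgab t ht, heg, hpr t ht]
  · intro z hz
    have : e.symm z ≤ a := ea ▸ e.symm.monotone hz
    simp only [pr]
    exact max_eq_left ((min_le_right _ _).trans this)
  · intro z hz
    have : b ≤ e.symm z := eb ▸ e.symm.monotone hz
    simp only [pr, min_eq_left this]
    exact max_eq_right hab.le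

/-- A simple closed curve whose height increases strictly on one arc and decreases strictly on the
complementary arc is unknotted. -/
theorem isotopicIn_circle_of_strict {γ : ℝ → ℂ × ℝ} (hγ : Continuous γ)
    (hper : Function.Periodic γ 1)
    (hinj : ∀ s t, s < t → t < s + 1 → γ s ≠ γ t) {a b : ℝ} (hab : a < b) (hba : b < a + 1)
    (hup : StrictMonoOn (fun t => (γ t).2) (Icc a b))
    (hdown : StrictAntiOn (fun t => (γ t).2) (Icc b (a + 1))) :
    IsotopicIn (range γ) {x | ‖x.1‖ = 1 ∧ x.2 = 0} := by
  wlog hnorm : (γ a).2 = -1 ∧ (γ b).2 = 1 generalizing γ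
  · have hlt : (γ a).2 < (γ b).2 := hup ⟨le_rfl, hab.le⟩ ⟨hab.le, le_rfl⟩ hab
    set k := 2 / ((γ b).2 - (γ a).2) with hk
    have hk0 : 0 < k := div_pos two_pos (sub_pos.2 hlt)
    set l := -1 - k * (γ a).2 with hl
    have h1 := isotopicIn_vertical_affine hk0 l (range γ)
    rw [← range_comp] at h1
    refine h1.trans (this (by fun_prop) (fun t => by simp [hper t]) ?_ ?_ ?_ ⟨?_, ?_⟩)
    · intro s t hst hts h
      have h2 := congrArg Prod.fst h
      have h3 := congrArg Prod.snd h
      simp only [Function.comp, add_left_inj, mul_eq_mul_left_iff, hk0.ne', or_false] at h2 h3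
      exact hinj s t hst hts (Prod.ext h2 h3)
    · intro s hs t ht hst
      have := mul_lt_mul_of_pos_left (hup hs ht hst) hk0
      simp only [Function.comp]; linarith
    · intro s hs t ht hst
      have := mul_lt_mul_of_pos_left (hdown hs ht hst) hk0
      simp only [Function.comp]; linarith
    · simp only [Function.comp, hl]; ring
    · have : k * ((γ b).2 - (γ a).2) = 2 := div_mul_cancel₀ _ (sub_pos.2 hlt).ne'
      simp only [Function.comp, hl]; linarith
  obtain ⟨ha, hb⟩ := hnorm
  have ha1 : (γ (a + 1)).2 = -1 := by rw [hper, ha]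
  have hc2 : Continuous fun t => (γ t).2 := by fun_prop
  obtain ⟨τ, hτc, hτmem, hτ1, hτ2, hτlo, hτhi⟩ := exists_continuous_inverse hc2 hab hup ha hb
  obtain ⟨τ', hτc', hτmem', hτ1', hτ2', hτlo', hτhi'⟩ :=
      exists_continuous_inverse (h := fun t => -(γ t).2)
    (by fun_prop) hba (fun s hs t ht hst => neg_lt_neg (hdown hs ht hst)) (by simp [hb])
      (by simp [ha1])
  let p : ℝ → ℂ := fun z => (γ (τ z)).1
  let q : ℝ → ℂ := fun z => (γ (τ' (-z))).1
  have hrange : range γ = twoStrands p q := by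
    ext ⟨w, z⟩
    constructor
    · rintro ⟨t, ht⟩
      obtain ⟨t', ht', e⟩ : ∃ t' ∈ Ico a (a + 1), γ t' = γ t :=
        (hper.exists_mem_Ico one_pos t a).imp fun t' h => ⟨h.1, h.2.symm⟩
      rw [← e] at ht
      rcases le_total t' b with h | h
      · have hm : t' ∈ Icc a b := ⟨ht'.1, h⟩
        have hz : (γ t').2 = z := by rw [ht]
        refine ⟨⟨?_, ?_⟩, Or.inl ?_⟩
        · rw [← ha, ← hz]; exact hup.monotoneOn ⟨le_rfl, hab.le⟩ hm hm.1
        · rw [← hb, ← hz]; exact hup.monotoneOn hm ⟨hab.le, le_rfl⟩ hm.2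
        · have h1 := hτ2 t' hm
          dsimp only at h1 ⊢
          rw [hz] at h1
          simp only [p]; rw [h1, ht]
      · have hm : t' ∈ Icc b (a + 1) := ⟨h, ht'.2.le⟩
        have hz : (γ t').2 = z := by rw [ht]
        refine ⟨⟨?_, ?_⟩, Or.inr ?_⟩
        · rw [← ha1, ← hz]; exact hdown.antitoneOn hm ⟨hba.le, le_rfl⟩ hm.2
        · rw [← hb, ← hz]; exact hdown.antitoneOn ⟨le_rfl, hba.le⟩ hm hm.1
        · have h1 := hτ2' t' hm
          dsimp only at h1 ⊢
          rw [hz] at h1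
          simp only [q]; rw [h1, ht]
    · rintro ⟨hz, h | h⟩
      · exact ⟨τ z, Prod.ext h.symm (hτ1 z hz)⟩
      · refine ⟨τ' (-z), Prod.ext h.symm ?_⟩
        have := hτ1' (-z) ⟨by linarith [hz.2], by linarith [hz.1]⟩
        exact neg_injective this
  rw [hrange]
  refine isotopicIn_circle_of_twoStrands (by fun_prop) (by fun_prop) fun z =>
      ⟨fun h hz => ?_, fun hz => ?_⟩
  · have hzI : z ∈ Icc (-1 : ℝ) 1 := ⟨hz.1.le, hz.2.le⟩
    have h1 := hτ1 z hzI
    have h2 := hτ1' (-z) ⟨by linarith [hz.2], by linarith [hz.1]⟩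
    have hne : γ (τ z) ≠ γ (τ' (-z)) := by
      have b1 : τ z < b := lt_of_le_of_ne (hτmem z).2 fun hh => by
        rw [hh] at h1; linarith [hz.2]
      have b2 : τ' (-z) < a + 1 := lt_of_le_of_ne (hτmem' _).2 fun hh => by
        rw [hh] at h2; linarith [hz.1]
      exact hinj _ _ (b1.trans_le (hτmem' _).1) (b2.trans_le (by linarith [(hτmem z).1]))
    exact hne (Prod.ext h (by linarith))
  · rw [mem_Ioo, not_and_or, not_lt, not_lt] at hz
    rcases hz with hz | hz
    · simp only [p, q, hτlo z hz, hτhi' (-z) (by linarith), hper a]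
    · simp only [p, q, hτhi z hz, hτlo' (-z) (by linarith)]

end Strands

/-! ### Tilting the plateaus of a weakly unimodal height -/

section Plateaus

open Set

/-- The retraction of the real line onto `[0, 1]`. -/
def clamp01 (x : ℝ) : ℝ := max 0 (min 1 x)

@[fun_prop]
theorem continuous_clamp01 : Continuous clamp01 := by unfold clamp01; fun_prop

theorem monotone_clamp01 : Monotone clamp01 := fun _ _ h => max_le_max le_rfl (min_le_min le_rfl h)

theorem clamp01_mem (x : ℝ) : clamp01 x ∈ Icc (0 : ℝ) 1 :=
  ⟨le_max_left _ _, max_le zero_le_one (min_le_left _ _)⟩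

theorem clamp01_of_nonpos {x : ℝ} (h : x ≤ 0) : clamp01 x = 0 :=
    max_eq_left ((min_le_right _ _).trans h)

theorem clamp01_of_one_le {x : ℝ} (h : 1 ≤ x) : clamp01 x = 1 := by simp [clamp01, h]

theorem clamp01_of_mem {x : ℝ} (h : x ∈ Icc (0 : ℝ) 1) : clamp01 x = x := by
  simp [clamp01, h.1, h.2]

/-- A continuous monotone map of the line onto `[0, 1]` that fixes `0`, `1 / 2` and `1` and is
constant near each of these points. -/
def flatten (x : ℝ) : ℝ := (clamp01 (6 * x - 1) + clamp01 (6 * x - 4)) / 2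

@[fun_prop]
theorem continuous_flatten : Continuous flatten := by unfold flatten; fun_prop

theorem monotone_flatten : Monotone flatten := fun x y h => by
  have h1 := monotone_clamp01 (by linarith : 6 * x - 1 ≤ 6 * y - 1)
  have h2 := monotone_clamp01 (by linarith : 6 * x - 4 ≤ 6 * y - 4)
  simp only [flatten]; linarith

theorem flatten_mem (x : ℝ) : flatten x ∈ Icc (0 : ℝ) 1 := by
  have h1 := clamp01_mem (6 * x - 1)
  have h2 := clamp01_mem (6 * x - 4)
  constructor <;> simp only [flatten] <;> linarith [h1.1, h1.2, h2.1, h2.2]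

theorem flatten_eq {β x : ℝ} (hβ : β = 0 ∨ β = 1 / 2 ∨ β = 1) (h : |x - β| < 1 / 6) :
    flatten x = β := by
  rw [abs_lt] at h
  rcases hβ with rfl | rfl | rfl <;> rw [flatten]
  · rw [clamp01_of_nonpos (by linarith), clamp01_of_nonpos (by linarith)]; norm_num
  · rw [clamp01_of_one_le (by linarith), clamp01_of_nonpos (by linarith)]; norm_num
  · rw [clamp01_of_one_le (by linarith), clamp01_of_one_le (by linarith)]; norm_num

/-- A strict inequality that holds on the zeros of `F` in a compact set also holds where `|F|` is
small. -/
theorem exists_pos_forall_abs_lt {K : Set ℝ} (hK : IsCompact K) {F ψ : ℝ → ℝ} (hF : Continuous F)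
    (hψ : Continuous ψ) {c : ℝ} (h : ∀ t ∈ K, F t = 0 → ψ t < c) :
    ∃ η > 0, ∀ t ∈ K, |F t| < η → ψ t < c := by
  have hc : IsCompact (K ∩ {t | c ≤ ψ t}) := hK.inter_right (isClosed_le continuous_const hψ)
  rcases (K ∩ {t | c ≤ ψ t}).eq_empty_or_nonempty with he | hne
  · refine ⟨1, one_pos, fun t ht _ => ?_⟩
    by_contra! hct
    exact he.subset ⟨ht, hct⟩
  · obtain ⟨t₀, ht₀, hmin⟩ := hc.exists_isMinOn hne (f := fun t => |F t|) (by fun_prop)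
    refine ⟨|F t₀|, abs_pos.2 fun h0 => absurd (h t₀ ht₀.1 h0) (not_lt.2 ht₀.2), fun t ht htl => ?_⟩
    by_contra! hct
    exact absurd htl (not_lt.2 (hmin ⟨ht, hct⟩))

/-- A closed curve whose height `(γ t).2` rises weakly for `t` in `[a, b]` and falls weakly for `t`
in `[b, a + 1]`. -/
structure IsUnimodal (γ : ℝ → ℂ × ℝ) (a b : ℝ) : Prop where
  continuous : Continuous γ
  periodic : Function.Periodic γ 1
  injective : ∀ s t, s < t → t < s + 1 → γ s ≠ γ t
  lt : a < b
  lt_add_one : b < a + 1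
  monotoneOn : MonotoneOn (fun t => (γ t).2) (Icc a b)
  antitoneOn : AntitoneOn (fun t => (γ t).2) (Icc b (a + 1))

/-- A vertical displacement with values in `[0, 1]` that is nondecreasing on vertical lines and
whose values along the curve `γ` rise and fall weakly together with the height. Adding it to the
height keeps the height unimodal and makes it strictly monotone wherever the displacement is. -/
structure IsLifting (γ : ℝ → ℂ × ℝ) (a b : ℝ) (G : ℂ × ℝ → ℝ) : Prop where
  continuous : Continuous G
  mem : ∀ x, G x ∈ Icc (0 : ℝ) 1
  monotone : ∀ w, Monotone fun z => G (w, z)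
  monotoneOn : MonotoneOn (fun t => G (γ t)) (Icc a b)
  antitoneOn : AntitoneOn (fun t => G (γ t)) (Icc b (a + 1))

variable {γ : ℝ → ℂ × ℝ} {a b : ℝ}

/-- Traversing the curve backwards exchanges the ascending and the descending arc. -/
theorem IsUnimodal.reflect (h : IsUnimodal γ a b) : IsUnimodal (fun t => γ (-t)) (-(a + 1))
    (-b) where
  continuous := h.continuous.comp continuous_neg
  periodic := fun t => by
    have := h.periodic (-(t + 1))
    simpa using this.symm
  injective := fun s t hst hts => (h.injective (-t) (-s) (by linarith) (by linarith)).symm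
  lt := by linarith [h.lt_add_one]
  lt_add_one := by linarith [h.lt]
  monotoneOn := fun s hs t ht hst => h.antitoneOn ⟨by linarith [ht.2], by linarith [ht.1]⟩
    ⟨by linarith [hs.2], by linarith [hs.1]⟩ (by linarith)
  antitoneOn := fun s hs t ht hst => h.monotoneOn ⟨by linarith [ht.2], by linarith [ht.1]⟩
    ⟨by linarith [hs.2], by linarith [hs.1]⟩ (by linarith)

theorem IsLifting.of_reflect {G : ℂ × ℝ → ℝ} (h : IsLifting (fun t => γ (-t)) (-(a + 1)) (-b) G) :
    IsLifting γ a b G where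
  continuous := h.continuous
  mem := h.mem
  monotone := h.monotone
  monotoneOn := fun s hs t ht hst => by
    have := h.antitoneOn (show -t ∈ Icc (-b) (-(a + 1) + 1) from
      ⟨by linarith [ht.2], by linarith [ht.1]⟩) (show -s ∈ Icc (-b) (-(a + 1) + 1) from
      ⟨by linarith [hs.2], by linarith [hs.1]⟩) (by linarith)
    simpa using this
  antitoneOn := fun s hs t ht hst => by
    have := h.monotoneOn (show -t ∈ Icc (-(a + 1)) (-b) from
      ⟨by linarith [ht.2], by linarith [ht.1]⟩) (show -s ∈ Icc (-(a + 1)) (-b) from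
      ⟨by linarith [hs.2], by linarith [hs.1]⟩) (by linarith)
    simpa using this

/-- For the level `z₀` there is a function `r` of the horizontal position that ramps up from `0` to
`1` over the parameters `[s, t]` on the ascending arc and is a constant `β` on the descending arc.
The two arcs meet the level in disjoint sets unless it is the top or the bottom level; there it is
assumed that they have only the end of the arc in common, and `β` is the value of the ramp at that
end. -/
theorem IsUnimodal.exists_planar_function (h : IsUnimodal γ a b) {s t z₀ β : ℝ} (hst : s < t)
    (has : a ≤ s) (htb : t ≤ b)
    (hβ : (β = 1 / 2 ∧ (γ a).2 ≠ z₀ ∧ (γ b).2 ≠ z₀) ∨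
      (β = 1 ∧ ∀ τ ∈ Icc b (a + 1), (γ τ).2 = z₀ → τ = b) ∨
      (β = 0 ∧ ∀ τ ∈ Icc b (a + 1), (γ τ).2 = z₀ → τ = a + 1)) :
    ∃ r : ℂ → ℝ, Continuous r ∧
      (∀ τ ∈ Icc a b, (γ τ).2 = z₀ → r (γ τ).1 = clamp01 ((τ - s) / (t - s))) ∧
      ∀ τ ∈ Icc b (a + 1), (γ τ).2 = z₀ → r (γ τ).1 = β := by
  have hγ := h.continuous
  have hst' : 0 < t - s := sub_pos.2 hst
  have hC : ∀ x y, IsCompact (Icc x y ∩ {τ | (γ τ).2 = z₀}) := fun x y =>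
    isCompact_Icc.inter_right (isClosed_eq (by fun_prop) continuous_const)
  let C := Icc a b ∩ {τ | (γ τ).2 = z₀}
  have : CompactSpace C := isCompact_iff_compactSpace.1 (hC a b)
  have hinj : Function.Injective fun τ : C => (γ τ).1 := by
    rintro ⟨x, hx⟩ ⟨y, hy⟩ hxy
    have e : γ x = γ y := Prod.ext hxy (hx.2.trans hy.2.symm)
    rcases lt_trichotomy x y with hl | hl | hl
    · exact absurd e (h.injective x y hl (by linarith [hy.1.2, hx.1.1, h.lt_add_one]))
    · exact Subtype.ext hl
    · exact absurd e.symm (h.injective y x hl (by linarith [hx.1.2, hy.1.1, h.lt_add_one]))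
  have hemb : Topology.IsClosedEmbedding fun τ : C => (γ τ).1 :=
    Continuous.isClosedEmbedding (by fun_prop) hinj
  obtain ⟨g, hg⟩ := ContinuousMap.exists_extension hemb
    (⟨fun τ : C => clamp01 ((τ - s) / (t - s)), by fun_prop⟩ : C(C, ℝ))
  have hg' : ∀ τ ∈ Icc a b, (γ τ).2 = z₀ → g (γ τ).1 = clamp01 ((τ - s) / (t - s)) :=
    fun τ hτ hz => DFunLike.congr_fun hg ⟨τ, hτ, hz⟩
  rcases hβ with ⟨rfl, hza, hzb⟩ | ⟨rfl, hb⟩ | ⟨rfl, ha⟩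
  · obtain ⟨u, hu0, hu1, -⟩ := exists_continuous_zero_one_of_isClosed
      ((hC b (a + 1)).image_of_continuousOn (f := fun τ => (γ τ).1) (by fun_prop)).isClosed
      ((hC a b).image_of_continuousOn (f := fun τ => (γ τ).1) (by fun_prop)).isClosed (by
        rw [Set.disjoint_left]
        rintro _ ⟨x, hx, rfl⟩ ⟨y, hy, hxy⟩
        have e : γ y = γ x := Prod.ext hxy (hy.2.trans hx.2.symm)
        have hx1 : x ≠ b := fun hh => hzb (hh ▸ hx.2)
        have hy1 : y ≠ a := fun hh => hza (hh ▸ hy.2)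
        have hx2 : b < x := lt_of_le_of_ne hx.1.1 hx1.symm
        have hy2 : a < y := lt_of_le_of_ne hy.1.1 hy1.symm
        exact h.injective y x (hy.1.2.trans_lt hx2) (by linarith [hx.1.2]) e)
    refine ⟨fun w => u w * g w + (1 - u w) * (1 / 2), by fun_prop, fun τ hτ hz => ?_,
        fun τ hτ hz => ?_⟩
    · have : u (γ τ).1 = 1 := hu1 ⟨τ, ⟨hτ, hz⟩, rfl⟩
      simp only [this, hg' τ hτ hz]; ring
    · have : u (γ τ).1 = 0 := hu0 ⟨τ, ⟨hτ, hz⟩, rfl⟩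
      simp only [this]; ring
  · refine ⟨g, g.continuous, hg', fun τ hτ hz => ?_⟩
    obtain rfl := hb τ hτ hz
    rw [hg' _ ⟨h.lt.le, le_rfl⟩ hz, clamp01_of_one_le]
    rw [one_le_div hst']; linarith
  · refine ⟨g, g.continuous, hg', fun τ hτ hz => ?_⟩
    obtain rfl := ha τ hτ hz
    rw [h.periodic] at hz ⊢
    rw [hg' _ ⟨le_rfl, h.lt.le⟩ hz, clamp01_of_nonpos]
    exact div_nonpos_of_nonpos_of_nonneg (by linarith) hst'.le

/-- A displacement that separates the ends of a plateau `[s, t]` of the ascending arc. It is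
`flatten (r w) + (z - z₀) / η`, cut off to `[0, 1]`, with `r` the ramp at the level `z₀` of the
plateau. For small `η` the cut-off makes it constant on the ascending arc outside the plateau. On
the descending arc `flatten (r w)` equals `β` near the level `z₀`, so that the displacement is a
function of the height there. -/
theorem IsUnimodal.exists_isLifting (h : IsUnimodal γ a b) {s t z₀ β : ℝ} (hst : s < t)
    (has : a ≤ s) (htb : t ≤ b) (hs : (γ s).2 = z₀) (ht : (γ t).2 = z₀)
    (hβ : (β = 1 / 2 ∧ (γ a).2 ≠ z₀ ∧ (γ b).2 ≠ z₀) ∨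
      (β = 1 ∧ ∀ τ ∈ Icc b (a + 1), (γ τ).2 = z₀ → τ = b) ∨
      (β = 0 ∧ ∀ τ ∈ Icc b (a + 1), (γ τ).2 = z₀ → τ = a + 1)) :
    ∃ G, IsLifting γ a b G ∧ G (γ s) < G (γ t) := by
  obtain ⟨r, hr, hr1, hr2⟩ := h.exists_planar_function hst has htb hβ
  have hβ' : β = 0 ∨ β = 1 / 2 ∨ β = 1 := by
    rcases hβ with hh | hh | hh <;> simp [hh.1]
  have hst' : 0 < t - s := sub_pos.2 hst
  have hγ := h.continuous
  have hsm : s ∈ Icc a b := ⟨has, by linarith⟩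
  have htm : t ∈ Icc a b := ⟨by linarith, htb⟩
  obtain ⟨η₁, hη₁, h1⟩ := exists_pos_forall_abs_lt (K := Icc a s) isCompact_Icc
    (F := fun τ => (γ τ).2 - z₀) (ψ := fun τ => |r (γ τ).1 - 0|) (c := 1 / 6) (by fun_prop)
      (by fun_prop)
    (fun τ hτ hz => by
      rw [hr1 τ ⟨hτ.1, by linarith [hτ.2]⟩ (sub_eq_zero.1 hz), clamp01_of_nonpos]
      · norm_num
      · exact div_nonpos_of_nonpos_of_nonneg (by linarith [hτ.2]) hst'.le)
  obtain ⟨η₂, hη₂, h2⟩ := exists_pos_forall_abs_lt (K := Icc t b) isCompact_Icc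
    (F := fun τ => (γ τ).2 - z₀) (ψ := fun τ => |r (γ τ).1 - 1|) (c := 1 / 6) (by fun_prop)
      (by fun_prop)
    (fun τ hτ hz => by
      rw [hr1 τ ⟨by linarith [hτ.1], hτ.2⟩ (sub_eq_zero.1 hz), clamp01_of_one_le]
      · norm_num
      · rw [one_le_div hst']; linarith [hτ.1])
  obtain ⟨η₃, hη₃, h3⟩ := exists_pos_forall_abs_lt (K := Icc b (a + 1)) isCompact_Icc
    (F := fun τ => (γ τ).2 - z₀) (ψ := fun τ => |r (γ τ).1 - β|) (c := 1 / 6) (by fun_prop)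
      (by fun_prop)
    (fun τ hτ hz => by
      rw [hr2 τ hτ (sub_eq_zero.1 hz)]; norm_num)
  set η := min η₁ (min η₂ η₃) with hη
  have hη0 : 0 < η := lt_min hη₁ (lt_min hη₂ hη₃)
  have e1 : η ≤ η₁ := min_le_left _ _
  have e2 : η ≤ η₂ := (min_le_right _ _).trans (min_le_left _ _)
  have e3 : η ≤ η₃ := (min_le_right _ _).trans (min_le_right _ _)
  let G : ℂ × ℝ → ℝ := fun x => clamp01 (flatten (r x.1) + (x.2 - z₀) / η)
  have hG1 : ∀ τ ∈ Icc a s, G (γ τ) = 0 := by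
    intro τ hτ
    have hle : (γ τ).2 ≤ z₀ := hs ▸ h.monotoneOn ⟨hτ.1, by linarith [hτ.2]⟩ hsm hτ.2
    refine clamp01_of_nonpos ?_
    rcases lt_or_ge |(γ τ).2 - z₀| η with hlt | hge
    · rw [flatten_eq (Or.inl rfl) (h1 τ hτ (hlt.trans_le e1)), zero_add]
      exact div_nonpos_of_nonpos_of_nonneg (by linarith) hη0.le
    · rw [abs_of_nonpos (by linarith)] at hge
      have : ((γ τ).2 - z₀) / η ≤ -1 := by rw [div_le_iff₀ hη0]; linarith
      linarith [(flatten_mem (r (γ τ).1)).2]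
  have hG2 : ∀ τ ∈ Icc t b, G (γ τ) = 1 := by
    intro τ hτ
    have hle : z₀ ≤ (γ τ).2 := ht ▸ h.monotoneOn htm ⟨by linarith [hτ.1], hτ.2⟩ hτ.1
    refine clamp01_of_one_le ?_
    rcases lt_or_ge |(γ τ).2 - z₀| η with hlt | hge
    · rw [flatten_eq (Or.inr (Or.inr rfl)) (h2 τ hτ (hlt.trans_le e2))]
      have : 0 ≤ ((γ τ).2 - z₀) / η := div_nonneg (by linarith) hη0.le
      linarith
    · rw [abs_of_nonneg (by linarith)] at hge
      have : 1 ≤ ((γ τ).2 - z₀) / η := (one_le_div hη0).2 hge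
      linarith [(flatten_mem (r (γ τ).1)).1]
  have hG3 : ∀ τ ∈ Icc s t, G (γ τ) = flatten (clamp01 ((τ - s) / (t - s))) := by
    intro τ hτ
    have hm : τ ∈ Icc a b := ⟨by linarith [hτ.1], by linarith [hτ.2]⟩
    have hz : (γ τ).2 = z₀ :=
      le_antisymm (ht ▸ h.monotoneOn hm htm hτ.2) (hs ▸ h.monotoneOn hsm hm hτ.1)
    simp only [G]
    rw [hr1 τ hm hz, hz, sub_self, zero_div, add_zero, clamp01_of_mem (flatten_mem _)]
  have hG4 : ∀ τ ∈ Icc b (a + 1), G (γ τ) = clamp01 (β + ((γ τ).2 - z₀) / η) := by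
    intro τ hτ
    rcases lt_or_ge |(γ τ).2 - z₀| η with hlt | hge
    · simp only [G]
      rw [flatten_eq hβ' (h3 τ hτ (hlt.trans_le e3))]
    · have hβm : β ∈ Icc (0 : ℝ) 1 := by rcases hβ' with rfl | rfl | rfl <;> norm_num
      have hfm := flatten_mem (r (γ τ).1)
      rcases le_abs.1 hge with hge | hge
      · have : 1 ≤ ((γ τ).2 - z₀) / η := (one_le_div hη0).2 hge
        simp only [G]
        rw [clamp01_of_one_le (by linarith [hfm.1]), clamp01_of_one_le (by linarith [hβm.1])]
      · have : ((γ τ).2 - z₀) / η ≤ -1 := by rw [div_le_iff₀ hη0]; linarith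
        simp only [G]
        rw [clamp01_of_nonpos (by linarith [hfm.2]), clamp01_of_nonpos (by linarith [hβm.2])]
  have hGmem : ∀ x, G x ∈ Icc (0 : ℝ) 1 := fun x => clamp01_mem _
  refine ⟨G, ⟨by fun_prop, hGmem, fun w z z' hz => monotone_clamp01 ?_, ?_, ?_⟩, ?_⟩
  · gcongr
  · intro x hx y hy hxy
    dsimp only
    rcases le_total x s with hxs | hxs
    · rw [hG1 x ⟨hx.1, hxs⟩]; exact (hGmem _).1
    rcases le_total t y with hyt | hyt
    · rw [hG2 y ⟨hyt, hy.2⟩]; exact (hGmem _).2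
    rw [hG3 x ⟨hxs, hxy.trans hyt⟩, hG3 y ⟨hxs.trans hxy, hyt⟩]
    exact monotone_flatten (monotone_clamp01 (by gcongr))
  · intro x hx y hy hxy
    dsimp only
    rw [hG4 x hx, hG4 y hy]
    have := h.antitoneOn hx hy hxy
    dsimp only at this
    exact monotone_clamp01 (by gcongr)
  · rw [hG1 s ⟨has, le_rfl⟩, hG2 t ⟨le_rfl, htb⟩]; norm_num

/-- A simple closed curve with weakly unimodal height is unknotted if its height on the open
descending arc lies strictly between the extreme values. A weighted sum of displacements, one for
each pair of rational parameters that bound a plateau, makes the height strictly monotone on both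
arcs. -/
theorem IsUnimodal.isotopicIn_circle (h : IsUnimodal γ a b)
    (hint : ∀ τ ∈ Ioo b (a + 1), (γ a).2 < (γ τ).2 ∧ (γ τ).2 < (γ b).2) :
    IsotopicIn (range γ) {x | ‖x.1‖ = 1 ∧ x.2 = 0} := by
  have hab : (γ a).2 < (γ b).2 := by
    obtain ⟨τ, hτ⟩ := exists_between h.lt_add_one
    exact (hint τ hτ).1.trans (hint τ hτ).2
  have ha1 : γ (a + 1) = γ a := h.periodic a
  have hup : ∀ s t, s < t → a ≤ s → t ≤ b → (γ s).2 = (γ t).2 →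
      ∃ G, IsLifting γ a b G ∧ G (γ s) < G (γ t) := by
    intro s t hst has htb hz
    have hends : ∀ τ ∈ Icc b (a + 1), (γ τ).2 = (γ b).2 → τ = b := by
      intro τ hτ hh
      by_contra hne
      rcases hτ.2.eq_or_lt with hl | hl
      · rw [hl, ha1] at hh; exact hab.ne hh
      · exact (hint τ ⟨lt_of_le_of_ne hτ.1 (Ne.symm hne), hl⟩).2.ne hh
    have hends' : ∀ τ ∈ Icc b (a + 1), (γ τ).2 = (γ a).2 → τ = a + 1 := by
      intro τ hτ hh
      by_contra hne
      rcases hτ.1.eq_or_lt with hl | hl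
      · rw [← hl] at hh; exact hab.ne' hh
      · exact (hint τ ⟨hl, lt_of_le_of_ne hτ.2 hne⟩).1.ne' hh
    by_cases hzb : (γ b).2 = (γ t).2
    · exact h.exists_isLifting (β := 1) hst has htb hz rfl (Or.inr (Or.inl ⟨rfl, hzb ▸ hends⟩))
    by_cases hza : (γ a).2 = (γ t).2
    · exact h.exists_isLifting (β := 0) hst has htb hz rfl (Or.inr (Or.inr ⟨rfl, hza ▸ hends'⟩))
    exact h.exists_isLifting (β := 1 / 2) hst has htb hz rfl (Or.inl ⟨rfl, hza, hzb⟩)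
  have hdown : ∀ s t, s < t → b ≤ s → t ≤ a + 1 → (γ s).2 = (γ t).2 →
      ∃ G, IsLifting γ a b G ∧ G (γ t) < G (γ s) := by
    intro s t hst hbs hta hz
    have hs : (γ s).2 < (γ b).2 := by
      rcases hbs.eq_or_lt with hl | hl
      · exfalso
        rcases hta.eq_or_lt with hl' | hl'
        · rw [hl', ha1, ← hl] at hz; exact hab.ne' hz
        · rw [← hl] at hz
          exact (hint t ⟨by linarith, hl'⟩).2.ne' hz
      · exact (hint s ⟨hl, by linarith⟩).2
    have ht : (γ a).2 < (γ s).2 := by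
      rcases hta.eq_or_lt with hl | hl
      · exfalso
        rw [hl, ha1] at hz
        rcases hbs.eq_or_lt with hl' | hl'
        · rw [← hl'] at hz; exact hab.ne' hz
        · exact (hint s ⟨hl', by linarith⟩).1.ne' hz
      · rw [hz]; exact (hint t ⟨by linarith, hl⟩).1
    obtain ⟨G, hG, hlt⟩ := h.reflect.exists_isLifting (s := -t) (t := -s) (z₀ := (γ s).2)
        (β := 1 / 2)
      (by linarith) (by linarith) (by linarith) (by simp [hz]) (by simp)
      (Or.inl ⟨rfl, by simpa [← neg_add', ha1] using ht.ne, by simpa using hs.ne'⟩)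
    exact ⟨G, hG.of_reflect, by simpa using hlt⟩
  -- for pairs that bound no plateau the zero displacement serves
  have hall : ∀ i : ℚ × ℚ, ∃ G, IsLifting γ a b G ∧
      ((i.1 : ℝ) < i.2 → a ≤ i.1 → (i.2 : ℝ) ≤ b → (γ i.1).2 = (γ i.2).2 → G (γ i.1) < G (γ i.2)) ∧
      ((i.1 : ℝ) < i.2 → b ≤ i.1 → (i.2 : ℝ) ≤ a + 1 → (γ i.1).2 = (γ i.2).2 → G (γ i.2) <
        G (γ i.1)) := by
    rintro ⟨s, t⟩
    dsimp only
    by_cases h1 : (s : ℝ) < t ∧ a ≤ s ∧ (t : ℝ) ≤ b ∧ (γ s).2 = (γ t).2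
    · obtain ⟨G, hG, hlt⟩ := hup s t h1.1 h1.2.1 h1.2.2.1 h1.2.2.2
      exact ⟨G, hG, fun _ _ _ _ => hlt, fun _ _ _ _ => by linarith [h1.1, h1.2.2.1]⟩
    by_cases h2 : (s : ℝ) < t ∧ b ≤ s ∧ (t : ℝ) ≤ a + 1 ∧ (γ s).2 = (γ t).2
    · obtain ⟨G, hG, hlt⟩ := hdown s t h2.1 h2.2.1 h2.2.2.1 h2.2.2.2
      exact ⟨G, hG, fun _ _ _ _ => by linarith [h2.1, h2.2.1], fun _ _ _ _ => hlt⟩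
    · exact ⟨fun _ => 0, ⟨by fun_prop, fun _ => by norm_num, fun _ => monotone_const,
        monotoneOn_const,
        antitoneOn_const⟩, fun a1 a2 a3 a4 => absurd ⟨a1, a2, a3, a4⟩ h1,
        fun a1 a2 a3 a4 => absurd ⟨a1, a2, a3, a4⟩ h2⟩
  choose G hG hG1 hG2 using hall
  let ε : ℚ × ℚ → ℝ := fun i => (1 / 2) ^ Encodable.encode i
  have hε : Summable ε := summable_geometric_two_encode
  have hε0 : ∀ i, 0 < ε i := fun i => by positivity
  have hle : ∀ i x, ‖ε i * G i x‖ ≤ ε i := fun i x => by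
    rw [Real.norm_of_nonneg (mul_nonneg (hε0 i).le ((hG i).mem x).1)]
    exact mul_le_of_le_one_right (hε0 i).le ((hG i).mem x).2
  have hsum : ∀ x, Summable fun i => ε i * G i x := fun x => Summable.of_norm_bounded hε fun i =>
      hle i x
  let S : ℂ × ℝ → ℝ := fun x => ∑' i, ε i * G i x
  have hS : Continuous S :=
    continuous_tsum (fun i => continuous_const.mul (hG i).continuous) hε hle
  have hSle : ∀ {x y}, (∀ i, G i x ≤ G i y) → S x ≤ S y := fun hxy =>
    (hsum _).tsum_le_tsum (fun i => mul_le_mul_of_nonneg_left (hxy i) (hε0 i).le) (hsum _)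
  have hSlt : ∀ {x y}, (∀ i, G i x ≤ G i y) → ∀ i, G i x < G i y → S x < S y := fun hxy i hi =>
    Summable.tsum_lt_tsum (fun i => mul_le_mul_of_nonneg_left (hxy i) (hε0 i).le)
      (mul_lt_mul_of_pos_left hi (hε0 i)) (hsum _) (hsum _)
  have hiso := isotopicIn_vertical hS (fun w z z' hz => hSle fun i => (hG i).monotone w hz)
      (range γ)
  rw [← range_comp] at hiso
  have hrat : ∀ s t : ℝ, s < t → ∃ i : ℚ × ℚ, s < i.1 ∧ (i.1 : ℝ) < i.2 ∧ (i.2 : ℝ) < t := by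
    intro s t hst
    obtain ⟨p, hp1, hp2⟩ := exists_rat_btwn hst
    obtain ⟨q, hq1, hq2⟩ := exists_rat_btwn hp2
    exact ⟨(p, q), hp1, hq1, hq2⟩
  have hγ := h.continuous
  refine hiso.trans (isotopicIn_circle_of_strict (a := a) (b := b) (by fun_prop)
    (fun t => by simp [h.periodic t]) ?_ h.lt h.lt_add_one ?_ ?_)
  · intro s t hst hts he
    have h1 := congrArg Prod.fst he
    have h2 := congrArg Prod.snd he
    simp only [Function.comp] at h1 h2
    have hzeq : (γ s).2 = (γ t).2 := by
      -- the vertical displacement is monotone on each vertical line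
      have hm : ∀ x y : ℂ × ℝ, x.1 = y.1 → x.2 < y.2 → S x ≤ S y := fun x y hxy hl =>
          hSle fun i => by
        have e : (x.1, y.2) = y := Prod.ext hxy rfl
        simpa only [e] using (hG i).monotone x.1 hl.le
      rcases lt_trichotomy (γ s).2 (γ t).2 with hl | hl | hl
      · linarith [hm _ _ h1 hl]
      · exact hl
      · linarith [hm _ _ h1.symm hl]
    exact h.injective s t hst hts (Prod.ext h1 hzeq)
  · intro s hs t ht hst
    simp only [Function.comp]
    have hm := h.monotoneOn hs ht hst.le
    dsimp only at hm
    have hGm : ∀ i, G i (γ s) ≤ G i (γ t) := fun i => (hG i).monotoneOn hs ht hst.le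
    rcases hm.eq_or_lt with he | hl
    · obtain ⟨i, i1, i2, i3⟩ := hrat s t hst
      have m1 : (i.1 : ℝ) ∈ Icc a b := ⟨by linarith [hs.1], by linarith [ht.2]⟩
      have m2 : (i.2 : ℝ) ∈ Icc a b := ⟨by linarith [hs.1], by linarith [ht.2]⟩
      have z1 := h.monotoneOn hs m1 i1.le
      have z2 := h.monotoneOn m1 m2 i2.le
      have z3 := h.monotoneOn m2 ht i3.le
      dsimp only at z1 z2 z3
      have := hSlt hGm i (((hG i).monotoneOn hs m1 i1.le).trans_lt
        ((hG1 i i2 m1.1 m2.2 (by linarith)).trans_le ((hG i).monotoneOn m2 ht i3.le)))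
      linarith
    · linarith [hSle hGm]
  · intro s hs t ht hst
    simp only [Function.comp]
    have hm := h.antitoneOn hs ht hst.le
    dsimp only at hm
    have hGm : ∀ i, G i (γ t) ≤ G i (γ s) := fun i => (hG i).antitoneOn hs ht hst.le
    rcases hm.eq_or_lt with he | hl
    · obtain ⟨i, i1, i2, i3⟩ := hrat s t hst
      have m1 : (i.1 : ℝ) ∈ Icc b (a + 1) := ⟨by linarith [hs.1], by linarith [ht.2]⟩
      have m2 : (i.2 : ℝ) ∈ Icc b (a + 1) := ⟨by linarith [hs.1], by linarith [ht.2]⟩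
      have z1 := h.antitoneOn hs m1 i1.le
      have z2 := h.antitoneOn m1 m2 i2.le
      have z3 := h.antitoneOn m2 ht i3.le
      dsimp only at z1 z2 z3
      have := hSlt hGm i (((hG i).antitoneOn m2 ht i3.le).trans_lt
        ((hG2 i i2 m1.1 m2.2 (by linarith)).trans_le ((hG i).antitoneOn hs m1 i1.le)))
      linarith
    · linarith [hSle hGm]

end Plateaus

/-! ### Height functions with a single peak -/

section Reduction

open Set

/-- A height function that is neither constant nor has a zigzag with two peaks is unimodal: its
parameter circle splits into an arc of weak ascent and an arc of weak descent. The arc of descent is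
chosen so short that it attains the extreme values at its ends only. -/
theorem exists_isUnimodal {γ : ℝ → ℂ × ℝ} (hγ : Continuous γ) (hper : Function.Periodic γ 1)
    (hinj : ∀ s t, s < t → t < s + 1 → γ s ≠ γ t) (h2 : ¬ HasZigzag 2 fun t => (γ t).2)
    (hne : ∃ s t, (γ s).2 ≠ (γ t).2) :
    ∃ a b, IsUnimodal γ a b ∧
      ∀ τ ∈ Ioo b (a + 1), (γ a).2 < (γ τ).2 ∧ (γ τ).2 < (γ b).2 := by
  set h : ℝ → ℝ := fun t => (γ t).2 with hh
  have hc : Continuous h := by fun_prop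
  have hp : Function.Periodic h 1 := fun t => by simp only [hh, hper t]
  have hmem : ∀ a t : ℝ, ∃ s ∈ Icc a (a + 1), h t = h s := fun a t => by
    obtain ⟨s, hs, e⟩ := hp.exists_mem_Ico one_pos t a
    exact ⟨s, Ico_subset_Icc_self hs, e⟩
  obtain ⟨a₀, -, ha₀⟩ := (isCompact_Icc (a := (0 : ℝ)) (b := 0 + 1)).exists_isMinOn
    (nonempty_Icc.2 (by norm_num)) hc.continuousOn
  have hmin : ∀ t, h a₀ ≤ h t := fun t => by
    obtain ⟨s, hs, e⟩ := hmem 0 t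
    exact e ▸ ha₀ hs
  obtain ⟨b₀, hb₀m, hb₀⟩ := (isCompact_Icc (a := a₀) (b := a₀ + 1)).exists_isMaxOn
    (nonempty_Icc.2 (by norm_num)) hc.continuousOn
  have hmax : ∀ t, h t ≤ h b₀ := fun t => by
    obtain ⟨s, hs, e⟩ := hmem a₀ t
    exact e ▸ hb₀ hs
  have hlt : h a₀ < h b₀ := by
    obtain ⟨s, t, hst⟩ := hne
    refine lt_of_le_of_ne (hmax a₀) fun e => hst ?_
    exact (le_antisymm (e ▸ hmax s) (hmin s)).trans (le_antisymm (e ▸ hmax t) (hmin t)).symm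
  obtain ⟨b, ⟨hbm, hb : h b = h b₀⟩, hbg⟩ := (isCompact_Icc.inter_right
    (isClosed_eq hc continuous_const) :
      IsCompact (Icc a₀ (a₀ + 1) ∩ {t | h t = h b₀})).exists_isGreatest
    ⟨b₀, hb₀m, rfl⟩
  obtain ⟨c, ⟨hcm, hcz : h c = h a₀⟩, hcl⟩ := (isCompact_Icc.inter_right
    (isClosed_eq hc continuous_const) :
      IsCompact (Icc b (a₀ + 1) ∩ {t | h t = h a₀})).exists_isLeast
    ⟨a₀ + 1, ⟨hbm.2, le_rfl⟩, hp a₀⟩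
  obtain ⟨a, rfl⟩ : ∃ a, c = a + 1 := ⟨c - 1, by ring⟩
  have ha : h a = h a₀ := (hp a).symm.trans hcz
  have hab : a < b := lt_of_le_of_ne (by linarith [hcm.2, hbm.1]) fun e => by
    rw [← e, ha] at hb; exact hlt.ne hb
  have hba : b < a + 1 := lt_of_le_of_ne hcm.1 fun e => by
    rw [← e, hb] at hcz; exact hlt.ne' hcz
  refine ⟨a, b, ⟨hγ, hper, hinj, hab, hba, ?_, ?_⟩, fun τ hτ => ⟨?_, ?_⟩⟩
  · intro x hx y hy hxy
    by_contra! hlt'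
    change h y < h x at hlt'
    have h1 : x < y := lt_of_le_of_ne hxy fun e => by rw [e] at hlt'; exact lt_irrefl _ hlt'
    have h3 : y < b := lt_of_le_of_ne hy.2 fun e => by
      rw [e, hb] at hlt'; exact absurd (hmax x) (not_le.2 hlt')
    have h4 : a < x := lt_of_le_of_ne hx.1 fun e => by
      rw [← e, ha] at hlt'; exact absurd (hmin y) (not_le.2 hlt')
    exact h2 (HasZigzag.two_of_lt hp h1 h3 hba (by linarith) hlt' (by linarith [hmax x])
      (by linarith) (by linarith [hmin y]))
  · intro x hx y hy hxy
    by_contra! hlt'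
    change h x < h y at hlt'
    have h1 : x < y := lt_of_le_of_ne hxy fun e => by rw [e] at hlt'; exact lt_irrefl _ hlt'
    have h3 : b < x := lt_of_le_of_ne hx.1 fun e => by
      rw [← e, hb] at hlt'; exact absurd (hmax y) (not_le.2 hlt')
    have h4 : y < a + 1 := lt_of_le_of_ne hy.2 fun e => by
      rw [e, hcz] at hlt'; exact absurd (hmin x) (not_le.2 hlt')
    exact h2 (HasZigzag.two_of_lt hp h3 h1 h4 (by linarith) (by linarith [hmax y]) hlt'
      (by linarith [hmin x]) (by linarith))
  · change h a < h τ
    rw [ha]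
    refine lt_of_le_of_ne (hmin τ) fun e => ?_
    exact absurd (hcl ⟨⟨hτ.1.le, by linarith [hτ.2, hcm.2]⟩, e.symm⟩) (not_le.2 hτ.2)
  · change h τ < h b
    rw [hb]
    refine lt_of_le_of_ne (hmax τ) fun e => ?_
    exact absurd (hbg ⟨⟨by linarith [hτ.1, hbm.1], by linarith [hτ.2, hcm.2]⟩, e⟩) (not_le.2 hτ.1)

/-- A simple closed curve in a horizontal plane is unknotted. The distance to `0` in the parameter
circle, carried over to the curve and extended to the plane by Tietze's theorem, tells how far to
lift each vertical line in order to make the height strictly unimodal. -/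
theorem isotopicIn_circle_of_const {κ : UnitAddCircle → ℂ × ℝ} (hκ : Continuous κ)
    (hinj : Function.Injective κ) {z₀ : ℝ} (hz : ∀ θ, (κ θ).2 = z₀) :
    IsotopicIn (range κ) {x | ‖x.1‖ = 1 ∧ x.2 = 0} := by
  have hemb : Topology.IsClosedEmbedding fun θ => (κ θ).1 :=
    Continuous.isClosedEmbedding (by fun_prop) fun θ θ' e =>
      hinj (Prod.ext e ((hz θ).trans (hz θ').symm))
  obtain ⟨r, hr⟩ := ContinuousMap.exists_extension hemb
    (⟨fun θ => ‖θ‖, continuous_norm⟩ : C(UnitAddCircle, ℝ))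
  have hr' : ∀ θ, r (κ θ).1 = ‖θ‖ := fun θ => DFunLike.congr_fun hr θ
  have hiso := isotopicIn_vertical (G := fun x => r x.1) (by fun_prop) (fun _ _ _ _ => le_rfl)
      (range κ)
  have hnorm : ∀ t ∈ Icc (0 : ℝ) (1 / 2), ‖(t : UnitAddCircle)‖ = t := fun t ht => by
    rw [(AddCircle.norm_coe_eq_abs_iff (1 : ℝ) one_ne_zero).2
        (by rw [abs_of_nonneg ht.1]; simpa using ht.2),
      abs_of_nonneg ht.1]
  have hnorm' : ∀ t ∈ Icc (1 / 2 : ℝ) 1, ‖(t : UnitAddCircle)‖ = 1 - t := fun t ht => by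
    have e : ((1 - t : ℝ) : UnitAddCircle) = -(t : UnitAddCircle) := by
      rw [AddCircle.coe_sub, AddCircle.coe_period, zero_sub]
    rw [← norm_neg, ← e, hnorm _ ⟨by linarith [ht.2], by linarith [ht.1]⟩]
  have hrange : (fun x : ℂ × ℝ => (x.1, x.2 + r x.1)) '' range κ =
      range fun t : ℝ => ((κ t).1, z₀ + ‖(t : UnitAddCircle)‖) := by
    rw [← range_comp, ← (QuotientAddGroup.mk_surjective
        (s := AddSubgroup.zmultiples (1 : ℝ))).range_comp]
    congr 1
    funext t
    simp only [Function.comp, hz, hr']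
  rw [hrange] at hiso
  have hcoe : Continuous fun t : ℝ => (t : UnitAddCircle) := AddCircle.continuous_mk' 1
  refine hiso.trans (isotopicIn_circle_of_strict (a := 0) (b := 1 / 2) (by fun_prop)
    (fun t => by rw [AddCircle.coe_add_period]) ?_ (by norm_num) (by norm_num) ?_ ?_)
  · intro s t hst hts e
    have h1 : κ s = κ t := Prod.ext (Prod.mk.inj e).1 ((hz _).trans (hz _).symm)
    have : Fact ((0 : ℝ) < 1) := ⟨one_pos⟩
    exact hst.ne ((AddCircle.coe_eq_coe_iff_of_mem_Ico (p := (1 : ℝ)) (a := s) ⟨le_rfl, by linarith⟩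
      ⟨hst.le, hts⟩).1 (hinj h1))
  · intro s hs t ht hst
    simp only [hnorm s hs, hnorm t ht]
    linarith
  · rw [zero_add]
    intro s hs t ht hst
    simp only [hnorm' s hs, hnorm' t ht]
    linarith

/-- A simple closed curve whose height does not have two peaks is unknotted. -/
theorem isotopicIn_circle_of_not_hasZigzag {κ : UnitAddCircle → ℂ × ℝ} (hκ : Continuous κ)
    (hinj : Function.Injective κ) (h2 : ¬ HasZigzag 2 fun t : ℝ => (κ t).2) :
    IsotopicIn (range κ) {x | ‖x.1‖ = 1 ∧ x.2 = 0} := by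
  have hcoe : Continuous fun t : ℝ => (t : UnitAddCircle) := AddCircle.continuous_mk' 1
  have hsurj := QuotientAddGroup.mk_surjective (s := AddSubgroup.zmultiples (1 : ℝ))
  by_cases hne : ∃ s t : ℝ, (κ s).2 ≠ (κ t).2
  · obtain ⟨a, b, hu, hint⟩ := exists_isUnimodal (γ := fun t : ℝ => κ t) (by fun_prop)
      (fun t => by simp only [AddCircle.coe_add_period]) (fun s t hst hts e => by
        have : Fact ((0 : ℝ) < 1) := ⟨one_pos⟩
        exact hst.ne ((AddCircle.coe_eq_coe_iff_of_mem_Ico (p := (1 : ℝ)) (a := s)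
          ⟨le_rfl, by linarith⟩ ⟨hst.le, hts⟩).1 (hinj e))) h2 hne
    have := hu.isotopicIn_circle hint
    rwa [show range (fun t : ℝ => κ t) = range κ from hsurj.range_comp κ] at this
  · push Not at hne
    refine isotopicIn_circle_of_const hκ hinj (z₀ := (κ (0 : ℝ)).2) fun θ => ?_
    obtain ⟨t, rfl⟩ := hsurj θ
    exact hne t 0

/-- Euclidean three-space as the product of the horizontal plane, regarded as `ℂ`, and the vertical
axis. -/
def planeProdAxis : E3 ≃ₜ ℂ × ℝ where
  toFun x := (x 0 + x 1 * Complex.I, x 2)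
  invFun p := WithLp.toLp 2 ![p.1.re, p.1.im, p.2]
  left_inv x := by ext i; fin_cases i <;> simp
  right_inv p := by ext <;> simp
  continuous_toFun := by fun_prop
  continuous_invFun := by
    refine (PiLp.continuous_toLp 2 _).comp (continuous_pi fun i => ?_)
    fin_cases i <;> simp <;> fun_prop

theorem planeProdAxis_symm_image_circle :
    planeProdAxis.symm '' {x | ‖x.1‖ = 1 ∧ x.2 = 0} = standardCircle := by
  rw [Homeomorph.image_symm]
  ext x
  have : ‖(planeProdAxis x).1‖ = 1 ↔ x 0 ^ 2 + x 1 ^ 2 = 1 := by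
    rw [← sq_eq_sq₀ (norm_nonneg _) zero_le_one, ← Complex.normSq_eq_norm_sq, Complex.normSq_apply]
    simp [planeProdAxis, sq]
  exact and_congr this Iff.rfl

/-- A knot with a height function that does not have two peaks is trivial: two shears, each isotopic
to the identity, turn the functional `⟨v, ·⟩` into a nonzero multiple of the height. -/
theorem Knot.isTrivial_of_not_hasZigzag (K : Knot) {v : E3} (hv : v ≠ 0)
    (h2 : ¬ HasZigzag 2 fun t => inner ℝ v (K.lift t)) : K.IsTrivial := by
  -- the shear by `c` makes the vertical coefficient of the functional nonzero
  obtain ⟨c, hc⟩ : ∃ c : ℂ, v 2 - v 0 * c.re - v 1 * c.im ≠ 0 := by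
    by_cases h : v 2 = 0
    · refine ⟨⟨v 0, v 1⟩, fun h0 => hv ?_⟩
      simp only [h] at h0
      have e0 : v 0 = 0 := by nlinarith [sq_nonneg (v 0), sq_nonneg (v 1)]
      have e1 : v 1 = 0 := by nlinarith [sq_nonneg (v 0), sq_nonneg (v 1)]
      ext i
      fin_cases i <;> assumption
    · exact ⟨0, by simpa using h⟩
  set δ : ℝ := v 2 - v 0 * c.re - v 1 * c.im with hδ
  let ℓ : ℂ → ℝ := fun w => (v 0 * w.re + v 1 * w.im) / δ
  have hℓ : Continuous ℓ := by fun_prop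
  have hK := K.continuous_toFun
  let f : ℂ × ℝ → ℂ × ℝ := fun x => (x.1 + c * x.2, x.2)
  let g : ℂ × ℝ → ℂ × ℝ := fun x => (x.1, x.2 + ℓ x.1)
  have hf : Function.Injective f := fun x y e => by
    simp only [f, Prod.mk.injEq] at e
    refine Prod.ext ?_ e.2
    have := e.1
    rwa [e.2, add_left_inj] at this
  have hg : Function.Injective g := fun x y e => by
    simp only [g, Prod.mk.injEq] at e
    refine Prod.ext e.1 ?_
    have := e.2
    rwa [e.1, add_left_inj] at this
  let κ : UnitAddCircle → ℂ × ℝ := fun θ => g (f (planeProdAxis (K.toFun θ)))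
  have h1 : IsotopicIn (planeProdAxis '' K.image) (range κ) := by
    have i1 := isotopicIn_translate (m := fun z => c * z) (by fun_prop) (planeProdAxis '' K.image)
    have i2 := isotopicIn_vertical (G := fun x => ℓ x.1) (by fun_prop) (fun _ _ _ _ => le_rfl)
      (f '' (planeProdAxis '' K.image))
    have e : g '' (f '' (planeProdAxis '' K.image)) = range κ := by
      rw [Knot.image, ← range_comp, ← range_comp, ← range_comp]; rfl
    exact i1.trans (e ▸ i2)
  have h3 : IsotopicIn (range κ) {x | ‖x.1‖ = 1 ∧ x.2 = 0} := by
    refine isotopicIn_circle_of_not_hasZigzag (by fun_prop)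
      (hg.comp (hf.comp (planeProdAxis.injective.comp K.injective_toFun))) fun h => h2 ?_
    convert h.const_mul hc using 2 with t
    have : δ * (κ t).2 = v 0 * (K.toFun t) 0 + v 1 * (K.toFun t) 1 + v 2 * (K.toFun t) 2 := by
      simp only [κ, f, g, ℓ, planeProdAxis, Homeomorph.homeomorph_mk_coe, Equiv.coe_fn_mk]
      rw [mul_add, mul_div_cancel₀ _ hc, hδ]
      simp
      ring
    rw [this]
    simp [Knot.lift, PiLp.inner_apply, Fin.sum_univ_three, mul_comm]
  have := (h1.trans h3).image planeProdAxis.symm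
  rw [planeProdAxis_symm_image_circle, ← image_comp] at this
  rwa [planeProdAxis.symm_comp_self, image_id] at this

end Reduction

theorem mainTheorem5 (K : Knot) (htame : K.IsTame) (hnontrivial : ¬ K.IsTrivial) :
    ENNReal.ofReal (4 * Real.pi) < K.totalCurvature :=
  K.four_pi_lt_totalCurvature fun _ hv => by_contra fun h2 =>
    hnontrivial (K.isTrivial_of_not_hasZigzag hv h2)

end
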